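/- Let $n\ge 1$ and let $\Omega\subset\mathbb{R}^n$ be a bounded Lipschitz domain, i.e. a nonempty bounded connected open set that near each boundary point is, in suitable orthonormal coordinates, the region above the graph of a Lipschitz function. For $\alpha\in\mathbb{R}$ and $k=1,2,\dots$ let $$\lambda_k(\Omega;\alpha)=\min_{U_k}\ \max_{u\in U_k\setminus\{0\}}\ \frac{\int_\Omega|\nabla u|^2\,dx+\alpha\int_{\partial\Omega}u^2\,dS}{\int_\Omega u^2\,dx},$$ where $U_k$ ranges over all $k$-dimensional subspaces of $H^1(\Omega)$ and boundary values are taken in the sense of traces; these are the eigenvalues of the Robin Laplacian ($-\Delta u=\lambda u$ in $\Omega$, $\partial u/\partial\nu+\alpha u=0$ on $\partial\Omega$). Let $\sigma_1(\Omega)$ be the first nonzero eigenvalue of the Steklov problem $\Delta u=0$ in $\Omega$, $\partial u/\partial\nu=\sigma u$ on $\partial\Omega$ (in the weak sense: $u\in H^1(\Omega)\setminus\{0\}$ and $\int_\Omega\nabla u\cdot\nabla w\,dx=\sigma\int_{\partial\Omega}uw\,dS$ for all $w\in H^1(\Omega)$). **Theorem (monotonicity of $\alpha$ times the spectral ratio).**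 The number $\sigma_1(\Omega)$ exists, i.e. the set of nonzero Steklov eigenvalues has a least element; one has $\lambda_1(\Omega;\alpha)=0$ if and only if $\alpha=0$, and $\lambda_2(\Omega;\alpha)>0$ if and only if $\alpha>-\sigma_1(\Omega)$; and the map $$\alpha\mapsto\alpha\,\frac{\lambda_2(\Omega;\alpha)}{\lambda_1(\Omega;\alpha)}$$ is increasing (in the sense of nondecreasing) on $\{\alpha\in\mathbb{R}:\alpha>-\sigma_1(\Omega),\ \alpha\neq 0\}$; that is, if $-\sigma_1(\Omega)<\alpha\le\beta$ and $\alpha,\beta\ne 0$ (possibly of opposite signs), then $\alpha\lambda_2(\Omega;\alpha)/\lambda_1(\Omega;\alpha)\le\beta\lambda_2(\Omega;\beta)/\lambda_1(\Omega;\beta)$. -/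

import Mathlib

open MeasureTheory Filter Topology
open scoped ContDiff

noncomputable section

namespace Robin

/-- Euclidean space `ℝⁿ`. -/
abbrev E (n : ℕ) := EuclideanSpace ℝ (Fin n)

/-- Bounded Lipschitz domain: a nonempty, connected, bounded open set which, near each of its
boundary points, is the strict epigraph of a Lipschitz function in suitable orthonormal
coordinates. Here `e` is the unit vector of the vertical axis, `inner ℝ e x` is the height of `x`,
and `x - inner ℝ e x • e` is its projection onto the hyperplane orthogonal to `e`. -/
structure IsBoundedLipschitzDomain {n : ℕ} (Ω : Set (E n)) : Prop where
  isOpen : IsOpen Ω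
  isConnected : IsConnected Ω
  isBounded : Bornology.IsBounded Ω
  lipschitz_boundary : ∀ p ∈ frontier Ω, ∃ e : E n, ‖e‖ = 1 ∧
    ∃ (K : NNReal) (γ : E n → ℝ), LipschitzWith K γ ∧
      ∀ᶠ x in 𝓝 p, (x ∈ Ω ↔ γ (x - inner ℝ e x • e) < inner ℝ e x)

/-- Lebesgue measure on `Ω`. -/
abbrev vol {n : ℕ} (Ω : Set (E n)) : Measure (E n) := volume.restrict Ω

/-- Surface measure on `∂Ω`: the `(n-1)`-dimensional Hausdorff measure (normalised so that it is
Lebesgue measure on `ℝⁿ⁻¹`), restricted to the boundary. -/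
abbrev surf {n : ℕ} (Ω : Set (E n)) : Measure (E n) :=
  (Measure.euclideanHausdorffMeasure (n - 1)).restrict (frontier Ω)

/-- `G` is the weak gradient of `u` on `Ω`:
`∫_Ω u ∂ᵥφ dx = - ∫_Ω φ ⟨G, v⟩ dx` for every `φ ∈ C_c^∞(Ω)` and every direction `v`. -/
def HasWeakGradient {n : ℕ} (Ω : Set (E n)) (u : E n → ℝ) (G : E n → E n) : Prop :=
  ∀ φ : E n → ℝ, ContDiff ℝ ∞ φ → HasCompactSupport φ → tsupport φ ⊆ Ω → ∀ v : E n,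
    ∫ x in Ω, u x * fderiv ℝ φ x v = - ∫ x in Ω, φ x * inner ℝ (G x) v

lemma integrable_left {n : ℕ} {Ω : Set (E n)} (u : Lp ℝ 2 (vol Ω)) {φ : E n → ℝ}
    (hφ : ContDiff ℝ ∞ φ) (hc : HasCompactSupport φ) (v : E n) :
    Integrable (fun x => u x * fderiv ℝ φ x v) (vol Ω) := by
  have hcont : Continuous (fun x => fderiv ℝ φ x v) :=
    (hφ.continuous_fderiv (by simp)).clm_apply continuous_const
  have hcs : HasCompactSupport (fun x => fderiv ℝ φ x v) := hc.fderiv_apply (𝕜 := ℝ) v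
  have h2 : MemLp (fun x => fderiv ℝ φ x v) 2 (vol Ω) :=
    (hcont.memLp_of_hasCompactSupport hcs (μ := volume)).restrict Ω
  exact (Lp.memLp u).integrable_mul h2

lemma integrable_right {n : ℕ} {Ω : Set (E n)} (G : Lp (E n) 2 (vol Ω)) {φ : E n → ℝ}
    (hφ : ContDiff ℝ ∞ φ) (hc : HasCompactSupport φ) (v : E n) :
    Integrable (fun x => φ x * inner ℝ (G x) v) (vol Ω) := by
  have h2 : MemLp φ 2 (vol Ω) :=
    (hφ.continuous.memLp_of_hasCompactSupport hc (μ := volume)).restrict Ω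
  exact h2.integrable_mul ((Lp.memLp G).inner_const v)

/-- The Sobolev space `H¹(Ω)`: the functions `u ∈ L²(Ω)` with a weak gradient `∇u ∈ L²(Ω; ℝⁿ)`.
An element is stored as the pair `(u, ∇u)`; the second component is determined by the first. -/
def H1 {n : ℕ} (Ω : Set (E n)) : Submodule ℝ (Lp ℝ 2 (vol Ω) × Lp (E n) 2 (vol Ω)) where
  carrier := {p | HasWeakGradient Ω p.1 p.2}
  zero_mem' := by
    intro φ hφ hc hs v
    have h1 : ∫ x in Ω, (0 : Lp ℝ 2 (vol Ω)) x * fderiv ℝ φ x v = ∫ x in Ω, (0 : ℝ) := by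
      refine integral_congr_ae ?_
      filter_upwards [Lp.coeFn_zero ℝ 2 (vol Ω)] with x hx
      rw [hx]; simp
    have h2 : ∫ x in Ω, φ x * inner ℝ ((0 : Lp (E n) 2 (vol Ω)) x) v = ∫ x in Ω, (0 : ℝ) := by
      refine integral_congr_ae ?_
      filter_upwards [Lp.coeFn_zero (E n) 2 (vol Ω)] with x hx
      rw [hx]; simp
    simpa using h1.trans (by rw [show (∫ x in Ω, (0 : ℝ)) = -∫ x in Ω, (0 : ℝ) by simp, ← h2]; rfl)
  add_mem' := by
    rintro ⟨u, G⟩ ⟨w, H⟩ hu hw φ hφ hc hs v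
    have h1 : ∫ x in Ω, (u + w : Lp ℝ 2 (vol Ω)) x * fderiv ℝ φ x v
        = ∫ x in Ω, (u x * fderiv ℝ φ x v + w x * fderiv ℝ φ x v) := by
      refine integral_congr_ae ?_
      filter_upwards [Lp.coeFn_add u w] with x hx
      rw [hx, Pi.add_apply, add_mul]
    have h2 : ∫ x in Ω, φ x * inner ℝ ((G + H : Lp (E n) 2 (vol Ω)) x) v
        = ∫ x in Ω, (φ x * inner ℝ (G x) v + φ x * inner ℝ (H x) v) := by
      refine integral_congr_ae ?_
      filter_upwards [Lp.coeFn_add G H] with x hx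
      rw [hx, Pi.add_apply, inner_add_left, mul_add]
    have e1 := hu φ hφ hc hs v
    have e2 := hw φ hφ hc hs v
    rw [integral_add (integrable_left u hφ hc v) (integrable_left w hφ hc v)] at h1
    rw [integral_add (integrable_right G hφ hc v) (integrable_right H hφ hc v)] at h2
    change ∫ x in Ω, (u + w : Lp ℝ 2 (vol Ω)) x * fderiv ℝ φ x v
      = - ∫ x in Ω, φ x * inner ℝ ((G + H : Lp (E n) 2 (vol Ω)) x) v
    rw [h1, h2, neg_add]
    exact congrArg₂ (· + ·) e1 e2
  smul_mem' := by
    rintro c ⟨u, G⟩ hu φ hφ hc hs v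
    have h1 : ∫ x in Ω, (c • u : Lp ℝ 2 (vol Ω)) x * fderiv ℝ φ x v
        = ∫ x in Ω, c * (u x * fderiv ℝ φ x v) := by
      refine integral_congr_ae ?_
      filter_upwards [Lp.coeFn_smul c u] with x hx
      rw [hx, Pi.smul_apply, smul_eq_mul, mul_assoc]
    have h2 : ∫ x in Ω, φ x * inner ℝ ((c • G : Lp (E n) 2 (vol Ω)) x) v
        = ∫ x in Ω, c * (φ x * inner ℝ (G x) v) := by
      refine integral_congr_ae ?_
      filter_upwards [Lp.coeFn_smul c G] with x hx
      rw [hx, Pi.smul_apply, real_inner_smul_left]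
      ring
    have e1 := hu φ hφ hc hs v
    rw [integral_const_mul] at h1 h2
    change ∫ x in Ω, (c • u : Lp ℝ 2 (vol Ω)) x * fderiv ℝ φ x v
      = - ∫ x in Ω, φ x * inner ℝ ((c • G : Lp (E n) 2 (vol Ω)) x) v
    rw [h1, h2, ← mul_neg]
    exact congrArg (c * ·) e1

/-- The function underlying an element of `H¹(Ω)`. -/
def fn {n : ℕ} {Ω : Set (E n)} (u : H1 Ω) : Lp ℝ 2 (vol Ω) := u.1.1

/-- The weak gradient of an element of `H¹(Ω)`. -/
def grad {n : ℕ} {Ω : Set (E n)} (u : H1 Ω) : Lp (E n) 2 (vol Ω) := u.1.2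

/-- `g ∈ L²(∂Ω)` is a boundary trace of `u ∈ H¹(Ω)`: there are smooth functions `φₖ` on `ℝⁿ` which
converge to `u` in `H¹(Ω)` and whose restrictions to the boundary converge to `g` in `L²(∂Ω)`. -/
def IsTrace {n : ℕ} {Ω : Set (E n)} (u : H1 Ω) (g : Lp ℝ 2 (surf Ω)) : Prop :=
  ∃ φ : ℕ → E n → ℝ, (∀ k, ContDiff ℝ ∞ (φ k) ∧ HasCompactSupport (φ k)) ∧
    Tendsto (fun k => eLpNorm (fun x => φ k x - fn u x) 2 (vol Ω)) atTop (𝓝 0) ∧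
    Tendsto (fun k => eLpNorm (fun x => gradient (φ k) x - grad u x) 2 (vol Ω)) atTop (𝓝 0) ∧
    Tendsto (fun k => eLpNorm (fun x => φ k x - g x) 2 (surf Ω)) atTop (𝓝 0)

open Classical in
/-- The trace of `u ∈ H¹(Ω)` on `∂Ω`. On a bounded Lipschitz domain every `u` has exactly one. -/
def trace {n : ℕ} {Ω : Set (E n)} (u : H1 Ω) : Lp ℝ 2 (surf Ω) :=
  if h : ∃ g, IsTrace u g then h.choose else 0

/-- The Rayleigh quotient of the Robin Laplacian,
`(∫_Ω |∇u|² dx + α ∫_∂Ω u² dS) / ∫_Ω u² dx`. -/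
def rayleigh {n : ℕ} {Ω : Set (E n)} (α : ℝ) (u : H1 Ω) : ℝ :=
  ((∫ x in Ω, ‖grad u x‖ ^ 2) + α * (∫ x, (trace u x) ^ 2 ∂(surf Ω))) / (∫ x in Ω, (fn u x) ^ 2)

/-- The `k`-th eigenvalue `λₖ(Ω; α)` (`k = 1, 2, …`) of the Robin Laplacian with parameter `α`,
`min_U max_{u ∈ U \ 0}` of the Rayleigh quotient, `U` ranging over the `k`-dimensional subspaces
of `H¹(Ω)`. -/
def robinEigenvalue {n : ℕ} (Ω : Set (E n)) (k : ℕ) (α : ℝ) : ℝ :=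
  ⨅ U : {U : Submodule ℝ (H1 Ω) // Module.finrank ℝ U = k},
    ⨆ u : {u : H1 Ω // u ∈ U.1 ∧ u ≠ 0}, rayleigh α u.1

/-- `σ` is an eigenvalue of the Steklov problem `Δu = 0` in `Ω`, `∂u/∂ν = σ u` on `∂Ω`, in the weak
sense: some nonzero `u ∈ H¹(Ω)` satisfies `∫_Ω ∇u · ∇w dx = σ ∫_∂Ω u w dS` for all `w ∈ H¹(Ω)`. -/
def IsSteklovEigenvalue {n : ℕ} (Ω : Set (E n)) (σ : ℝ) : Prop :=
  ∃ u : H1 Ω, u ≠ 0 ∧ ∀ w : H1 Ω,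
    ∫ x in Ω, inner ℝ (grad u x) (grad w x) = σ * ∫ x, trace u x * trace w x ∂(surf Ω)

/-- `σ₁(Ω)`, the first nonzero Steklov eigenvalue. -/
def steklovSigma1 {n : ℕ} (Ω : Set (E n)) : ℝ :=
  sInf {σ : ℝ | σ ≠ 0 ∧ IsSteklovEigenvalue Ω σ}

end Robin

end

namespace Robin

open scoped ENNReal NNReal

/-! Write the function as (α/λ₁)·λ₂. The factor λ₂ is nondecreasing in α, because every Rayleigh
quotient is, and it is positive for α > -σ₁. So it suffices that α/λ₁ is positive and nondecreasing
away from 0 (`div_ev_one_mono`). Since λ₁ is an infimum of affine functions of α and vanishes at 0,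
it is concave, which makes λ₁/α nonincreasing on each side of 0. Across 0, testing with the constant
function gives λ₁(α) ≤ tα with t = |∂Ω|/|Ω|. Hence α/λ₁ ≤ 1/t for α < 0 and α/λ₁ ≥ 1/t for α > 0.
Only the inf-sup is used; no Robin eigenfunction is needed.

The threshold -σ₁ comes from minimising the Dirichlet energy among functions whose trace has unit
norm and mean zero (`exists_steklov`). Every two-dimensional space contains a nonzero function with
mean-free trace, which yields λ₂ > 0 above -σ₁ (`ev_two_pos`). Testing with the span of the
constants and the minimiser yields λ₂ ≤ 0 at and below -σ₁ (`ev_two_nonpos`).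

This argument is carried out for an abstract triple of operators (`IsRobinTriple`). Most of the work
is to show that inclusion, gradient and trace on a bounded Lipschitz domain form such a triple
(`exists_trace_structure`). The two main estimates are Friedrichs' inequality and a quantitative
compactness of the trace: ‖Tu‖² is at most ε‖∇u‖² plus finitely many squared functionals of u in L².
This replaces Rellich's theorem, and it follows from moving boundary points into Ω along interior
cones. Density of functions smooth up to the boundary, obtained with mollifiers shifted along the
same cones, carries both estimates to H¹. -/

/-! ### Splitting off a direction, and Hausdorff measure of transversal sets -/

/-- The hyperplane orthogonal to `e`. -/
noncomputable abbrev hyper {n : ℕ} (e : E n) : Submodule ℝ (E n) := (Submodule.span ℝ {e})ᗮ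

/-- The orthogonal projection onto the hyperplane orthogonal to `e`. -/
noncomputable def proj {n : ℕ} (e : E n) : E n →L[ℝ] hyper e := (hyper e).orthogonalProjectionOnto

lemma proj_add_inner_smul {n : ℕ} {e : E n} (he : ‖e‖ = 1) (x : E n) :
    (proj e x : E n) + inner ℝ e x • e = x := by
  have h := (Submodule.span ℝ {e}).starProjection_add_starProjection_orthogonal x
  rw [Submodule.starProjection_unit_singleton ℝ he] at h
  rw [add_comm] at h
  exact h

lemma proj_self {n : ℕ} (e : E n) : proj e e = 0 := by
  exact Submodule.orthogonalProjectionOnto_orthogonalComplement_singleton_eq_zero e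

lemma proj_add_smul {n : ℕ} (e x : E n) (t : ℝ) : proj e (x + t • e) = proj e x := by
  simp [proj_self]

lemma proj_coe {n : ℕ} {e : E n} (y : hyper e) : proj e (y : E n) = y :=
  Submodule.orthogonalProjectionOnto_mem_subspace_eq_self y

lemma norm_proj_le {n : ℕ} (e x : E n) : ‖proj e x‖ ≤ ‖x‖ :=
  Submodule.norm_orthogonalProjectionOnto_apply_le _ x

lemma norm_proj_eq {n : ℕ} {e : E n} (he : ‖e‖ = 1) (x : E n) :
    ‖proj e x‖ = ‖x - inner ℝ e x • e‖ := by
  rw [← eq_sub_of_add_eq (proj_add_inner_smul he x)]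
  rfl

lemma finrank_hyper {n : ℕ} {e : E n} (he : ‖e‖ = 1) : Module.finrank ℝ (hyper e) = n - 1 := by
  have h0 : e ≠ 0 := by rintro rfl; simp at he
  have h := (Submodule.span ℝ {e}).finrank_add_finrank_orthogonal
  rw [finrank_span_singleton h0, finrank_euclideanSpace_fin] at h
  change 1 + Module.finrank ℝ (hyper e) = n at h
  omega

/-- The orthogonal decomposition is a linear isometry from the ℓ² product, whose volume is the
product measure; the unit vector `e` identifies ℝ with the second factor. -/
lemma measurePreserving_hyper {n : ℕ} {e : E n} (he : ‖e‖ = 1) :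
    MeasurePreserving (fun q : hyper e × ℝ => (q.1 : E n) + q.2 • e) volume volume := by
  have h1 : MeasurePreserving (hyper e).orthogonalDecomposition.symm := by
    exact (hyper e).orthogonalDecomposition.symm.measurePreserving
  have h2 := h1.comp (WithLp.volume_preserving_toLp (hyper e) (hyper e)ᗮ)
  have hle : (hyper e)ᗮ = Submodule.span ℝ {e} := Submodule.orthogonal_orthogonal _
  let f : ℝ ≃ₗᵢ[ℝ] (hyper e)ᗮ := (LinearIsometryEquiv.toSpanUnitSingleton e he).trans
    (LinearIsometryEquiv.ofEq _ _ hle.symm)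
  have h3 := h2.comp ((MeasurePreserving.id (volume : Measure (hyper e))).prod f.measurePreserving)
  have h4 : (fun q : hyper e × ℝ => (q.1 : E n) + q.2 • e) =
    ((⇑(hyper e).orthogonalDecomposition.symm ∘ WithLp.toLp 2) ∘ Prod.map id ⇑f) := by
    ext1 q
    simp [f]
  rw [h4]
  exact h3

lemma hausdorff_hyper {n : ℕ} {e : E n} (he : ‖e‖ = 1) :
    (Measure.euclideanHausdorffMeasure (n - 1) : Measure (hyper e)) = volume := by
  rw [← finrank_hyper he]
  exact InnerProductSpace.euclideanHausdorffMeasure_eq_volume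

section Hausdorff

variable {X Y : Type*} [MetricSpace X] [MeasurableSpace X] [BorelSpace X]
  [MetricSpace Y] [MeasurableSpace Y] [BorelSpace Y]

lemma euclideanHausdorffMeasure_image_le {f : X → Y} {K : ℝ≥0} (hf : LipschitzWith K f) (d : ℕ)
    (s : Set X) : Measure.euclideanHausdorffMeasure d (f '' s) ≤
      (K : ℝ≥0∞) ^ d * Measure.euclideanHausdorffMeasure d s := by
  have h := hf.hausdorffMeasure_image_le (d := d) (by positivity) s
  rw [ENNReal.rpow_natCast] at h
  simp only [Measure.euclideanHausdorffMeasure_def, Measure.smul_apply, ENNReal.smul_def,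
    smul_eq_mul]
  rw [mul_left_comm]
  gcongr

lemma le_euclideanHausdorffMeasure_image {f : X → Y} {K : ℝ≥0} {s : Set X}
    (hf : ∀ x ∈ s, ∀ y ∈ s, edist x y ≤ K * edist (f x) (f y)) (d : ℕ) :
    Measure.euclideanHausdorffMeasure d s ≤
      (K : ℝ≥0∞) ^ d * Measure.euclideanHausdorffMeasure d (f '' s) := by
  have ha : AntilipschitzWith K (fun x : s => f x) := fun x y => hf x x.2 y y.2
  have h := ha.le_hausdorffMeasure_image (d := d) (by positivity) Set.univ
  have h2 := (isometry_subtype_coe (s := s)).hausdorffMeasure_image (d := d)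
    (Or.inl (by positivity)) Set.univ
  rw [Set.image_univ, Subtype.range_coe] at h2
  rw [← h2, ENNReal.rpow_natCast] at h
  have h3 : (fun x : s => f x) '' Set.univ = f '' s := by
    rw [Set.image_univ]; ext y; simp
  rw [h3] at h
  simp only [Measure.euclideanHausdorffMeasure_def, Measure.smul_apply, ENNReal.smul_def,
    smul_eq_mul]
  rw [mul_left_comm]
  gcongr

end Hausdorff

/-- On `S` the projection is injective with `K`-Lipschitz inverse, so the pushforward of the
Hausdorff measure on `S` is at most `K ^ (n - 1)` times Lebesgue measure. This inequality stands in
for the area formula. -/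
lemma lintegral_comp_proj_le {n : ℕ} {e : E n} (he : ‖e‖ = 1) {S : Set (E n)}
    {K : ℝ≥0} (hK : ∀ x ∈ S, ∀ y ∈ S, ‖x - y‖ ≤ K * ‖proj e (x - y)‖)
    {F : hyper e → ℝ≥0∞} (hF : Measurable F) :
    ∫⁻ x in S, F (proj e x) ∂(Measure.euclideanHausdorffMeasure (n - 1)) ≤
      (K : ℝ≥0∞) ^ (n - 1) * ∫⁻ y, F y := by
  have hm : Measurable (proj e) := (proj e).continuous.measurable
  have hle : ((Measure.euclideanHausdorffMeasure (n - 1)).restrict S).map (proj e) ≤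
      ((K : ℝ≥0∞) ^ (n - 1)) • (volume : Measure (hyper e)) := by
    refine Measure.le_iff.2 fun A hA => ?_
    rw [Measure.map_apply hm hA, Measure.restrict_apply (hm hA), Measure.smul_apply, smul_eq_mul]
    refine (le_euclideanHausdorffMeasure_image (f := proj e) (K := K) ?_ (n - 1)).trans ?_
    · intro x hx y hy
      have h := hK x hx.2 y hy.2
      rw [map_sub] at h
      rw [edist_eq_enorm_sub, edist_eq_enorm_sub, enorm_eq_nnnorm, enorm_eq_nnnorm]
      exact_mod_cast h
    · rw [hausdorff_hyper he]
      gcongr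
      rintro _ ⟨x, hx, rfl⟩
      exact hx.1
  calc ∫⁻ x in S, F (proj e x) ∂(Measure.euclideanHausdorffMeasure (n - 1))
      = ∫⁻ y, F y ∂(((Measure.euclideanHausdorffMeasure (n - 1)).restrict S).map (proj e)) :=
        (lintegral_map hF hm).symm
    _ ≤ ∫⁻ y, F y ∂(((K : ℝ≥0∞) ^ (n - 1)) • (volume : Measure (hyper e))) :=
        lintegral_mono' hle le_rfl
    _ = _ := by rw [lintegral_smul_measure, smul_eq_mul]

/-- Tonelli along the lines in a unit direction. -/
lemma lintegral_eq_lintegral_hyper {n : ℕ} {e : E n} (he : ‖e‖ = 1) {f : E n → ℝ≥0∞}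
    (hf : Measurable f) : ∫⁻ x, f x = ∫⁻ y : hyper e, ∫⁻ t : ℝ, f ((y : E n) + t • e) := by
  have hm : Measurable (fun q : hyper e × ℝ => (q.1 : E n) + q.2 • e) := by fun_prop
  rw [← (measurePreserving_hyper he).lintegral_comp hf, Measure.volume_eq_prod,
    lintegral_prod (fun q : hyper e × ℝ => f ((q.1 : E n) + q.2 • e)) (hf.comp hm).aemeasurable]

/-- If a set is nowhere nearly parallel to the unit vector `e`, integrating along the lines through
its points is controlled by the Lebesgue integral. -/
lemma lintegral_flow_le {n : ℕ} {e : E n} (he : ‖e‖ = 1) {S : Set (E n)}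
    {κ : ℝ} (hκ : 0 < κ)
    (hcone : ∀ x ∈ S, ∀ y ∈ S, ∀ t : ℝ, κ * |t| ≤ ‖x - y - t • e‖)
    {f : E n → ℝ≥0∞} (hf : Measurable f) :
    ∫⁻ x in S, (∫⁻ t : ℝ, f (x + t • e)) ∂(Measure.euclideanHausdorffMeasure (n - 1)) ≤
      ENNReal.ofReal (1 + 1 / κ) ^ (n - 1) * ∫⁻ x, f x := by
  have hm : Measurable (fun q : hyper e × ℝ => (q.1 : E n) + q.2 • e) := by fun_prop
  have hF : Measurable (fun y : hyper e => ∫⁻ t : ℝ, f ((y : E n) + t • e)) :=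
    (hf.comp hm).lintegral_prod_right'
  have h := lintegral_comp_proj_le he (S := S) (K := (1 + 1 / κ).toNNReal) ?_ hF
  · rw [lintegral_eq_lintegral_hyper he hf]
    refine le_trans (le_of_eq ?_) h
    refine lintegral_congr fun x => ?_
    -- The integral over the whole line through `x` depends only on the projection of `x`: the
    -- height is absorbed by translating `t`.
    conv_lhs => rw [← proj_add_inner_smul he x]
    simp_rw [add_assoc, ← add_smul]
    exact lintegral_add_left_eq_self (fun t => f ((proj e x : E n) + t • e)) (inner ℝ e x)
  · intro x hx y hy
    rw [Real.coe_toNNReal _ (by positivity), norm_proj_eq he]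
    -- With `t` the height difference, the cone condition bounds `|t|` by the horizontal distance
    -- divided by `κ`.
    set t := inner ℝ e (x - y)
    have h1 := hcone x hx y hy t
    have h2 : ‖x - y‖ ≤ ‖x - y - t • e‖ + |t| := by
      calc ‖x - y‖ = ‖(x - y - t • e) + t • e‖ := by rw [sub_add_cancel]
        _ ≤ _ := (norm_add_le _ _).trans (by rw [norm_smul, he, mul_one, Real.norm_eq_abs])
    have h3 : |t| ≤ 1 / κ * ‖x - y - t • e‖ := by
      rw [one_div, ← div_eq_inv_mul, le_div_iff₀ hκ]; linarith
    linarith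

lemma sq_lintegral_le {α : Type*} [MeasurableSpace α] (μ : Measure α) {f : α → ℝ≥0∞}
    (hf : AEMeasurable f μ) : (∫⁻ x, f x ∂μ) ^ 2 ≤ μ Set.univ * ∫⁻ x, f x ^ 2 ∂μ := by
  have h := ENNReal.lintegral_mul_le_Lp_mul_Lq μ (p := 2) (q := 2) ⟨by norm_num, by norm_num, by norm_num⟩
    hf (aemeasurable_const (b := (1 : ℝ≥0∞)))
  simp only [Pi.mul_apply, mul_one, ENNReal.one_rpow, lintegral_const, one_mul] at h
  have h2 := pow_le_pow_left₀ zero_le h 2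
  refine h2.trans (le_of_eq ?_)
  rw [mul_pow, ← ENNReal.rpow_natCast, ← ENNReal.rpow_natCast, ← ENNReal.rpow_mul,
    ← ENNReal.rpow_mul]
  norm_num [mul_comm]

/-! ### Interior cones and transport of the boundary into the domain -/

/-- Uniform interior cone with axis `e` at the points of `closure Ω` near `p`. -/
def HasCone {n : ℕ} (Ω : Set (E n)) (p e : E n) (c r h : ℝ) : Prop :=
  ∀ x ∈ closure Ω, dist x p < r → ∀ t : ℝ, 0 < t → t < h → Metric.ball (x + t • e) (c * t) ⊆ Ω

/-- With axis `0` the condition only asks that small balls about `x` lie in `Ω`. Interior points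
thus fit the same predicate as boundary points, and the later patching need not distinguish them. -/
lemma exists_hasCone_of_mem {n : ℕ} {Ω : Set (E n)} (hΩ : IsOpen Ω) {p : E n} (hp : p ∈ Ω) :
    ∃ (e : E n) (c r h : ℝ), 0 < c ∧ 0 < r ∧ 0 < h ∧ HasCone Ω p e c r h := by
  obtain ⟨R, hR, hb⟩ := Metric.isOpen_iff.1 hΩ p hp
  refine ⟨0, 1, R / 2, R / 2, one_pos, by positivity, by positivity, ?_⟩
  intro x _ hxp t _ ht y hy
  refine hb ?_
  rw [smul_zero, add_zero, one_mul, Metric.mem_ball] at hy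
  rw [Metric.mem_ball]
  linarith [dist_triangle y x p]

/-- Points of the closure lie weakly above the graph. Moving up by `t` gains height `t`, while a
further displacement `z` costs at most `(K + 1) * ‖z‖` in height and graph together; the aperture is
chosen so that this cost stays below `t / 2`. -/
lemma exists_hasCone_of_mem_frontier {n : ℕ} {Ω : Set (E n)} (hΩ : IsBoundedLipschitzDomain Ω)
    {p : E n} (hp : p ∈ frontier Ω) :
    ∃ (e : E n) (c r h : ℝ), 0 < c ∧ 0 < r ∧ 0 < h ∧ HasCone Ω p e c r h := by
  obtain ⟨e, he, K, γ, hγ, hev⟩ := hΩ.lipschitz_boundary p hp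
  obtain ⟨R, hR, hb⟩ := Metric.eventually_nhds_iff_ball.1 hev
  have hK : (0 : ℝ) ≤ K := K.2
  have hKp : (0 : ℝ) < 2 * (K + 1) := by positivity
  have hc1 : 1 / (2 * ((K : ℝ) + 1)) ≤ 1 := by rw [div_le_one hKp]; linarith
  refine ⟨e, 1 / (2 * (K + 1)), R / 2, R / 4, by positivity, by positivity, by positivity, ?_⟩
  intro x hx hxp t ht htR y hy
  set c := 1 / (2 * ((K : ℝ) + 1)) with hc
  have hcK : c * (K + 1) = 1 / 2 := by rw [hc]; field_simp
  have hle : γ (x - inner ℝ e x • e) ≤ inner ℝ e x := by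
    have hcl : x ∈ closure (Ω ∩ Metric.ball p R) := by
      refine mem_closure_iff_nhds.2 fun s hs => ?_
      have h2 : s ∩ Metric.ball p R ∈ 𝓝 x := inter_mem hs
        (Metric.isOpen_ball.mem_nhds (by rw [Metric.mem_ball]; linarith))
      obtain ⟨z, hz⟩ := mem_closure_iff_nhds.1 hx _ h2
      exact ⟨z, hz.1.1, hz.2, hz.1.2⟩
    have hclosed : IsClosed {z : E n | γ (z - inner ℝ e z • e) ≤ inner ℝ e z} :=
      isClosed_le (hγ.continuous.comp (by fun_prop)) (by fun_prop)
    exact closure_minimal (fun z hz => ((hb z hz.2).1 hz.1).le) hclosed hcl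
  rw [Metric.mem_ball, dist_eq_norm] at hy
  set z := y - (x + t • e) with hz
  have hyx : y = x + t • e + z := by rw [hz]; abel
  have hinz : |inner ℝ e z| ≤ ‖z‖ := by
    have := abs_real_inner_le_norm e z
    rwa [he, one_mul] at this
  have hee : inner ℝ e e = (1 : ℝ) := by rw [real_inner_self_eq_norm_sq, he]; norm_num
  have hin : inner ℝ e y = inner ℝ e x + t + inner ℝ e z := by
    rw [hyx, inner_add_right, inner_add_right, inner_smul_right, hee, mul_one]
  have hyp : y ∈ Metric.ball p R := by
    rw [Metric.mem_ball]
    have h1 : dist y x ≤ t + ‖z‖ := by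
      rw [dist_eq_norm, hyx]
      calc ‖x + t • e + z - x‖ = ‖t • e + z‖ := by congr 1; abel
        _ ≤ _ := (norm_add_le _ _).trans (by rw [norm_smul, he, mul_one, Real.norm_of_nonneg ht.le])
    have h2 : c * t ≤ t := by nlinarith
    linarith [dist_triangle y x p]
  refine (hb y hyp).2 ?_
  have hlip := hγ.dist_le_mul (y - inner ℝ e y • e) (x - inner ℝ e x • e)
  have hd : dist (y - inner ℝ e y • e) (x - inner ℝ e x • e) ≤ ‖z‖ := by
    have h1 : y - inner ℝ e y • e - (x - inner ℝ e x • e) = z - inner ℝ e z • e := by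
      rw [hin, hyx]; module
    rw [dist_eq_norm, h1, ← norm_proj_eq he]
    exact norm_proj_le e z
  rw [Real.dist_eq] at hlip
  have h3 := (le_abs_self _).trans hlip
  have h4 : (K : ℝ) * dist (y - inner ℝ e y • e) (x - inner ℝ e x • e) ≤ K * ‖z‖ := by gcongr
  have h5 := (abs_le.1 hinz).1
  have h6 : (K + 1) * ‖z‖ < t := by
    calc (K + 1) * ‖z‖ ≤ (K + 1) * (c * t) := by gcongr
      _ = t / 2 := by rw [← mul_assoc, mul_comm _ c, hcK]; ring
      _ < t := by linarith
  linarith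

lemma exists_hasCone {n : ℕ} {Ω : Set (E n)} (hΩ : IsBoundedLipschitzDomain Ω)
    {p : E n} (hp : p ∈ closure Ω) :
    ∃ (e : E n) (c r h : ℝ), 0 < c ∧ 0 < r ∧ 0 < h ∧ HasCone Ω p e c r h := by
  by_cases h : p ∈ Ω
  · exact exists_hasCone_of_mem hΩ.isOpen h
  · exact exists_hasCone_of_mem_frontier hΩ (by rw [frontier, hΩ.isOpen.interior_eq]; exact ⟨hp, h⟩)

lemma notMem_of_mem_frontier {n : ℕ} {Ω : Set (E n)} (hΩ : IsOpen Ω) {x : E n}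
    (hx : x ∈ frontier Ω) : x ∉ Ω := by
  rw [frontier, hΩ.interior_eq] at hx
  exact hx.2

/-- Integrating along short segments which enter `Ω` from its boundary is controlled by the Lebesgue
integral over `Ω`, uniformly for directions near the axis of the cone. -/
lemma exists_lintegral_frontier_flow_le {n : ℕ} {Ω : Set (E n)} (hΩ : IsOpen Ω) {p e : E n}
    (hp : p ∈ frontier Ω) {c r h : ℝ} (hc : 0 < c) (hr : 0 < r) (hh : 0 < h)
    (hcone : HasCone Ω p e c r h) :
    ∃ r' : ℝ, 0 < r' ∧ r' ≤ r ∧ ∃ C : ℝ≥0, ∀ (t : ℝ) (w : E n), 0 < t → t < h →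
      ‖w - t • e‖ < c / 2 * t → w ≠ 0 ∧ ‖w‖ ≤ C * t ∧
      (∀ x ∈ frontier Ω ∩ Metric.ball p r', ∀ s ∈ Set.Ioo 0 ‖w‖, x + s • (‖w‖⁻¹ • w) ∈ Ω) ∧
      ∀ g : E n → ℝ≥0∞, Measurable g →
        ∫⁻ x in frontier Ω ∩ Metric.ball p r', (∫⁻ s in Set.Ioo 0 ‖w‖, g (x + s • (‖w‖⁻¹ • w)))
          ∂(Measure.euclideanHausdorffMeasure (n - 1)) ≤ C * ∫⁻ x in Ω, g x := by
  set M := ‖e‖ + c with hM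
  have hMpos : 0 < M := by positivity
  set κ := c / (4 * M) with hκ
  have hκpos : 0 < κ := by positivity
  -- The boundary point `p` lies outside the open set `Ω`, hence outside the balls of its own cone;
  -- in particular `e ≠ 0`.
  have hce : c ≤ ‖e‖ := by
    have h1 := hcone p (frontier_subset_closure hp) (by simpa using hr) (h / 2) (by positivity)
      (by linarith)
    have h2 : p ∉ Metric.ball (p + (h / 2) • e) (c * (h / 2)) :=
      fun hmem => notMem_of_mem_frontier hΩ hp (h1 hmem)
    rw [Metric.mem_ball, not_lt, dist_eq_norm, sub_add_cancel_left, norm_neg, norm_smul,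
      Real.norm_of_nonneg (by positivity), mul_comm] at h2
    exact le_of_mul_le_mul_left h2 (by positivity)
  -- The bound `c * h / 8` keeps distances within `S` below `c * h / 4`, which is what settles times
  -- beyond `h`, where the cone says nothing.
  refine ⟨min r (c * h / 8), by positivity, min_le_left _ _,
    max (M.toNNReal) ((1 + 1 / κ).toNNReal ^ (n - 1)), ?_⟩
  intro t w ht hth hw
  set S := frontier Ω ∩ Metric.ball p (min r (c * h / 8)) with hS
  obtain ⟨e', rfl⟩ : ∃ e', w = t • e' := ⟨t⁻¹ • w, by rw [smul_inv_smul₀ ht.ne']⟩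
  have hee : ‖e' - e‖ < c / 2 := by
    rw [← smul_sub, norm_smul, Real.norm_of_nonneg ht.le, mul_comm] at hw
    exact lt_of_mul_lt_mul_right hw ht.le
  have he'1 : c / 2 ≤ ‖e'‖ := by
    have := norm_sub_norm_le e e'
    rw [norm_sub_rev] at this; linarith
  have he'2 : ‖e'‖ ≤ M := by
    have := norm_sub_norm_le e' e
    linarith
  have he'pos : 0 < ‖e'‖ := by linarith
  have he'0 : e' ≠ 0 := norm_pos_iff.1 he'pos
  have hunit : ‖t • e'‖⁻¹ • t • e' = ‖e'‖⁻¹ • e' := by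
    rw [norm_smul, Real.norm_of_nonneg ht.le, smul_smul]
    congr 1; field_simp
  have hnorm : ‖t • e'‖ = t * ‖e'‖ := by rw [norm_smul, Real.norm_of_nonneg ht.le]
  have hmem : ∀ x ∈ S, ∀ σ : ℝ, 0 < σ → σ < h → x + σ • e' ∈ Ω := by
    intro x hx σ hσ hσh
    refine hcone x (frontier_subset_closure hx.1) (lt_of_lt_of_le hx.2 (min_le_left _ _)) σ hσ hσh ?_
    rw [Metric.mem_ball, dist_eq_norm, add_sub_add_left_eq_sub, ← smul_sub, norm_smul,
      Real.norm_of_nonneg hσ.le, mul_comm]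
    gcongr; linarith
  -- Before time `h`, `x` lies outside the cone ball about `y + σ • e`, and replacing `e` by `e'`
  -- loses at most half its radius. After time `h`, the displacement `σ • e'` has length at least `c
  -- / 2 * σ`, and `S` is too small to cancel more than half of it.
  have hpos : ∀ x ∈ S, ∀ y ∈ S, ∀ σ : ℝ, 0 < σ → c / 4 * σ ≤ ‖x - y - σ • e'‖ := by
    intro x hx y hy σ hσ
    rcases lt_or_ge σ h with hσh | hσh
    · have h1 := hcone y (frontier_subset_closure hy.1) (lt_of_lt_of_le hy.2 (min_le_left _ _))
        σ hσ hσh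
      have h2 : x ∉ Metric.ball (y + σ • e) (c * σ) :=
        fun hmem => notMem_of_mem_frontier hΩ hx.1 (h1 hmem)
      rw [Metric.mem_ball, not_lt, dist_eq_norm] at h2
      have h3 : ‖x - (y + σ • e)‖ ≤ ‖x - y - σ • e'‖ + σ * ‖e' - e‖ := by
        calc ‖x - (y + σ • e)‖ = ‖(x - y - σ • e') + σ • (e' - e)‖ := by congr 1; module
          _ ≤ _ := (norm_add_le _ _).trans (by rw [norm_smul, Real.norm_of_nonneg hσ.le])
      nlinarith
    · have h1 : ‖x - y‖ ≤ c * h / 4 := by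
        have hx2 := lt_of_lt_of_le hx.2 (min_le_right r (c * h / 8))
        have hy2 := lt_of_lt_of_le hy.2 (min_le_right r (c * h / 8))
        rw [← dist_eq_norm]
        linarith [dist_triangle_right x y p]
      have h2 : σ * ‖e'‖ ≤ ‖x - y - σ • e'‖ + ‖x - y‖ := by
        calc σ * ‖e'‖ = ‖σ • e'‖ := by rw [norm_smul, Real.norm_of_nonneg hσ.le]
          _ = ‖(x - y) - (x - y - σ • e')‖ := by congr 1; abel
          _ ≤ _ := (norm_sub_le _ _).trans (by rw [add_comm])
      have h3 : σ * (c / 2) ≤ σ * ‖e'‖ := by gcongr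
      have h4 : c * h ≤ c * σ := by gcongr
      linarith
  have hall : ∀ x ∈ S, ∀ y ∈ S, ∀ σ : ℝ, c / 4 * |σ| ≤ ‖x - y - σ • e'‖ := by
    intro x hx y hy σ
    rcases lt_trichotomy σ 0 with hσ | hσ | hσ
    · have h1 := hpos y hy x hx (-σ) (by linarith)
      rw [abs_of_neg hσ]
      refine h1.trans (le_of_eq ?_)
      rw [← norm_neg]; congr 1; module
    · rw [hσ]; simp
    · rw [abs_of_pos hσ]; exact hpos x hx y hy σ hσ
  rw [hunit, hnorm]
  have hpt : ∀ x ∈ S, ∀ s ∈ Set.Ioo 0 (t * ‖e'‖), x + s • (‖e'‖⁻¹ • e') ∈ Ω := by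
    intro x hx s hs
    rw [smul_smul]
    refine hmem x hx _ (by have := hs.1; positivity) (lt_trans ?_ hth)
    rw [← div_eq_mul_inv, div_lt_iff₀ he'pos]; exact hs.2
  refine ⟨smul_ne_zero ht.ne' he'0, ?_, hpt, ?_⟩
  · rw [mul_comm]
    gcongr
    refine he'2.trans (le_trans ?_ (NNReal.coe_le_coe.2 (le_max_left _ _)))
    rw [Real.coe_toNNReal _ hMpos.le]
  · intro g hg
    have hcone2 : ∀ x ∈ S, ∀ y ∈ S, ∀ τ : ℝ, κ * |τ| ≤ ‖x - y - τ • (‖e'‖⁻¹ • e')‖ := by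
      intro x hx y hy τ
      rw [smul_smul]
      refine le_trans ?_ (hall x hx y hy _)
      rw [abs_mul, abs_of_pos (inv_pos.2 he'pos), hκ]
      have h1 : 1 / M ≤ ‖e'‖⁻¹ := by rw [one_div]; gcongr
      calc c / (4 * M) * |τ| = c / 4 * (|τ| * (1 / M)) := by field_simp
        _ ≤ _ := by gcongr
    have hflow := lintegral_flow_le (norm_smul_inv_norm (𝕜 := ℝ) he'0) hκpos hcone2
      (hg.indicator hΩ.measurableSet)
    rw [lintegral_indicator hΩ.measurableSet] at hflow
    have hSm : MeasurableSet S := isClosed_frontier.measurableSet.inter measurableSet_ball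
    calc _ ≤ ∫⁻ x in S, (∫⁻ τ : ℝ, Ω.indicator g (x + τ • (‖e'‖⁻¹ • e')))
          ∂(Measure.euclideanHausdorffMeasure (n - 1)) := by
          refine setLIntegral_mono' hSm fun x hx => ?_
          rw [← lintegral_indicator measurableSet_Ioo]
          refine lintegral_mono fun s => ?_
          by_cases hs : s ∈ Set.Ioo 0 (t * ‖e'‖)
          · rw [Set.indicator_of_mem hs, Set.indicator_of_mem (hpt x hx s hs)]
          · rw [Set.indicator_of_notMem hs]; exact zero_le
      _ ≤ _ := hflow
      _ ≤ _ := by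
          gcongr
          rw [ENNReal.ofReal, ← ENNReal.coe_pow]
          exact_mod_cast le_max_right _ _

/-- The fundamental theorem of calculus along the segment, then Cauchy–Schwarz on an interval of
length `ℓ`. -/
lemma enorm_sub_sq_le_lintegral {n : ℕ} {φ : E n → ℝ} (hφ : ContDiff ℝ 1 φ) {e : E n}
    (he : ‖e‖ = 1) (x : E n) {ℓ : ℝ} (hℓ : 0 ≤ ℓ) :
    ‖φ (x + ℓ • e) - φ x‖ₑ ^ 2 ≤
      ENNReal.ofReal ℓ * ∫⁻ s in Set.Ioo 0 ℓ, ‖fderiv ℝ φ (x + s • e)‖ₑ ^ 2 := by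
  have hcont : Continuous (fun s : ℝ => fderiv ℝ φ (x + s • e)) :=
    (hφ.continuous_fderiv one_ne_zero).comp (by fun_prop)
  have hderiv : ∀ s : ℝ, HasDerivAt (fun s : ℝ => φ (x + s • e)) (fderiv ℝ φ (x + s • e) e) s := by
    intro s
    have h1 : HasDerivAt (fun s : ℝ => x + s • e) e s := by
      simpa using ((hasDerivAt_id s).smul_const e).const_add x
    exact ((hφ.differentiable one_ne_zero) (x + s • e)).hasFDerivAt.comp_hasDerivAt s h1
  have hint := intervalIntegral.integral_eq_sub_of_hasDerivAt (a := 0) (b := ℓ)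
    (fun s _ => hderiv s) ((hcont.clm_apply continuous_const).intervalIntegrable _ _)
  rw [zero_smul, add_zero, intervalIntegral.integral_of_le hℓ] at hint
  rw [← hint]
  calc ‖∫ s in Set.Ioc 0 ℓ, fderiv ℝ φ (x + s • e) e‖ₑ ^ 2
      ≤ (∫⁻ s in Set.Ioc 0 ℓ, ‖fderiv ℝ φ (x + s • e)‖ₑ) ^ 2 := by
        gcongr
        refine (enorm_integral_le_lintegral_enorm _).trans (lintegral_mono fun s => ?_)
        refine (ContinuousLinearMap.le_opENorm _ _).trans ?_
        rw [← ofReal_norm e, he, ENNReal.ofReal_one, mul_one]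
    _ ≤ _ := sq_lintegral_le _ (by exact hcont.enorm.measurable.aemeasurable)
    _ = _ := by
        rw [Measure.restrict_apply_univ, Real.volume_Ioc, sub_zero]
        congr 2
        exact Measure.restrict_congr_set Ioo_ae_eq_Ioc.symm

/-- Squared increments are bounded along the segments of length `‖w‖`, and these segments are then
integrated over the boundary. The factor `t` gained here makes the trace compact and not merely
bounded. The same transport estimate with integrand `1` shows that the surface measure is locally
finite. -/
lemma exists_lintegral_frontier_sub_sq_le {n : ℕ} {Ω : Set (E n)} (hΩ : IsOpen Ω) {p e : E n}
    (hp : p ∈ frontier Ω) {c r h : ℝ} (hc : 0 < c) (hr : 0 < r) (hh : 0 < h)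
    (hcone : HasCone Ω p e c r h) :
    ∃ r' : ℝ, 0 < r' ∧ r' ≤ r ∧ ∃ C : ℝ≥0,
      (volume Ω ≠ ⊤ → surf Ω (Metric.ball p r') < ⊤) ∧
      ∀ (t : ℝ) (w : E n), 0 < t → t < h → ‖w - t • e‖ < c / 2 * t →
      ∀ φ : E n → ℝ, ContDiff ℝ 1 φ →
        ∫⁻ x in Metric.ball p r', ‖φ (x + w) - φ x‖ₑ ^ 2 ∂(surf Ω) ≤
          C * ENNReal.ofReal t * ∫⁻ x in Ω, ‖fderiv ℝ φ x‖ₑ ^ 2 := by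
  obtain ⟨r', hr', hrr, C, hC⟩ := exists_lintegral_frontier_flow_le hΩ hp hc hr hh hcone
  have hres : (surf Ω).restrict (Metric.ball p r') =
      (Measure.euclideanHausdorffMeasure (n - 1)).restrict (frontier Ω ∩ Metric.ball p r') := by
    rw [surf, Measure.restrict_restrict measurableSet_ball, Set.inter_comm]
  refine ⟨r', hr', hrr, C * C, ?_, ?_⟩
  · intro hvol
    obtain ⟨hw0, -, -, h1⟩ := hC (h / 2) ((h / 2) • e) (by positivity) (by linarith)
      (by rw [sub_self, norm_zero]; positivity)
    have h2 := h1 (fun _ => 1) measurable_const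
    simp only [lintegral_const, Measure.restrict_apply_univ, one_mul, Real.volume_Ioo, sub_zero]
      at h2
    rw [← Measure.restrict_apply_univ, hres, Measure.restrict_apply_univ]
    by_contra htop
    rw [not_lt, top_le_iff] at htop
    rw [htop, ENNReal.mul_top (by simpa using hw0), top_le_iff] at h2
    exact ENNReal.mul_ne_top ENNReal.coe_ne_top hvol h2
  · intro t w ht hth hw φ hφ
    obtain ⟨hw0, hwt, hmem, h1⟩ := hC t w ht hth hw
    have hmeas : Measurable (fun x => ‖fderiv ℝ φ x‖ₑ ^ 2) :=
      (hφ.continuous_fderiv one_ne_zero).enorm.measurable.pow_const 2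
    rw [hres]
    have hnw : ‖w‖ • (‖w‖⁻¹ • w) = w := smul_inv_smul₀ (norm_ne_zero_iff.2 hw0) w
    calc _ ≤ ∫⁻ x in frontier Ω ∩ Metric.ball p r', ENNReal.ofReal ‖w‖ *
          (∫⁻ s in Set.Ioo 0 ‖w‖, ‖fderiv ℝ φ (x + s • (‖w‖⁻¹ • w))‖ₑ ^ 2)
          ∂(Measure.euclideanHausdorffMeasure (n - 1)) := by
          refine lintegral_mono fun x => ?_
          have := enorm_sub_sq_le_lintegral hφ (norm_smul_inv_norm (𝕜 := ℝ) hw0) x (norm_nonneg w)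
          simpa only [RCLike.ofReal_real_eq_id, id, hnw] using this
      _ = ENNReal.ofReal ‖w‖ * ∫⁻ x in frontier Ω ∩ Metric.ball p r',
          (∫⁻ s in Set.Ioo 0 ‖w‖, ‖fderiv ℝ φ (x + s • (‖w‖⁻¹ • w))‖ₑ ^ 2)
          ∂(Measure.euclideanHausdorffMeasure (n - 1)) := lintegral_const_mul' _ _ ENNReal.ofReal_ne_top
      _ ≤ ENNReal.ofReal (C * t) * (C * ∫⁻ x in Ω, ‖fderiv ℝ φ x‖ₑ ^ 2) := by
          gcongr
          exact h1 _ hmeas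
      _ = _ := by
          rw [ENNReal.ofReal_mul (NNReal.coe_nonneg C), ENNReal.coe_mul, ENNReal.ofReal_coe_nnreal]
          ring

lemma enorm_sq_le_two_mul (a b : ℝ) : ‖a‖ₑ ^ 2 ≤ 2 * ‖a - b‖ₑ ^ 2 + 2 * ‖b‖ₑ ^ 2 := by
  have h : ‖a‖ ^ 2 ≤ 2 * ‖a - b‖ ^ 2 + 2 * ‖b‖ ^ 2 := by
    simp only [Real.norm_eq_abs, sq_abs]
    nlinarith [sq_nonneg (a - 2 * b)]
  have h2 := ENNReal.ofReal_le_ofReal h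
  rw [ENNReal.ofReal_add (by positivity) (by positivity), ENNReal.ofReal_mul (by norm_num),
    ENNReal.ofReal_mul (by norm_num), ENNReal.ofReal_pow (norm_nonneg _),
    ENNReal.ofReal_pow (norm_nonneg _), ENNReal.ofReal_pow (norm_nonneg _)] at h2
  simpa only [ofReal_norm, ENNReal.ofReal_ofNat] using h2

/-! ### The compact trace estimate for smooth functions -/

/-- On the part `S` of the boundary, the `L²` norm of a smooth function is bounded by an arbitrarily
small multiple of its gradient and finitely many functionals on `L²(Ω)`. -/
def CompactTraceBound {n : ℕ} (Ω S : Set (E n)) : Prop :=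
  ∀ ε : ℝ≥0, 0 < ε → ∃ (ι : Type) (_ : Fintype ι) (g : ι → Lp ℝ 2 (vol Ω)),
    ∀ φ : E n → ℝ, ContDiff ℝ 1 φ →
      ∫⁻ x in S, ‖φ x‖ₑ ^ 2 ∂(surf Ω) ≤
        ε * (∫⁻ x in Ω, ‖fderiv ℝ φ x‖ₑ ^ 2) + ∑ i, ‖∫ x in Ω, g i x * φ x‖ₑ ^ 2

lemma enorm_measureReal_mul_sub_setIntegral_sq_le {n : ℕ} {φ : E n → ℝ} (hφ : Continuous φ)
    (a : ℝ) (z : E n) (δ : ℝ) :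
    ‖volume.real (Metric.ball z δ) * a - ∫ y in Metric.ball z δ, φ y‖ₑ ^ 2 ≤
      volume (Metric.ball z δ) * ∫⁻ y in Metric.ball z δ, ‖φ y - a‖ₑ ^ 2 := by
  have hfin : volume (Metric.ball z δ) ≠ ⊤ := measure_ball_lt_top.ne
  have hint : IntegrableOn φ (Metric.ball z δ) volume :=
    (hφ.continuousOn.integrableOn_compact (isCompact_closedBall z δ)).mono_set
      Metric.ball_subset_closedBall
  have h1 : volume.real (Metric.ball z δ) * a - ∫ y in Metric.ball z δ, φ y =
      - ∫ y in Metric.ball z δ, (φ y - a) := by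
    rw [integral_sub hint (integrableOn_const hfin), setIntegral_const, smul_eq_mul]
    ring
  rw [h1, enorm_neg]
  calc _ ≤ (∫⁻ y in Metric.ball z δ, ‖φ y - a‖ₑ) ^ 2 := by
        gcongr; exact enorm_integral_le_lintegral_enorm _
    _ ≤ _ := by
        refine (sq_lintegral_le _ ?_).trans_eq (by rw [Measure.restrict_apply_univ])
        exact (hφ.sub continuous_const).enorm.measurable.aemeasurable

/-- `SimpleFunc.nearestPt` takes a sequence, so a finite set is listed as one, with a default
element of the set beyond its end. -/
lemma exists_nat_range_finite {α : Type*} {T : Set α} (hT : T.Finite) (hne : T.Nonempty) :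
    ∃ (u : ℕ → α) (N : ℕ), (∀ k, u k ∈ T) ∧ ∀ y ∈ T, ∃ k ≤ N, u k = y := by
  obtain ⟨a, ha⟩ := hne
  refine ⟨fun k => hT.toFinset.toList.getD k a, hT.toFinset.toList.length, ?_, ?_⟩
  · intro k
    by_cases hk : k < hT.toFinset.toList.length
    · simp only [List.getD_eq_getElem _ _ hk]
      have := List.getElem_mem hk
      simpa only [Finset.mem_toList, Set.Finite.mem_toFinset] using this
    · simp only [List.getD_eq_default _ _ (not_lt.1 hk)]
      exact ha
  · intro y hy
    have hy' : y ∈ hT.toFinset.toList := by simpa using hy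
    obtain ⟨k, hk, rfl⟩ := List.getElem_of_mem hy'
    exact ⟨k, hk.le, List.getD_eq_getElem _ _ hk⟩

/-- The nearest point in a finite `δ`-net is a measurable choice with finitely many values. This
finiteness is what leaves only finitely many functionals in the trace bound. -/
lemma exists_simpleFunc_near {n : ℕ} {S : Set (E n)} (hS : Bornology.IsBounded S)
    (hne : S.Nonempty) {δ : ℝ} (hδ : 0 < δ) :
    ∃ ξ : SimpleFunc (E n) (E n), (∀ x, ξ x ∈ S) ∧ ∀ x ∈ S, dist (ξ x) x < δ := by
  have htb : TotallyBounded S := hS.isCompact_closure.totallyBounded.subset subset_closure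
  obtain ⟨T, hTS, hT, hcov⟩ := htb.exists_subset (Metric.dist_mem_uniformity hδ)
  have hTne : T.Nonempty := by
    obtain ⟨x, hx⟩ := hne
    have := hcov hx
    simp only [Set.mem_iUnion] at this
    obtain ⟨y, hy, -⟩ := this
    exact ⟨y, hy⟩
  obtain ⟨u, N, hu, hN⟩ := exists_nat_range_finite hT hTne
  refine ⟨SimpleFunc.nearestPt u N, fun x => hTS (hu _), fun x hx => ?_⟩
  have := hcov hx
  simp only [Set.mem_iUnion] at this
  obtain ⟨y, hy, hxy⟩ := this
  obtain ⟨k, hk, rfl⟩ := hN y hy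
  have h1 := SimpleFunc.edist_nearestPt_le u x hk
  have h2 : edist (u k) x < ENNReal.ofReal δ := by
    rw [edist_dist, ENNReal.ofReal_lt_ofReal_iff hδ, dist_comm]; exact hxy
  have h3 := h1.trans_lt h2
  rwa [edist_dist, ENNReal.ofReal_lt_ofReal_iff hδ] at h3

/-- The value `φ x` is compared with the integral of `φ` over a small ball in `Ω` centred at `ξ x +
t • e`. The deviation is an integral of increments of size about `t`, whose boundary norms carry a
factor `t`. The ball integrals are functionals on L², and only finitely many centres occur. -/
lemma exists_compactTraceBound_ball {n : ℕ} {Ω : Set (E n)} (hΩ : IsBoundedLipschitzDomain Ω)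
    {p : E n} (hp : p ∈ frontier Ω) :
    ∃ r : ℝ, 0 < r ∧ surf Ω (Metric.ball p r) < ⊤ ∧
      CompactTraceBound Ω (Metric.ball p r ∩ frontier Ω) := by
  have hvol : volume Ω ≠ ⊤ := hΩ.isBounded.measure_lt_top.ne
  obtain ⟨e, c, r₀, h, hc, hr₀, hh, hcone⟩ := exists_hasCone_of_mem_frontier hΩ hp
  obtain ⟨r, hr, hrr, C, hfin, hdir⟩ :=
    exists_lintegral_frontier_sub_sq_le hΩ.isOpen hp hc hr₀ hh hcone
  have hfin := hfin hvol
  refine ⟨r, hr, hfin, ?_⟩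
  intro ε hε
  set S := Metric.ball p r ∩ frontier Ω with hS
  have hSsurf : (surf Ω).restrict S = (surf Ω).restrict (Metric.ball p r) := by
    rw [surf, Measure.restrict_restrict measurableSet_ball,
      Measure.restrict_restrict (measurableSet_ball.inter isClosed_frontier.measurableSet),
      Set.inter_assoc, Set.inter_self]
  set μ := (surf Ω).restrict (Metric.ball p r) with hμ
  have : IsFiniteMeasure μ := ⟨by rw [hμ, Measure.restrict_apply_univ]; exact hfin⟩
  -- Here `2` comes from splitting a square and `2 ^ n` from doubling the radius of the averaging
  -- ball.
  obtain ⟨t, ht, hth, hte⟩ : ∃ t : ℝ, 0 < t ∧ t < h ∧ 2 * (2 ^ n * (C * t)) ≤ ε := by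
    refine ⟨min (h / 2) (ε / (2 * 2 ^ n * (C + 1))), by positivity,
      (min_le_left _ _).trans_lt (by linarith), ?_⟩
    calc 2 * (2 ^ n * ((C : ℝ) * min (h / 2) (ε / (2 * 2 ^ n * (C + 1)))))
        ≤ 2 * (2 ^ n * ((C + 1 : ℝ) * (ε / (2 * 2 ^ n * (C + 1))))) := by
          gcongr
          · linarith
          · exact min_le_right _ _
      _ = ε := by field_simp
  -- `x` and `ξ x` differ by less than `δ`, so increments range over a ball of radius `2 * δ = c / 2
  -- * t`, exactly the tolerance of directions in `hdir`.
  set δ := c * t / 4 with hδ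
  have hδpos : 0 < δ := by positivity
  have hSne : S.Nonempty := ⟨p, Metric.mem_ball_self hr, hp⟩
  obtain ⟨ξ, hξS, hξ⟩ := exists_simpleFunc_near
    (Metric.isBounded_ball.subset Set.inter_subset_left : Bornology.IsBounded S) hSne hδpos
  have hball : ∀ a ∈ S, Metric.ball (a + t • e) δ ⊆ Ω := by
    intro a ha
    refine (Metric.ball_subset_ball ?_).trans
      (hcone a (frontier_subset_closure ha.2) (lt_of_lt_of_le ha.1 hrr) t ht hth)
    rw [hδ]; nlinarith
  set v := volume.real (Metric.ball (0 : E n) δ) with hv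
  have hvball : ∀ z : E n, volume (Metric.ball z δ) = ENNReal.ofReal v := by
    intro z
    rw [hv, Measure.real, ENNReal.ofReal_toReal measure_ball_lt_top.ne]
    exact Measure.addHaar_ball_center _ _ _
  have hvreal : ∀ z : E n, volume.real (Metric.ball z δ) = v := by
    intro z; rw [Measure.real, hvball, ENNReal.toReal_ofReal measureReal_nonneg]
  have hvpos : 0 < v := by
    have := Metric.measure_ball_pos volume (0 : E n) hδpos
    exact ENNReal.toReal_pos this.ne' measure_ball_lt_top.ne
  have hv2 : volume (Metric.ball (0 : E n) (2 * δ)) = 2 ^ n * ENNReal.ofReal v := by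
    rw [Measure.addHaar_ball_mul_of_pos _ _ (by norm_num), hvball, finrank_euclideanSpace_fin]
    norm_num [ENNReal.ofReal_pow]
  set m := (μ Set.univ).toReal with hm
  have hm0 : 0 ≤ m := ENNReal.toReal_nonneg
  have hfinv : ∀ z : E n, vol Ω (Metric.ball z δ) ≠ ⊤ := fun z =>
    (lt_of_le_of_lt (Measure.restrict_apply_le _ _) measure_ball_lt_top).ne
  -- The weight squares to `2 * m / v ^ 2`: `2` from splitting the square, `m` from integrating a
  -- constant over the boundary piece, `v ^ 2` from working with ball integrals in place of
  -- averages.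
  refine ⟨ξ.range, inferInstance, fun a => indicatorConstLp 2 measurableSet_ball
    (hfinv (a.1 + t • e)) (√(2 * m) / v), fun φ hφ => ?_⟩
  rw [hSsurf]
  set D := ∫⁻ x in Ω, ‖fderiv ℝ φ x‖ₑ ^ 2 with hD
  have hφc : Continuous φ := hφ.continuous
  set I : E n → ℝ := fun a => ∫ y in Metric.ball (a + t • e) δ, φ y with hI
  have hgI : ∀ a ∈ S, ∫ x in Ω, (indicatorConstLp 2 measurableSet_ball
      (hfinv (a + t • e)) (√(2 * m) / v) : Lp ℝ 2 (vol Ω)) x * φ x = √(2 * m) / v * I a := by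
    intro a ha
    have h1 : ∫ x in Ω, (indicatorConstLp 2 measurableSet_ball
      (hfinv (a + t • e)) (√(2 * m) / v) : Lp ℝ 2 (vol Ω)) x * φ x =
        ∫ x in Ω, (Metric.ball (a + t • e) δ).indicator (fun x => √(2 * m) / v * φ x) x := by
      refine integral_congr_ae ?_
      filter_upwards [indicatorConstLp_coeFn (p := 2) (hs := measurableSet_ball)
        (hμs := hfinv (a + t • e)) (c := √(2 * m) / v)] with x hx
      rw [hx]
      by_cases hxb : x ∈ Metric.ball (a + t • e) δ <;> simp [hxb]
    rw [h1, setIntegral_indicator measurableSet_ball, Set.inter_eq_right.2 (hball a ha),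
      integral_const_mul]
  have hpt : ∀ x ∈ S, ENNReal.ofReal v ^ 2 * ‖φ x‖ₑ ^ 2 ≤
      2 * (ENNReal.ofReal v * ∫⁻ z in Metric.ball (0 : E n) (2 * δ), ‖φ (x + (t • e + z)) - φ x‖ₑ ^ 2)
        + 2 * ∑ a ∈ ξ.range, ‖I a‖ₑ ^ 2 := by
    intro x hx
    have h1 : ENNReal.ofReal v ^ 2 * ‖φ x‖ₑ ^ 2 = ‖v * φ x‖ₑ ^ 2 := by
      rw [enorm_mul, mul_pow, Real.enorm_of_nonneg hvpos.le]
    rw [h1]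
    refine (enorm_sq_le_two_mul _ (I (ξ x))).trans ?_
    gcongr 2 * ?_ + 2 * ?_
    · have h2 := enorm_measureReal_mul_sub_setIntegral_sq_le hφc (φ x) (ξ x + t • e) δ
      rw [hvreal, hvball] at h2
      refine h2.trans ?_
      gcongr ENNReal.ofReal v * ?_
      rw [← lintegral_indicator measurableSet_ball, ← lintegral_indicator measurableSet_ball,
        ← lintegral_add_left_eq_self _ (x + t • e)]
      refine lintegral_mono fun z => ?_
      by_cases hz : x + t • e + z ∈ Metric.ball (ξ x + t • e) δ
      · have hz2 : z ∈ Metric.ball (0 : E n) (2 * δ) := by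
          rw [Metric.mem_ball, dist_eq_norm] at hz
          rw [mem_ball_zero_iff]
          have h3 := hξ x hx
          rw [dist_eq_norm] at h3
          calc ‖z‖ = ‖(x + t • e + z - (ξ x + t • e)) + (ξ x - x)‖ := by congr 1; abel
            _ ≤ _ := norm_add_le _ _
            _ < 2 * δ := by linarith
        rw [Set.indicator_of_mem hz, Set.indicator_of_mem hz2, add_assoc]
      · rw [Set.indicator_of_notMem hz]; exact zero_le
    -- The term for `ξ x` is enlarged to the sum over all centres, which no longer depends on `x`.
    · exact Finset.single_le_sum (f := fun a => ‖I a‖ₑ ^ 2) (fun _ _ => zero_le)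
        (SimpleFunc.mem_range_self ξ x)
  have hmeas : Measurable (Function.uncurry fun (x z : E n) => ‖φ (x + (t • e + z)) - φ x‖ₑ ^ 2) := by
    have : Continuous (Function.uncurry fun (x z : E n) => φ (x + (t • e + z)) - φ x) := by
      unfold Function.uncurry; fun_prop
    exact this.enorm.measurable.pow_const 2
  have hswap : ∫⁻ x, (∫⁻ z in Metric.ball (0 : E n) (2 * δ), ‖φ (x + (t • e + z)) - φ x‖ₑ ^ 2) ∂μ ≤
      2 ^ n * ENNReal.ofReal v * (C * ENNReal.ofReal t * D) := by
    rw [lintegral_lintegral_swap hmeas.aemeasurable]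
    calc _ ≤ ∫⁻ z in Metric.ball (0 : E n) (2 * δ), C * ENNReal.ofReal t * D := by
          refine setLIntegral_mono' measurableSet_ball fun z hz => ?_
          refine hdir t (t • e + z) ht hth ?_ φ hφ
          rw [mem_ball_zero_iff] at hz
          rw [add_sub_cancel_left]
          refine hz.trans_eq ?_
          rw [hδ]; ring
      _ = _ := by rw [setLIntegral_const, hv2, mul_comm]
  have hS' : ∀ᵐ x ∂μ, x ∈ S := by
    rw [← hSsurf]
    exact ae_restrict_mem (measurableSet_ball.inter isClosed_frontier.measurableSet)
  have hmain : ENNReal.ofReal v ^ 2 * ∫⁻ x, ‖φ x‖ₑ ^ 2 ∂μ ≤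
      ENNReal.ofReal v ^ 2 * (ε * D + ∑ a ∈ ξ.range, ‖√(2 * m) / v * I a‖ₑ ^ 2) := by
    rw [← lintegral_const_mul _ (hφc.enorm.measurable.pow_const 2)]
    calc _ ≤ ∫⁻ x, (2 * (ENNReal.ofReal v * ∫⁻ z in Metric.ball (0 : E n) (2 * δ),
            ‖φ (x + (t • e + z)) - φ x‖ₑ ^ 2) + 2 * ∑ a ∈ ξ.range, ‖I a‖ₑ ^ 2) ∂μ :=
          lintegral_mono_ae (hS'.mono hpt)
      _ = 2 * (ENNReal.ofReal v * ∫⁻ x, (∫⁻ z in Metric.ball (0 : E n) (2 * δ),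
            ‖φ (x + (t • e + z)) - φ x‖ₑ ^ 2) ∂μ) + 2 * (∑ a ∈ ξ.range, ‖I a‖ₑ ^ 2) * μ Set.univ := by
          rw [lintegral_add_right _ measurable_const, lintegral_const_mul' _ _ (by norm_num),
            lintegral_const_mul' _ _ ENNReal.ofReal_ne_top, lintegral_const]
      _ ≤ 2 * (ENNReal.ofReal v * (2 ^ n * ENNReal.ofReal v * (C * ENNReal.ofReal t * D)))
            + 2 * (∑ a ∈ ξ.range, ‖I a‖ₑ ^ 2) * μ Set.univ := by gcongr
      _ = ENNReal.ofReal v ^ 2 * (2 * (2 ^ n * (C * ENNReal.ofReal t)) * D)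
            + 2 * (∑ a ∈ ξ.range, ‖I a‖ₑ ^ 2) * μ Set.univ := by ring
      _ ≤ ENNReal.ofReal v ^ 2 * (ε * D)
            + ENNReal.ofReal v ^ 2 * ∑ a ∈ ξ.range, ‖√(2 * m) / v * I a‖ₑ ^ 2 := by
          gcongr _ * (?_ * _) + ?_
          · have := ENNReal.ofReal_le_ofReal hte
            rw [ENNReal.ofReal_mul (by norm_num), ENNReal.ofReal_mul (by positivity),
              ENNReal.ofReal_mul (NNReal.coe_nonneg C), ENNReal.ofReal_pow (by norm_num),
              ENNReal.ofReal_coe_nnreal, ENNReal.ofReal_coe_nnreal] at this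
            simpa using this
          · rw [Finset.mul_sum, Finset.mul_sum, Finset.sum_mul]
            refine Finset.sum_le_sum fun a _ => le_of_eq ?_
            have hmu : μ Set.univ = ENNReal.ofReal m :=
              (ENNReal.ofReal_toReal (measure_ne_top _ _)).symm
            have h2m : (2 : ℝ≥0∞) * μ Set.univ = ENNReal.ofReal (2 * m) := by
              rw [hmu, ENNReal.ofReal_mul (by norm_num)]; norm_num
            rw [mul_right_comm, h2m, enorm_mul, mul_pow, ← mul_assoc,
              Real.enorm_of_nonneg (show 0 ≤ √(2 * m) / v by positivity), ← ENNReal.ofReal_pow hvpos.le,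
              ← ENNReal.ofReal_pow (show 0 ≤ √(2 * m) / v by positivity), ← ENNReal.ofReal_mul (by positivity)]
            congr 2
            rw [div_pow, Real.sq_sqrt (by positivity)]
            field_simp
      _ = _ := by rw [mul_add]
  have hv0 : ENNReal.ofReal v ^ 2 ≠ 0 := by simpa using hvpos
  have hvt : ENNReal.ofReal v ^ 2 ≠ ⊤ := ENNReal.pow_ne_top ENNReal.ofReal_ne_top
  refine ((ENNReal.mul_le_mul_iff_right hv0 hvt).1 hmain).trans (le_of_eq ?_)
  congr 1
  rw [← Finset.sum_coe_sort]
  refine Finset.sum_congr rfl fun a _ => ?_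
  obtain ⟨x, hx⟩ := SimpleFunc.mem_range.1 a.2
  rw [hgI a.1 (by rw [← hx]; exact hξS x)]

lemma compactTraceBound_union {n : ℕ} {Ω S T : Set (E n)} (hS : CompactTraceBound Ω S)
    (hT : CompactTraceBound Ω T) : CompactTraceBound Ω (S ∪ T) := by
  intro ε hε
  obtain ⟨ι, _, g, hg⟩ := hS (ε / 2) (by positivity)
  obtain ⟨κ, _, k, hk⟩ := hT (ε / 2) (by positivity)
  refine ⟨ι ⊕ κ, inferInstance, Sum.elim g k, fun φ hφ => ?_⟩
  rw [Fintype.sum_sum_type]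
  refine (lintegral_union_le _ _ _).trans ((add_le_add (hg φ hφ) (hk φ hφ)).trans (le_of_eq ?_))
  have h2 : (ε : ℝ≥0∞) = (ε / 2 : ℝ≥0) + (ε / 2 : ℝ≥0) := by
    rw [← ENNReal.coe_add, add_halves]
  rw [h2]
  simp only [Sum.elim_inl, Sum.elim_inr]
  ring

/-- Finite measure and the trace bound both pass to subsets and finite unions, so by compactness of
the boundary the local statements suffice. -/
lemma compactTraceBound_frontier {n : ℕ} {Ω : Set (E n)} (hΩ : IsBoundedLipschitzDomain Ω) :
    surf Ω Set.univ < ⊤ ∧ CompactTraceBound Ω (frontier Ω) := by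
  have hcpt : IsCompact (frontier Ω) :=
    (Metric.isCompact_of_isClosed_isBounded isClosed_frontier
      (hΩ.isBounded.closure.subset frontier_subset_closure))
  have key : surf Ω (frontier Ω) < ⊤ ∧ CompactTraceBound Ω (frontier Ω) := by
    refine hcpt.induction_on (p := fun S => surf Ω S < ⊤ ∧ CompactTraceBound Ω S) ?_ ?_ ?_ ?_
    · refine ⟨by simp, fun ε _ => ⟨PEmpty, inferInstance, PEmpty.elim, fun φ _ => ?_⟩⟩
      simp
    · intro S T hST hT
      refine ⟨(measure_mono hST).trans_lt hT.1, fun ε hε => ?_⟩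
      obtain ⟨ι, _, g, hg⟩ := hT.2 ε hε
      exact ⟨ι, inferInstance, g, fun φ hφ => (lintegral_mono_set hST).trans (hg φ hφ)⟩
    · intro S T hS hT
      exact ⟨measure_union_lt_top hS.1 hT.1, compactTraceBound_union hS.2 hT.2⟩
    · intro p hp
      obtain ⟨r, hr, hfin, hb⟩ := exists_compactTraceBound_ball hΩ hp
      refine ⟨Metric.ball p r ∩ frontier Ω, ?_, (measure_mono Set.inter_subset_left).trans_lt hfin, hb⟩
      exact inter_mem (mem_nhdsWithin_of_mem_nhds (Metric.ball_mem_nhds p hr)) self_mem_nhdsWithin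
  refine ⟨?_, key.2⟩
  rw [surf, Measure.restrict_apply_univ]
  have := key.1
  rwa [surf, Measure.restrict_apply isClosed_frontier.measurableSet, Set.inter_self] at this

lemma exists_lintegral_surf_sq_le {n : ℕ} {Ω : Set (E n)} (hΩ : IsBoundedLipschitzDomain Ω)
    {ε : ℝ≥0} (hε : 0 < ε) : ∃ (ι : Type) (_ : Fintype ι) (g : ι → Lp ℝ 2 (vol Ω)),
    ∀ φ : E n → ℝ, ContDiff ℝ 1 φ →
      ∫⁻ x, ‖φ x‖ₑ ^ 2 ∂(surf Ω) ≤
        ε * (∫⁻ x in Ω, ‖fderiv ℝ φ x‖ₑ ^ 2) + ∑ i, ‖∫ x in Ω, g i x * φ x‖ₑ ^ 2 := by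
  have h := (compactTraceBound_frontier hΩ).2 ε hε
  rwa [surf, Measure.restrict_restrict isClosed_frontier.measurableSet, Set.inter_self] at h

/-! ### Exit points along a direction, and Friedrichs' inequality -/

/-- The time at which the ray from `x` in direction `e` leaves `Ω`. -/
noncomputable def exitTime {n : ℕ} (Ω : Set (E n)) (e x : E n) : ℝ :=
  sInf {t : ℝ | 0 ≤ t ∧ x + t • e ∉ Ω}

/-- The point at which the ray from `x` in direction `e` leaves `Ω`. -/
noncomputable def exitPoint {n : ℕ} (Ω : Set (E n)) (e x : E n) : E n := x + exitTime Ω e x • e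

section Exit

variable {n : ℕ} {Ω : Set (E n)} {e : E n} {R : ℝ}

lemma exists_notMem_of_subset_ball (he : ‖e‖ = 1) (hR : Ω ⊆ Metric.ball 0 R) (x : E n) :
    ∃ t : ℝ, 0 ≤ t ∧ x + t • e ∉ Ω := by
  refine ⟨|R| + ‖x‖, by positivity, fun hmem => ?_⟩
  have h1 := mem_ball_zero_iff.1 (hR hmem)
  have h2 : ‖(|R| + ‖x‖) • e‖ ≤ ‖x + (|R| + ‖x‖) • e‖ + ‖x‖ := by
    calc _ = ‖(x + (|R| + ‖x‖) • e) - x‖ := by congr 1; abel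
      _ ≤ _ := norm_sub_le _ _
  rw [norm_smul, he, mul_one, Real.norm_of_nonneg (by positivity)] at h2
  linarith [le_abs_self R]

lemma isClosed_exit_set (hΩ : IsOpen Ω) (x : E n) : IsClosed {t : ℝ | 0 ≤ t ∧ x + t • e ∉ Ω} :=
  (isClosed_le continuous_const continuous_id).inter
    (hΩ.isClosed_compl.preimage (by fun_prop : Continuous fun t : ℝ => x + t • e))

lemma exitTime_mem (hΩ : IsOpen Ω) (he : ‖e‖ = 1) (hR : Ω ⊆ Metric.ball 0 R) (x : E n) :
    0 ≤ exitTime Ω e x ∧ exitPoint Ω e x ∉ Ω :=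
  (isClosed_exit_set hΩ x).csInf_mem (exists_notMem_of_subset_ball he hR x) ⟨0, fun _ h => h.1⟩

lemma exitTime_le_of_notMem {x : E n} {t : ℝ} (ht : 0 ≤ t) (h : x + t • e ∉ Ω) :
    exitTime Ω e x ≤ t := by
  have hmem : t ∈ {t : ℝ | 0 ≤ t ∧ x + t • e ∉ Ω} := ⟨ht, h⟩
  exact csInf_le ⟨0, fun _ h => h.1⟩ hmem

lemma mem_of_lt_exitTime {x : E n} {t : ℝ} (ht : 0 ≤ t) (htx : t < exitTime Ω e x) :
    x + t • e ∈ Ω := by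
  by_contra h
  exact (exitTime_le_of_notMem ht h).not_gt htx

lemma exitTime_pos (hΩ : IsOpen Ω) (he : ‖e‖ = 1) (hR : Ω ⊆ Metric.ball 0 R) {x : E n}
    (hx : x ∈ Ω) : 0 < exitTime Ω e x := by
  obtain ⟨h1, h2⟩ := exitTime_mem hΩ he hR x
  refine lt_of_le_of_ne h1 fun h => h2 ?_
  rw [exitPoint, ← h, zero_smul, add_zero]
  exact hx

lemma exitPoint_mem_frontier (hΩ : IsOpen Ω) (he : ‖e‖ = 1) (hR : Ω ⊆ Metric.ball 0 R) {x : E n}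
    (hx : x ∈ Ω) : exitPoint Ω e x ∈ frontier Ω := by
  rw [frontier, hΩ.interior_eq]
  refine ⟨?_, (exitTime_mem hΩ he hR x).2⟩
  have hpos := exitTime_pos hΩ he hR hx
  have hcl : exitTime Ω e x ∈ closure (Set.Ico 0 (exitTime Ω e x)) := by
    rw [closure_Ico hpos.ne]; exact Set.right_mem_Icc.2 hpos.le
  have hcont : Continuous fun t : ℝ => x + t • e := by fun_prop
  exact map_mem_closure (f := fun t : ℝ => x + t • e) hcont hcl
    fun t ht => mem_of_lt_exitTime ht.1 ht.2

lemma exitTime_le (he : ‖e‖ = 1) (hR : Ω ⊆ Metric.ball 0 R) {x : E n}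
    (hx : x ∈ Ω) : exitTime Ω e x ≤ 2 * R := by
  refine le_of_forall_lt_imp_le_of_dense fun t ht => ?_
  rcases le_or_gt t 0 with h | h
  · have := mem_ball_zero_iff.1 (hR hx)
    linarith [norm_nonneg x]
  · have h1 := mem_ball_zero_iff.1 (hR (mem_of_lt_exitTime h.le ht))
    have h2 := mem_ball_zero_iff.1 (hR hx)
    have h3 : ‖t • e‖ ≤ ‖x + t • e‖ + ‖x‖ := by
      calc _ = ‖(x + t • e) - x‖ := by congr 1; abel
        _ ≤ _ := norm_sub_le _ _
    rw [norm_smul, he, mul_one, Real.norm_of_nonneg h.le] at h3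
    linarith

/-- Each sublevel set is the projection, along a compact time interval, of the closed set of pairs
whose ray point lies outside `Ω`; such a projection is closed. -/
lemma measurable_exitTime (hΩ : IsOpen Ω) (he : ‖e‖ = 1) (hR : Ω ⊆ Metric.ball 0 R) :
    Measurable (exitTime Ω e) := by
  refine measurable_of_Iic fun a => ?_
  have h : exitTime Ω e ⁻¹' Set.Iic a =
      Prod.snd '' ((Set.Icc 0 a ×ˢ Set.univ) ∩ {q : ℝ × E n | q.2 + q.1 • e ∈ Ωᶜ}) := by
    ext x
    simp only [Set.mem_preimage, Set.mem_Iic, Set.mem_image, Set.mem_inter_iff, Set.mem_prod,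
      Set.mem_univ, and_true, Set.mem_ofPred_eq, Prod.exists, exists_eq_right]
    constructor
    · intro hx
      obtain ⟨h1, h2⟩ := exitTime_mem hΩ he hR x
      exact ⟨_, ⟨h1, hx⟩, h2⟩
    · rintro ⟨t, ht, h2⟩
      exact (exitTime_le_of_notMem ht.1 h2).trans ht.2
  rw [h]
  refine IsClosed.measurableSet ?_
  have hc : IsClosed {q : ℝ × E n | q.2 + q.1 • e ∈ Ωᶜ} :=
    hΩ.isClosed_compl.preimage (by fun_prop : Continuous fun q : ℝ × E n => q.2 + q.1 • e)
  have h2 : Prod.snd '' ((Set.Icc 0 a ×ˢ Set.univ) ∩ {q : ℝ × E n | q.2 + q.1 • e ∈ Ωᶜ}) =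
      Prod.snd '' {q : Set.Icc (0 : ℝ) a × E n | q.2 + (q.1 : ℝ) • e ∈ Ωᶜ} := by
    ext x
    simp
  rw [h2]
  refine isClosedMap_snd_of_compactSpace _ ?_
  exact hΩ.isClosed_compl.preimage
    (by fun_prop : Continuous fun q : Set.Icc (0 : ℝ) a × E n => q.2 + (q.1 : ℝ) • e)

lemma measurable_exitPoint (hΩ : IsOpen Ω) (he : ‖e‖ = 1) (hR : Ω ⊆ Metric.ball 0 R) :
    Measurable (exitPoint Ω e) :=
  measurable_id.add ((measurable_exitTime hΩ he hR).smul_const e)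

/-- Lebesgue measure of a bounded cylinder over a subset of a hyperplane. -/
lemma volume_cylinder_le (he : ‖e‖ = 1) (T : Set (hyper e)) (a b : ℝ) :
    volume {x : E n | proj e x ∈ T ∧ inner ℝ e x ∈ Set.Icc a b} ≤
      volume T * ENNReal.ofReal (b - a) := by
  -- `T` will be the projection of a boundary set, whose measurability is not known, so it is
  -- replaced by a measurable hull of the same volume.
  set T' := toMeasurable volume T
  have hm : MeasurableSet {x : E n | proj e x ∈ T' ∧ inner ℝ e x ∈ Set.Icc a b} :=
    ((proj e).continuous.measurable (measurableSet_toMeasurable _ _)).inter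
      ((by fun_prop : Continuous fun x : E n => inner ℝ e x).measurable measurableSet_Icc)
  have hpre : (fun q : hyper e × ℝ => (q.1 : E n) + q.2 • e) ⁻¹'
      {x : E n | proj e x ∈ T' ∧ inner ℝ e x ∈ Set.Icc a b} = T' ×ˢ Set.Icc a b := by
    ext ⟨y, t⟩
    have h1 : inner ℝ e ((y : E n) + t • e) = t := by
      have h2 : inner ℝ e (y : E n) = 0 :=
        (Submodule.mem_orthogonal_singleton_iff_inner_right (𝕜 := ℝ)).1 y.2
      rw [inner_add_right, h2, inner_smul_right, real_inner_self_eq_norm_sq, he]; ring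
    simp only [Set.mem_preimage, Set.mem_ofPred_eq, proj_add_smul, proj_coe, h1, Set.mem_prod]
  calc _ ≤ volume {x : E n | proj e x ∈ T' ∧ inner ℝ e x ∈ Set.Icc a b} :=
        measure_mono fun x hx => ⟨subset_toMeasurable _ _ hx.1, hx.2⟩
    _ = _ := by
        rw [← (measurePreserving_hyper he).measure_preimage hm.nullMeasurableSet, hpre,
          Measure.volume_eq_prod, Measure.prod_prod, Real.volume_Icc, measure_toMeasurable]

/-- The points that leave `Ω` through `A` lie in a cylinder of height `2 * R` over the projection of
`A ∩ frontier Ω`, and a projection does not increase Hausdorff measure. -/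
lemma map_exitPoint_le (hΩ : IsOpen Ω) (he : ‖e‖ = 1) (hR : Ω ⊆ Metric.ball 0 R) :
    (vol Ω).map (exitPoint Ω e) ≤ ENNReal.ofReal (2 * R) • surf Ω := by
  refine Measure.le_iff.2 fun A hA => ?_
  have hq := measurable_exitPoint hΩ he hR
  rw [Measure.map_apply hq hA, Measure.restrict_apply (hq hA), Measure.smul_apply, smul_eq_mul,
    Measure.restrict_apply hA]
  have hsub : exitPoint Ω e ⁻¹' A ∩ Ω ⊆
      {x : E n | proj e x ∈ proj e '' (A ∩ frontier Ω) ∧ inner ℝ e x ∈ Set.Icc (-R) R} := by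
    rintro x ⟨hxA, hx⟩
    refine ⟨⟨exitPoint Ω e x, ⟨hxA, exitPoint_mem_frontier hΩ he hR hx⟩, proj_add_smul _ _ _⟩, ?_⟩
    have h1 := abs_real_inner_le_norm e x
    rw [he, one_mul] at h1
    exact abs_le.1 (h1.trans (mem_ball_zero_iff.1 (hR hx)).le)
  refine (measure_mono hsub).trans ((volume_cylinder_le he _ _ _).trans ?_)
  rw [sub_neg_eq_add, ← two_mul, mul_comm, ← hausdorff_hyper he]
  gcongr
  have hl : LipschitzWith 1 (proj e) := by
    refine LipschitzWith.of_dist_le_mul fun x y => ?_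
    rw [dist_eq_norm, dist_eq_norm, ← map_sub, NNReal.coe_one, one_mul]
    exact norm_proj_le e _
  simpa using euclideanHausdorffMeasure_image_le hl (n - 1) (A ∩ frontier Ω)

lemma ae_exitPoint (hΩ : IsOpen Ω) (he : ‖e‖ = 1) (hR : Ω ⊆ Metric.ball 0 R) {P : E n → Prop}
    (hP : ∀ᵐ y ∂(surf Ω), P y) : ∀ᵐ x ∂(vol Ω), P (exitPoint Ω e x) := by
  refine ae_of_ae_map (measurable_exitPoint hΩ he hR).aemeasurable ?_
  have hac : (vol Ω).map (exitPoint Ω e) ≪ surf Ω :=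
    (Measure.absolutelyContinuous_of_le (map_exitPoint_le hΩ he hR)).trans
      (Measure.smul_absolutelyContinuous)
  exact hac.ae_le hP

lemma lintegral_exitPoint_le (hΩ : IsOpen Ω) (he : ‖e‖ = 1) (hR : Ω ⊆ Metric.ball 0 R)
    {g : E n → ℝ≥0∞} (hg : Measurable g) :
    ∫⁻ x in Ω, g (exitPoint Ω e x) ≤ ENNReal.ofReal (2 * R) * ∫⁻ y, g y ∂(surf Ω) := by
  rw [← lintegral_map hg (measurable_exitPoint hΩ he hR), ← smul_eq_mul, ← lintegral_smul_measure]
  exact lintegral_mono' (map_exitPoint_le hΩ he hR) le_rfl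

end Exit

/-- Friedrichs' inequality for smooth functions. -/
lemma exists_friedrichs_smooth {n : ℕ} (hn : 1 ≤ n) {Ω : Set (E n)} (hΩ : IsOpen Ω)
    (hb : Bornology.IsBounded Ω) : ∃ C : ℝ≥0, ∀ φ : E n → ℝ, ContDiff ℝ 1 φ →
      ∫⁻ x in Ω, ‖φ x‖ₑ ^ 2 ≤
        C * ((∫⁻ x in Ω, ‖fderiv ℝ φ x‖ₑ ^ 2) + ∫⁻ x, ‖φ x‖ₑ ^ 2 ∂(surf Ω)) := by
  obtain ⟨R, hR⟩ := hb.subset_ball 0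
  set e : E n := EuclideanSpace.single ⟨0, hn⟩ 1
  have he : ‖e‖ = 1 := by simp [e]
  refine ⟨2 * (2 * R).toNNReal * ((2 * R).toNNReal + 1), fun φ hφ => ?_⟩
  set ρ := ENNReal.ofReal (2 * R) with hρ
  have hmD : Measurable (fun x => ‖fderiv ℝ φ x‖ₑ ^ 2) :=
    (hφ.continuous_fderiv one_ne_zero).enorm.measurable.pow_const 2
  have hmφ : Measurable (fun x => ‖φ x‖ₑ ^ 2) := hφ.continuous.enorm.measurable.pow_const 2
  -- Extension by zero lets the integration time grow from the exit time to `2 * R`, which is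
  -- independent of `x`; Tonelli and translation invariance then apply.
  set g := Ω.indicator (fun x => ‖fderiv ℝ φ x‖ₑ ^ 2) with hg
  have hmg : Measurable g := hmD.indicator hΩ.measurableSet
  have hpt : ∀ x ∈ Ω, ‖φ x‖ₑ ^ 2 ≤ 2 * (ρ * ∫⁻ s in Set.Ioo 0 (2 * R), g (x + s • e)) +
      2 * ‖φ (exitPoint Ω e x)‖ₑ ^ 2 := by
    intro x hx
    refine (enorm_sq_le_two_mul _ (φ (exitPoint Ω e x))).trans ?_
    gcongr 2 * ?_ + _
    have h1 := enorm_sub_sq_le_lintegral hφ he x (exitTime_pos hΩ he hR hx).le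
    rw [← enorm_neg, neg_sub] at h1
    refine h1.trans ?_
    have h2 := exitTime_le he hR hx
    gcongr ?_ * ?_
    · exact ENNReal.ofReal_le_ofReal h2
    · calc _ = ∫⁻ s in Set.Ioo 0 (exitTime Ω e x), g (x + s • e) := by
            refine setLIntegral_congr_fun measurableSet_Ioo fun s hs => ?_
            rw [hg, Set.indicator_of_mem (mem_of_lt_exitTime hs.1.le hs.2)]
        _ ≤ _ := lintegral_mono_set (Set.Ioo_subset_Ioo_right h2)
  have hmu : Measurable (Function.uncurry fun (x : E n) (s : ℝ) => g (x + s • e)) :=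
    hmg.comp (by fun_prop : Measurable fun q : E n × ℝ => q.1 + q.2 • e)
  have hflow : ∫⁻ x in Ω, (∫⁻ s in Set.Ioo 0 (2 * R), g (x + s • e)) ≤
      ρ * ∫⁻ x in Ω, ‖fderiv ℝ φ x‖ₑ ^ 2 := by
    rw [lintegral_lintegral_swap hmu.aemeasurable]
    calc _ ≤ ∫⁻ s in Set.Ioo 0 (2 * R), (∫⁻ x in Ω, ‖fderiv ℝ φ x‖ₑ ^ 2) := by
          refine lintegral_mono fun s => ?_
          refine (setLIntegral_le_lintegral _ _).trans ?_
          rw [lintegral_add_right_eq_self g (s • e), hg, lintegral_indicator hΩ.measurableSet]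
      _ = _ := by rw [setLIntegral_const, Real.volume_Ioo, sub_zero, mul_comm]
  calc _ ≤ ∫⁻ x in Ω, (2 * (ρ * ∫⁻ s in Set.Ioo 0 (2 * R), g (x + s • e)) +
      2 * ‖φ (exitPoint Ω e x)‖ₑ ^ 2) := setLIntegral_mono' hΩ.measurableSet hpt
    _ = 2 * (ρ * ∫⁻ x in Ω, (∫⁻ s in Set.Ioo 0 (2 * R), g (x + s • e))) +
      2 * ∫⁻ x in Ω, ‖φ (exitPoint Ω e x)‖ₑ ^ 2 := by
        have hmq : Measurable fun x => 2 * ‖φ (exitPoint Ω e x)‖ₑ ^ 2 :=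
          (hmφ.comp (measurable_exitPoint hΩ he hR)).const_mul 2
        rw [lintegral_add_right _ hmq,
          lintegral_const_mul' _ _ (by norm_num), lintegral_const_mul' _ _ ENNReal.ofReal_ne_top,
          lintegral_const_mul' _ _ (by norm_num)]
    _ ≤ 2 * (ρ * (ρ * ∫⁻ x in Ω, ‖fderiv ℝ φ x‖ₑ ^ 2)) +
      2 * (ρ * ∫⁻ x, ‖φ x‖ₑ ^ 2 ∂(surf Ω)) := by
        gcongr
        exact lintegral_exitPoint_le hΩ he hR hmφ
    _ ≤ (2 * ρ * (ρ + 1)) * ((∫⁻ x in Ω, ‖fderiv ℝ φ x‖ₑ ^ 2) + ∫⁻ x, ‖φ x‖ₑ ^ 2 ∂(surf Ω)) := by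
        set a := ∫⁻ x in Ω, ‖fderiv ℝ φ x‖ₑ ^ 2
        set b := ∫⁻ x, ‖φ x‖ₑ ^ 2 ∂(surf Ω)
        calc _ ≤ 2 * (ρ * (ρ * a)) + 2 * (ρ * b) + (2 * ρ * a + 2 * ρ * ρ * b) := le_self_add
          _ = _ := by ring
    _ = _ := by
        rw [hρ, ENNReal.ofReal]
        push_cast
        rfl

/-- A coordinate function is not almost everywhere constant on the boundary. -/
lemma not_ae_surf_inner_eq_const {n : ℕ} {Ω : Set (E n)} (hΩ : IsOpen Ω) (hne : Ω.Nonempty)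
    (hb : Bornology.IsBounded Ω) {e : E n} (he : ‖e‖ = 1) (c : ℝ) :
    ¬ ∀ᵐ y ∂(surf Ω), inner ℝ e y = c := by
  intro h
  obtain ⟨R, hR⟩ := hb.subset_ball 0
  have he' : ‖-e‖ = 1 := by rw [norm_neg, he]
  -- An interior point exits in the directions `e` and `-e` at strictly different heights, one above
  -- it and one below.
  have hcontra : ∀ᵐ x ∂(vol Ω), False := by
    filter_upwards [ae_exitPoint hΩ he hR h, ae_exitPoint hΩ he' hR h,
      ae_restrict_mem hΩ.measurableSet] with x h1 h2 hx
    have h3 := exitTime_pos hΩ he hR hx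
    have h4 := exitTime_pos hΩ he' hR hx
    have hee : inner ℝ e e = (1 : ℝ) := by rw [real_inner_self_eq_norm_sq, he]; norm_num
    simp only [exitPoint, inner_add_right, inner_smul_right, inner_neg_right, hee] at h1 h2
    linarith
  rw [eventually_false_iff_eq_bot, ae_eq_bot, Measure.restrict_eq_zero] at hcontra
  exact (hΩ.measure_pos volume hne).ne' hcontra

/-! ### L² tools and mollification -/

lemma eLpNorm_two_sq {α F : Type*} [MeasurableSpace α] [NormedAddCommGroup F] (f : α → F)
    (μ : Measure α) : eLpNorm f 2 μ ^ 2 = ∫⁻ x, ‖f x‖ₑ ^ 2 ∂μ := by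
  have h := eLpNorm_nnreal_pow_eq_lintegral (f := f) (μ := μ) (p := 2) two_ne_zero
  norm_num at h
  exact h

lemma sq_lintegral_mul_le {α : Type*} [MeasurableSpace α] (μ : Measure α) {w g : α → ℝ≥0∞}
    (hw : Measurable w) (hg : Measurable g) :
    (∫⁻ x, w x * g x ∂μ) ^ 2 ≤ (∫⁻ x, w x ∂μ) * ∫⁻ x, w x * g x ^ 2 ∂μ := by
  have h := sq_lintegral_le (μ.withDensity w) hg.aemeasurable
  rw [lintegral_withDensity_eq_lintegral_mul _ hw hg, withDensity_apply _ MeasurableSet.univ,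
    lintegral_withDensity_eq_lintegral_mul _ hw (hg.pow_const 2), setLIntegral_univ] at h
  exact h

/-- Translations preserve Lebesgue measure and depend continuously on `t` as continuous maps, and
composition with them is continuous in L². -/
lemma tendsto_eLpNorm_translate_sub {n : ℕ} {F : Type*} [NormedAddCommGroup F] {g : E n → F} (hg : MemLp g 2) :
    Tendsto (fun t : E n => eLpNorm (fun x => g (x - t) - g x) 2) (𝓝 0) (𝓝 0) := by
  have hmp : ∀ t : E n, MeasurePreserving (fun x : E n => x - t) volume volume :=
    fun t => measurePreserving_sub_right volume t
  let T : E n → C(E n, E n) := fun t => ⟨fun x => x - t, by fun_prop⟩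
  have hT : Continuous T := by
    refine ContinuousMap.continuous_of_continuous_uncurry _ ?_
    simp only [T, Function.uncurry_def, ContinuousMap.coe_mk]
    fun_prop
  have h1 := (continuous_const (y := hg.toLp g)).compMeasurePreservingLp hT hmp
    (by norm_num : (2 : ℝ≥0∞) ≠ ⊤)
  have h2 := (h1.tendsto 0)
  have h3 := (tendsto_iff_edist_tendsto_0.1 h2)
  refine h3.congr fun t => ?_
  rw [Lp.edist_def]
  refine eLpNorm_congr_ae ?_
  have e1 := Lp.coeFn_compMeasurePreserving (hg.toLp g) (hmp t)
  have e2 := Lp.coeFn_compMeasurePreserving (hg.toLp g) (hmp 0)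
  have e3 := (hmp t).quasiMeasurePreserving.ae_eq_comp hg.coeFn_toLp
  have e4 := (hmp 0).quasiMeasurePreserving.ae_eq_comp hg.coeFn_toLp
  filter_upwards [e1, e2, e3, e4] with x h1 h2 h3 h4
  simp only [Function.comp_apply] at h1 h2 h3 h4
  simp only [Pi.sub_apply]
  change (Lp.compMeasurePreserving (fun x => x - t) (hmp t) (hg.toLp g) : E n → F) x -
    (Lp.compMeasurePreserving (fun x => x - 0) (hmp 0) (hg.toLp g) : E n → F) x = _
  rw [h1, h2, h3, h4, sub_zero]

section Mollify

variable {n : ℕ} {F : Type*} [NormedAddCommGroup F] [NormedSpace ℝ F]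

/-- Convolution of a vector-valued function with a scalar kernel. -/
noncomputable def mollify (f : E n → ℝ) (g : E n → F) : E n → F :=
  convolution f g (ContinuousLinearMap.lsmul ℝ ℝ) volume

lemma mollify_apply (f : E n → ℝ) (g : E n → F) (x : E n) :
    mollify f g x = ∫ t, f t • g (x - t) := rfl

lemma contDiff_mollify {f : E n → ℝ} (hf : ContDiff ℝ ∞ f) (hc : HasCompactSupport f) {g : E n → F}
    (hg : LocallyIntegrable g) : ContDiff ℝ ∞ (mollify f g) :=
  hc.contDiff_convolution_left _ hf hg

lemma integrable_mollify {f : E n → ℝ} (hf : Continuous f) (hc : HasCompactSupport f)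
    {g : E n → F} (hg : LocallyIntegrable g) (x : E n) : Integrable (fun t => f t • g (x - t)) :=
  hc.convolutionExists_left (ContinuousLinearMap.lsmul ℝ ℝ) hf hg x

/-- `f` is a smooth probability density supported in the ball of radius `r`. -/
structure IsMollifier (f : E n → ℝ) (r : ℝ) : Prop where
  contDiff : ContDiff ℝ ∞ f
  nonneg : ∀ x, 0 ≤ f x
  integral_eq_one : ∫ x, f x = 1
  tsupport_subset : tsupport f ⊆ Metric.closedBall 0 r

lemma IsMollifier.hasCompactSupport {f : E n → ℝ} {r : ℝ} (hf : IsMollifier f r) :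
    HasCompactSupport f :=
  (isCompact_closedBall 0 r).of_isClosed_subset (isClosed_tsupport f) hf.tsupport_subset

variable [CompleteSpace F]

/-- Since `f` is a probability density, the difference is an average of the increments of `g`;
Cauchy–Schwarz with weight `f` gives Jensen's inequality for the square. -/
lemma enorm_mollify_sub_sq_le {f : E n → ℝ} {r : ℝ} (hf : IsMollifier f r) {g : E n → F}
    (hg : StronglyMeasurable g) (hgl : LocallyIntegrable g) (x : E n) :
    ‖mollify f g x - g x‖ₑ ^ 2 ≤ ∫⁻ t, ‖f t‖ₑ * ‖g (x - t) - g x‖ₑ ^ 2 := by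
  have hfc := hf.contDiff.continuous
  have hfi : Integrable f := hfc.integrable_of_hasCompactSupport hf.hasCompactSupport
  have h1 : mollify f g x - g x = ∫ t, f t • (g (x - t) - g x) := by
    simp_rw [smul_sub]
    rw [integral_sub (integrable_mollify hfc hf.hasCompactSupport hgl x) (hfi.smul_const _),
      integral_smul_const, hf.integral_eq_one, one_smul, mollify_apply]
  have h2 : ∫⁻ t, ‖f t‖ₑ = 1 := by
    have := ofReal_integral_eq_lintegral_ofReal hfi (ae_of_all _ hf.nonneg)
    rw [hf.integral_eq_one, ENNReal.ofReal_one] at this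
    rw [this]
    exact lintegral_congr fun t => Real.enorm_of_nonneg (hf.nonneg t)
  have hm : Measurable fun t => ‖g (x - t) - g x‖ₑ :=
    ((hg.comp_measurable (measurable_const.sub measurable_id)).sub stronglyMeasurable_const).enorm
  have h3 := sq_lintegral_mul_le volume hfc.enorm.measurable hm
  rw [h2, one_mul] at h3
  refine le_trans ?_ h3
  gcongr
  rw [h1]
  refine (enorm_integral_le_lintegral_enorm _).trans (lintegral_mono fun t => ?_)
  rw [enorm_smul]

lemma eLpNorm_mollify_sub_le {f : E n → ℝ} {r : ℝ} (hf : IsMollifier f r) {g : E n → F}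
    (hg : StronglyMeasurable g) (hgl : LocallyIntegrable g) {C : ℝ≥0∞}
    (hC : ∀ t ∈ Metric.closedBall (0 : E n) r, eLpNorm (fun x => g (x - t) - g x) 2 ≤ C) :
    eLpNorm (fun x => mollify f g x - g x) 2 ≤ C := by
  have hfc := hf.contDiff.continuous
  have hfi : Integrable f := hfc.integrable_of_hasCompactSupport hf.hasCompactSupport
  have h2 : ∫⁻ t, ‖f t‖ₑ = 1 := by
    have := ofReal_integral_eq_lintegral_ofReal hfi (ae_of_all _ hf.nonneg)
    rw [hf.integral_eq_one, ENNReal.ofReal_one] at this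
    rw [this]
    exact lintegral_congr fun t => Real.enorm_of_nonneg (hf.nonneg t)
  have hm : Measurable (Function.uncurry fun (x t : E n) => ‖f t‖ₑ * ‖g (x - t) - g x‖ₑ ^ 2) := by
    refine (hfc.enorm.measurable.comp measurable_snd).mul (Measurable.pow_const ?_ 2)
    exact ((hg.comp_measurable (measurable_fst.sub measurable_snd)).sub
      (hg.comp_measurable measurable_fst)).enorm
  have key : eLpNorm (fun x => mollify f g x - g x) 2 ^ 2 ≤ C ^ 2 := by
    rw [eLpNorm_two_sq]
    calc _ ≤ ∫⁻ x, ∫⁻ t, ‖f t‖ₑ * ‖g (x - t) - g x‖ₑ ^ 2 :=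
          lintegral_mono fun x => enorm_mollify_sub_sq_le hf hg hgl x
      _ = ∫⁻ t, ∫⁻ x, ‖f t‖ₑ * ‖g (x - t) - g x‖ₑ ^ 2 := lintegral_lintegral_swap hm.aemeasurable
      _ ≤ ∫⁻ t, ‖f t‖ₑ * C ^ 2 := by
          refine lintegral_mono fun t => ?_
          rw [lintegral_const_mul' _ _ enorm_ne_top]
          by_cases ht : t ∈ tsupport f
          · rw [← eLpNorm_two_sq (fun x => g (x - t) - g x)]
            gcongr
            exact hC t (hf.tsupport_subset ht)
          · simp [image_eq_zero_of_notMem_tsupport ht]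
      _ = C ^ 2 := by rw [lintegral_mul_const _ hfc.enorm.measurable, h2, one_mul]
  exact le_of_not_gt fun hlt => (ENNReal.pow_lt_pow_left two_ne_zero hlt).not_ge key

lemma tendsto_eLpNorm_mollify_sub {f : ℕ → E n → ℝ} {r : ℕ → ℝ}
    (hf : ∀ k, IsMollifier (f k) (r k)) (hr : Tendsto r atTop (𝓝 0)) {g : E n → F}
    (hg : StronglyMeasurable g) (hg2 : MemLp g 2) :
    Tendsto (fun k => eLpNorm (fun x => mollify (f k) g x - g x) 2) atTop (𝓝 0) := by
  rw [ENNReal.tendsto_nhds_zero]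
  intro ε hε
  have h1 := (ENNReal.tendsto_nhds_zero.1 (tendsto_eLpNorm_translate_sub hg2)) ε hε
  obtain ⟨δ, hδ, hb⟩ := Metric.eventually_nhds_iff_ball.1 h1
  filter_upwards [hr.eventually (gt_mem_nhds hδ)] with k hk
  exact eLpNorm_mollify_sub_le (hf k) hg (hg2.locallyIntegrable (by norm_num))
    fun t ht => hb t (Metric.closedBall_subset_ball hk ht)

end Mollify

lemma gradient_eq_iff {n : ℕ} {f : E n → ℝ} {x G : E n} :
    gradient f x = G ↔ ∀ v, fderiv ℝ f x v = inner ℝ G v := by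
  rw [gradient]
  constructor
  · rintro rfl v
    rw [InnerProductSpace.toDual_symm_apply]
  · intro h
    refine (LinearIsometryEquiv.symm_apply_eq _).2 ?_
    ext v
    rw [h v, InnerProductSpace.toDual_apply_apply]

/-- Near points from which the reflected support of the kernel stays in `Ω`, mollification commutes
with the weak gradient. -/
lemma gradient_mollify {n : ℕ} {Ω : Set (E n)} (hΩ : MeasurableSet Ω) {u : E n → ℝ} {G : E n → E n}
    (hu : LocallyIntegrable (Ω.indicator u)) (hG : LocallyIntegrable (Ω.indicator G))
    (h : HasWeakGradient Ω u G) {f : E n → ℝ} (hf : ContDiff ℝ ∞ f) (hc : HasCompactSupport f)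
    {x : E n} (hx : ∀ t ∈ tsupport f, x - t ∈ Ω) :
    gradient (mollify f (Ω.indicator u)) x = mollify f (Ω.indicator G) x := by
  rw [gradient_eq_iff]
  intro v
  have hf1 : ContDiff ℝ 1 f := hf.of_le (by exact_mod_cast le_top)
  have h1 := hc.hasFDerivAt_convolution_left (ContinuousLinearMap.lsmul ℝ ℝ) hf1 hu x
  have hint := (hc.fderiv ℝ).convolutionExists_left
    ((ContinuousLinearMap.lsmul ℝ ℝ : ℝ →L[ℝ] ℝ →L[ℝ] ℝ).precompL (E n))
    (hf1.continuous_fderiv one_ne_zero) hu x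
  have h2 : fderiv ℝ (mollify f (Ω.indicator u)) x v =
      ∫ t, fderiv ℝ f t v * Ω.indicator u (x - t) := by
    rw [mollify, h1.fderiv, convolution_def, ContinuousLinearMap.integral_apply hint]
    rfl
  -- The reflected kernel is an admissible test function because its support lies in `Ω`. The sign
  -- from reflection cancels the one in the definition of the weak gradient.
  have hθ : ContDiff ℝ ∞ fun y => f (x - y) := hf.comp (contDiff_const.sub contDiff_id)
  have hθc : HasCompactSupport fun y => f (x - y) := hc.comp_homeomorph (Homeomorph.subLeft x)
  have hθs : tsupport (fun y => f (x - y)) ⊆ Ω := by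
    have h3 : tsupport (fun y => f (x - y)) = (Homeomorph.subLeft x) ⁻¹' tsupport f :=
      tsupport_comp_eq_preimage f (Homeomorph.subLeft x)
    intro y hy
    rw [h3] at hy
    have := hx _ hy
    simpa using this
  have hθd : ∀ y, fderiv ℝ (fun y => f (x - y)) y v = - fderiv ℝ f (x - y) v := by
    intro y
    have h4 : HasFDerivAt (fun y : E n => x - y) (-(ContinuousLinearMap.id ℝ (E n))) y :=
      (hasFDerivAt_id y).const_sub x
    have h5 := ((hf1.differentiable one_ne_zero) (x - y)).hasFDerivAt.comp y h4
    have h6 : fderiv ℝ (fun y => f (x - y)) y = _ := h5.fderiv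
    rw [h6]; simp
  have hw := h _ hθ hθc hθs v
  rw [h2, ← integral_sub_left_eq_self _ volume x]
  simp only [sub_sub_cancel]
  have h7 : ∫ y, fderiv ℝ f (x - y) v * Ω.indicator u y =
      - ∫ y in Ω, u y * fderiv ℝ (fun y => f (x - y)) y v := by
    rw [← integral_neg, ← integral_indicator hΩ]
    refine integral_congr_ae (ae_of_all _ fun y => ?_)
    by_cases hy : y ∈ Ω <;> simp [hy, hθd, mul_comm]
  rw [h7, hw, neg_neg, mollify_apply, real_inner_comm,
    ← integral_inner (integrable_mollify hf.continuous hc hG x)]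
  rw [← integral_indicator hΩ,
    ← integral_sub_left_eq_self (fun t => inner ℝ v (f t • Ω.indicator G (x - t))) volume x]
  refine integral_congr_ae (ae_of_all _ fun y => ?_)
  by_cases hy : y ∈ Ω <;> simp [hy, inner_smul_right, real_inner_comm]

/-! ### Density of functions smooth up to the boundary -/

lemma exists_smooth_partition {n : ℕ} {K : Set (E n)} (hK : IsCompact K) {r : E n → ℝ}
    (hr : ∀ p ∈ K, 0 < r p) :
    ∃ (ι : Type) (_ : Fintype ι) (c : ι → E n) (χ : ι → E n → ℝ), (∀ i, c i ∈ K) ∧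
      (∀ i, ContDiff ℝ ∞ (χ i)) ∧ (∀ i, HasCompactSupport (χ i)) ∧
      (∀ i x, χ i x ≠ 0 → dist x (c i) < r (c i)) ∧ ∀ x ∈ K, ∑ i, χ i x = 1 := by
  obtain ⟨T, hTK, hcov⟩ := hK.elim_nhds_subcover (fun p => Metric.ball p (r p))
    (fun p hp => Metric.ball_mem_nhds p (hr p hp))
  have hcov' : K ⊆ ⋃ i : T, Metric.ball (i.1 : E n) (r i.1) := by
    intro x hx
    have := hcov hx
    simp only [Set.mem_iUnion] at this ⊢
    obtain ⟨i, hi, hxi⟩ := this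
    exact ⟨⟨i, hi⟩, hxi⟩
  obtain ⟨ρ, hρ⟩ := SmoothPartitionOfUnity.exists_isSubordinate (I := modelWithCornersSelf ℝ (E n))
    hK.isClosed (fun i : T => Metric.ball (i.1 : E n) (r i.1)) (fun _ => Metric.isOpen_ball) hcov'
  refine ⟨T, inferInstance, fun i => i.1, fun i => ρ i, fun i => hTK i.1 i.2, fun i => (ρ i).contMDiff.contDiff,
    fun i => ?_, fun i x hx => ?_, fun x hx => ?_⟩
  · exact (isCompact_closedBall (i.1 : E n) (r i.1)).of_isClosed_subset (isClosed_tsupport _)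
      ((hρ i).trans Metric.ball_subset_closedBall)
  · exact hρ i (subset_tsupport _ hx)
  · rw [← finsum_eq_sum_of_fintype]
    exact ρ.sum_eq_one hx

/-- The bumps are centred at `-(τ k • e)` with radius less than `c * τ k`, so for `t` in the support
`x - t` lies in the cone ball about `x + τ k • e`. Mollifying near the boundary then only uses
values inside `Ω`. -/
lemma exists_mollifier_of_hasCone {n : ℕ} {Ω : Set (E n)} {p e : E n} {c r h : ℝ} (hc : 0 < c)
    (hh : 0 < h) (hcone : HasCone Ω p e c r h) :
    ∃ (f : ℕ → E n → ℝ) (R : ℕ → ℝ), (∀ k, IsMollifier (f k) (R k)) ∧ Tendsto R atTop (𝓝 0) ∧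
      ∀ k, ∀ x ∈ closure Ω, dist x p < r → ∀ t ∈ tsupport (f k), x - t ∈ Ω := by
  set τ : ℕ → ℝ := fun k => h / (k + 2) with hτ
  have hτpos : ∀ k, 0 < τ k := fun k => by positivity
  have hτh : ∀ k, τ k < h := fun k => by
    rw [hτ]; simp only
    rw [div_lt_iff₀ (by positivity)]
    nlinarith [(Nat.cast_nonneg k : (0 : ℝ) ≤ k)]
  have hτ0 : Tendsto τ atTop (𝓝 0) := by
    refine Tendsto.div_atTop tendsto_const_nhds ?_
    exact tendsto_atTop_add_const_right _ _ tendsto_natCast_atTop_atTop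
  let b : (k : ℕ) → ContDiffBump (-(τ k • e)) := fun k =>
    ⟨c * τ k / 4, c * τ k / 2, by have := hτpos k; positivity, by
      have := mul_pos hc (hτpos k); linarith⟩
  have hts : ∀ k, tsupport ((b k).normed volume) = Metric.closedBall (-(τ k • e)) (c * τ k / 2) :=
    fun k => (b k).tsupport_normed_eq
  refine ⟨fun k => (b k).normed volume, fun k => τ k * (‖e‖ + c), fun k => ⟨?_, ?_, ?_, ?_⟩, ?_, ?_⟩
  · exact (b k).contDiff_normed
  · exact (b k).nonneg_normed
  · exact (b k).integral_normed
  · rw [hts]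
    refine Metric.closedBall_subset_closedBall' ?_
    rw [dist_zero_right, norm_neg, norm_smul, Real.norm_of_nonneg (hτpos k).le]
    nlinarith [hτpos k]
  · simpa using hτ0.mul_const (‖e‖ + c)
  · intro k x hx hxp t ht
    rw [hts, Metric.mem_closedBall, dist_eq_norm] at ht
    refine hcone x hx hxp (τ k) (hτpos k) (hτh k) ?_
    rw [Metric.mem_ball, dist_eq_norm]
    have h1 : ‖x - t - (x + τ k • e)‖ = ‖t - -(τ k • e)‖ := by
      rw [← norm_neg]; congr 1; abel
    rw [h1]
    have := mul_pos hc (hτpos k)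
    linarith

lemma memLp_indicator {n : ℕ} {Ω : Set (E n)} (hΩ : MeasurableSet Ω) {F : Type*}
    [NormedAddCommGroup F] (u : Lp F 2 (vol Ω)) : MemLp (Ω.indicator u) 2 volume :=
  (memLp_indicator_iff_restrict hΩ).2 (Lp.memLp u)

lemma stronglyMeasurable_indicator {n : ℕ} {Ω : Set (E n)} (hΩ : MeasurableSet Ω) {F : Type*}
    [NormedAddCommGroup F] (u : Lp F 2 (vol Ω)) : StronglyMeasurable (Ω.indicator u) :=
  (Lp.stronglyMeasurable u).indicator hΩ

lemma gradient_sum_mul {n : ℕ} {ι : Type*} [Fintype ι] {χ m : ι → E n → ℝ} {x : E n}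
    (hχ : ∀ i, DifferentiableAt ℝ (χ i) x) (hm : ∀ i, DifferentiableAt ℝ (m i) x) :
    gradient (fun x => ∑ i, χ i x * m i x) x =
      ∑ i, (χ i x • gradient (m i) x + m i x • gradient (χ i) x) := by
  rw [gradient_eq_iff]
  intro v
  rw [fderiv_fun_sum fun i _ => (hχ i).fun_mul (hm i)]
  simp only [FunLike.coe_sum, Finset.sum_apply, sum_inner]
  refine Finset.sum_congr rfl fun i _ => ?_
  rw [fderiv_fun_mul (hχ i) (hm i)]
  rw [inner_add_left, real_inner_smul_left, real_inner_smul_left,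
    ← gradient_eq_iff.1 (rfl : gradient (m i) x = _) v,
    ← gradient_eq_iff.1 (rfl : gradient (χ i) x = _) v]
  simp

lemma sum_gradient_eq_zero {n : ℕ} {ι : Type*} [Fintype ι] {χ : ι → E n → ℝ} {Ω : Set (E n)}
    (hΩ : IsOpen Ω) (hχ : ∀ i, ContDiff ℝ ∞ (χ i)) (hsum : ∀ x ∈ Ω, ∑ i, χ i x = 1) {x : E n}
    (hx : x ∈ Ω) : ∑ i, gradient (χ i) x = 0 := by
  have h1 : fderiv ℝ (fun x => ∑ i, χ i x) x = 0 := by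
    have h2 : (fun x => ∑ i, χ i x) =ᶠ[𝓝 x] fun _ => (1 : ℝ) :=
      eventually_of_mem (hΩ.mem_nhds hx) hsum
    rw [h2.fderiv_eq]; simp
  refine ext_inner_right ℝ fun v => ?_
  rw [sum_inner, inner_zero_left]
  have h3 := congrArg (fun L => L v) h1
  rw [fderiv_fun_sum fun i _ => (hχ i).differentiable (by simp) x] at h3
  simp only [FunLike.coe_sum, Finset.sum_apply, zero_apply] at h3
  rw [← h3]
  exact Finset.sum_congr rfl fun i _ => (gradient_eq_iff.1 rfl v).symm

lemma continuous_gradient {n : ℕ} {φ : E n → ℝ} (hφ : ContDiff ℝ ∞ φ) : Continuous (gradient φ) :=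
  (InnerProductSpace.toDual ℝ (E n)).symm.continuous.comp (hφ.continuous_fderiv (by simp))

lemma norm_gradient {n : ℕ} (φ : E n → ℝ) (x : E n) : ‖gradient φ x‖ = ‖fderiv ℝ φ x‖ := by
  rw [gradient, LinearIsometryEquiv.norm_map]

lemma enorm_gradient {n : ℕ} (φ : E n → ℝ) (x : E n) : ‖gradient φ x‖ₑ = ‖fderiv ℝ φ x‖ₑ := by
  rw [← ofReal_norm, ← ofReal_norm, norm_gradient]

lemma gradient_eq_zero_of_fderiv {n : ℕ} {φ : E n → ℝ} {x : E n} (h : fderiv ℝ φ x = 0) :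
    gradient φ x = 0 := by
  rw [gradient, h, map_zero]

lemma hasCompactSupport_gradient {n : ℕ} {φ : E n → ℝ} (hc : HasCompactSupport φ) :
    HasCompactSupport (gradient φ) :=
  (hc.fderiv ℝ).comp_left (g := (InnerProductSpace.toDual ℝ (E n)).symm) (map_zero _)

/-- Functions smooth up to the boundary are dense in `H¹(Ω)`. -/
lemma exists_smooth_approx {n : ℕ} {Ω : Set (E n)} (hΩ : IsBoundedLipschitzDomain Ω) (u : H1 Ω) :
    ∃ φ : ℕ → E n → ℝ, (∀ k, ContDiff ℝ ∞ (φ k) ∧ HasCompactSupport (φ k)) ∧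
      Tendsto (fun k => eLpNorm (fun x => φ k x - fn u x) 2 (vol Ω)) atTop (𝓝 0) ∧
      Tendsto (fun k => eLpNorm (fun x => gradient (φ k) x - grad u x) 2 (vol Ω)) atTop (𝓝 0) := by
  have hΩm : MeasurableSet Ω := hΩ.isOpen.measurableSet
  have hcone : ∀ p : E n, ∃ (e : E n) (c r h : ℝ), p ∈ closure Ω → 0 < c ∧ 0 < r ∧ 0 < h ∧
      HasCone Ω p e c r h := by
    intro p
    by_cases hp : p ∈ closure Ω
    · obtain ⟨e, c, r, h, H⟩ := exists_hasCone hΩ hp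
      exact ⟨e, c, r, h, fun _ => H⟩
    · exact ⟨0, 0, 0, 0, fun h => absurd h hp⟩
  choose e c r h H using hcone
  have hK : IsCompact (closure Ω) :=
    Metric.isCompact_of_isClosed_isBounded isClosed_closure hΩ.isBounded.closure
  obtain ⟨ι, _, p, χ, hp, hχ, hχc, hχp, hχ1⟩ := exists_smooth_partition hK (r := r)
    (fun p hp => (H p hp).2.1)
  have hmol := fun i => exists_mollifier_of_hasCone (H (p i) (hp i)).1 (H (p i) (hp i)).2.2.1
    (H (p i) (hp i)).2.2.2
  choose f R hf hR hfx using hmol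
  set U := Ω.indicator (fn u) with hU
  set G := Ω.indicator (grad u) with hG
  have hU2 : MemLp U 2 volume := memLp_indicator hΩm _
  have hG2 : MemLp G 2 volume := memLp_indicator hΩm _
  have hUs : StronglyMeasurable U := stronglyMeasurable_indicator hΩm _
  have hGs : StronglyMeasurable G := stronglyMeasurable_indicator hΩm _
  have hUl : LocallyIntegrable U := hU2.locallyIntegrable (by norm_num)
  have hGl : LocallyIntegrable G := hG2.locallyIntegrable (by norm_num)
  -- Each patch is mollified with kernels adapted to its own cone; the approximant is the sum of
  -- these weighted by the partition of unity.
  set m : ι → ℕ → E n → ℝ := fun i k => mollify (f i k) U with hm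
  set g : ι → ℕ → E n → E n := fun i k => mollify (f i k) G with hg
  have hmc : ∀ i k, ContDiff ℝ ∞ (m i k) := fun i k =>
    contDiff_mollify (hf i k).contDiff (hf i k).hasCompactSupport hUl
  have hgc : ∀ i k, ContDiff ℝ ∞ (g i k) := fun i k =>
    contDiff_mollify (hf i k).contDiff (hf i k).hasCompactSupport hGl
  have hA : ∀ i, Tendsto (fun k => eLpNorm (fun x => m i k x - U x) 2 volume) atTop (𝓝 0) :=
    fun i => tendsto_eLpNorm_mollify_sub (hf i) (hR i) hUs hU2
  have hB : ∀ i, Tendsto (fun k => eLpNorm (fun x => g i k x - G x) 2 volume) atTop (𝓝 0) :=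
    fun i => tendsto_eLpNorm_mollify_sub (hf i) (hR i) hGs hG2
  have hbd : ∀ i, ∃ M : ℝ, ∀ x, ‖χ i x‖ ≤ M := fun i =>
    (hχc i).exists_bound_of_continuous (hχ i).continuous
  have hbd' : ∀ i, ∃ M : ℝ, ∀ x, ‖gradient (χ i) x‖ ≤ M := fun i =>
    (hasCompactSupport_gradient (hχc i)).exists_bound_of_continuous (continuous_gradient (hχ i))
  choose M hM using hbd
  choose M' hM' using hbd'
  -- Mollification commutes with the gradient only near the centre of the patch, which is enough
  -- where `χ i` does not vanish.
  have hgrad : ∀ i k, ∀ x ∈ Ω, χ i x • gradient (m i k) x = χ i x • g i k x := by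
    intro i k x hx
    by_cases hx0 : χ i x = 0
    · rw [hx0, zero_smul, zero_smul]
    · rw [gradient_mollify hΩm hUl hGl u.2 (hf i k).contDiff (hf i k).hasCompactSupport
        (hfx i k x (subset_closure hx) (hχp i x hx0))]
  have hχm : ∀ i, Measurable (χ i) := fun i => (hχ i).continuous.measurable
  refine ⟨fun k x => ∑ i, χ i x * m i k x, fun k => ⟨?_, ?_⟩, ?_, ?_⟩
  · exact ContDiff.sum fun i _ => (hχ i).mul (hmc i k)
  · refine HasCompactSupport.intro (K := ⋃ i, tsupport (χ i)) (isCompact_iUnion fun i => hχc i) ?_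
    intro x hx
    simp only [Set.mem_iUnion, not_exists] at hx
    exact Finset.sum_eq_zero fun i _ => by rw [image_eq_zero_of_notMem_tsupport (hx i), zero_mul]
  · have hlim : Tendsto (fun k => ∑ i, ENNReal.ofReal (M i) *
        eLpNorm (fun x => m i k x - U x) 2 volume) atTop (𝓝 0) := by
      have := tendsto_finsetSum Finset.univ fun i _ =>
        ENNReal.Tendsto.const_mul (a := ENNReal.ofReal (M i)) (hA i) (Or.inr ENNReal.ofReal_ne_top)
      simpa using this
    refine tendsto_of_tendsto_of_tendsto_of_le_of_le tendsto_const_nhds hlim (fun _ => zero_le) ?_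
    intro k
    have h1 : eLpNorm (fun x => (∑ i, χ i x * m i k x) - fn u x) 2 (vol Ω) =
        eLpNorm (∑ i, fun x => χ i x * (m i k x - U x)) 2 (vol Ω) := by
      refine eLpNorm_congr_ae ?_
      filter_upwards [ae_restrict_mem hΩm] with x hx
      simp only [Finset.sum_apply, mul_sub, Finset.sum_sub_distrib, ← Finset.sum_mul,
        hχ1 x (subset_closure hx), one_mul, hU, Set.indicator_of_mem hx]
    simp only
    rw [h1]
    refine (eLpNorm_sum_le (fun i _ => ?_) (by norm_num)).trans (Finset.sum_le_sum fun i _ => ?_)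
    · exact ((hχm i).mul ((hmc i k).continuous.measurable.sub hUs.measurable)).aestronglyMeasurable
    · refine (eLpNorm_mono_measure _ Measure.restrict_le_self).trans ?_
      refine eLpNorm_le_mul_eLpNorm_of_ae_le_mul (ae_of_all _ fun x => ?_) 2
      rw [norm_mul]
      gcongr
      exact hM i x
  · have hlim : Tendsto (fun k => ∑ i, (ENNReal.ofReal (M i) *
        eLpNorm (fun x => g i k x - G x) 2 volume + ENNReal.ofReal (M' i) *
        eLpNorm (fun x => m i k x - U x) 2 volume)) atTop (𝓝 0) := by
      have := tendsto_finsetSum Finset.univ fun i _ =>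
        (ENNReal.Tendsto.const_mul (a := ENNReal.ofReal (M i)) (hB i)
          (Or.inr ENNReal.ofReal_ne_top)).add
        (ENNReal.Tendsto.const_mul (a := ENNReal.ofReal (M' i)) (hA i)
          (Or.inr ENNReal.ofReal_ne_top))
      simpa using this
    refine tendsto_of_tendsto_of_tendsto_of_le_of_le tendsto_const_nhds hlim (fun _ => zero_le) ?_
    intro k
    have h1 : eLpNorm (fun x => gradient (fun x => ∑ i, χ i x * m i k x) x - grad u x) 2 (vol Ω) =
        eLpNorm (∑ i, ((fun x => χ i x • (g i k x - G x)) +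
          fun x => (m i k x - U x) • gradient (χ i) x)) 2 (vol Ω) := by
      refine eLpNorm_congr_ae ?_
      filter_upwards [ae_restrict_mem hΩm] with x hx
      rw [gradient_sum_mul (fun i => (hχ i).differentiable (by simp) x)
        (fun i => (hmc i k).differentiable (by simp) x)]
      -- Because the gradients of the partition sum to zero, `U x` may be subtracted from each
      -- factor multiplying `gradient (χ i) x`, so that factor tends to zero in L².
      have h2 := sum_gradient_eq_zero hΩ.isOpen hχ (fun x hx => hχ1 x (subset_closure hx)) hx
      simp only [Finset.sum_apply, Pi.add_apply, smul_sub, sub_smul, Finset.sum_add_distrib,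
        Finset.sum_sub_distrib, ← Finset.sum_smul, ← Finset.smul_sum, h2,
        hχ1 x (subset_closure hx), one_smul, hG, Set.indicator_of_mem hx, smul_zero, sub_zero]
      rw [Finset.sum_congr rfl fun i _ => hgrad i k x hx]
      abel
    simp only
    rw [h1]
    have ms1 : ∀ i, AEStronglyMeasurable (fun x => χ i x • (g i k x - G x)) (vol Ω) := fun i =>
      ((hχm i).smul ((hgc i k).continuous.measurable.sub hGs.measurable)).aestronglyMeasurable
    have ms2 : ∀ i, AEStronglyMeasurable (fun x => (m i k x - U x) • gradient (χ i) x) (vol Ω) :=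
      fun i => (((hmc i k).continuous.measurable.sub hUs.measurable).smul
        (continuous_gradient (hχ i)).measurable).aestronglyMeasurable
    refine (eLpNorm_sum_le (fun i _ => (ms1 i).add (ms2 i)) (by norm_num)).trans
      (Finset.sum_le_sum fun i _ => ?_)
    refine (eLpNorm_add_le (ms1 i) (ms2 i) (by norm_num)).trans (add_le_add ?_ ?_)
    · refine (eLpNorm_mono_measure _ Measure.restrict_le_self).trans ?_
      refine eLpNorm_le_mul_eLpNorm_of_ae_le_mul (ae_of_all _ fun x => ?_) 2
      rw [norm_smul]
      gcongr
      exact hM i x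
    · refine (eLpNorm_mono_measure _ Measure.restrict_le_self).trans ?_
      refine eLpNorm_le_mul_eLpNorm_of_ae_le_mul (ae_of_all _ fun x => ?_) 2
      rw [norm_smul, mul_comm]
      gcongr
      exact hM' i x

/-! ### Completeness of H¹ and restriction of smooth functions -/

lemma toLp_norm_sq {α F : Type*} [MeasurableSpace α] [NormedAddCommGroup F] {μ : Measure α}
    (f : Lp F 2 μ) : ENNReal.ofReal (‖f‖ ^ 2) = ∫⁻ x, ‖f x‖ₑ ^ 2 ∂μ := by
  rw [← eLpNorm_two_sq, ENNReal.ofReal_pow (norm_nonneg _), Lp.norm_def,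
    ENNReal.ofReal_toReal (Lp.eLpNorm_ne_top f)]

/-- Each test identity equates two inner products with fixed L² elements, a closed condition on the
pair. -/
lemma isClosed_H1 {n : ℕ} (Ω : Set (E n)) :
    IsClosed (H1 Ω : Set (Lp ℝ 2 (vol Ω) × Lp (E n) 2 (vol Ω))) := by
  have h : (H1 Ω : Set (Lp ℝ 2 (vol Ω) × Lp (E n) 2 (vol Ω))) =
      ⋂ (φ : E n → ℝ) (_ : ContDiff ℝ ∞ φ) (_ : HasCompactSupport φ) (_ : tsupport φ ⊆ Ω) (v : E n),
        {p | ∫ x in Ω, p.1 x * fderiv ℝ φ x v = - ∫ x in Ω, φ x * inner ℝ (p.2 x) v} := by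
    ext p
    simp only [Set.mem_iInter, Set.mem_ofPred_eq]
    rfl
  rw [h]
  refine isClosed_iInter fun φ => isClosed_iInter fun hφ => isClosed_iInter fun hc =>
    isClosed_iInter fun _ => isClosed_iInter fun v => ?_
  have m1 : MemLp (fun x => fderiv ℝ φ x v) 2 (vol Ω) :=
    ((((hφ.continuous_fderiv (by simp)).clm_apply continuous_const).memLp_of_hasCompactSupport
      (hc.fderiv_apply (𝕜 := ℝ) v) (μ := volume))).restrict Ω
  have m2 : MemLp (fun x => φ x • v) 2 (vol Ω) :=
    ((hφ.continuous.smul continuous_const).memLp_of_hasCompactSupport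
      (hc.smul_right) (μ := volume)).restrict Ω
  have e1 : ∀ p : Lp ℝ 2 (vol Ω) × Lp (E n) 2 (vol Ω),
      ∫ x in Ω, p.1 x * fderiv ℝ φ x v = inner ℝ (m1.toLp _) p.1 := by
    intro p
    rw [L2.inner_def]
    refine integral_congr_ae ?_
    filter_upwards [m1.coeFn_toLp] with x hx
    rw [hx]; simp
  have e2 : ∀ p : Lp ℝ 2 (vol Ω) × Lp (E n) 2 (vol Ω),
      ∫ x in Ω, φ x * inner ℝ (p.2 x) v = inner ℝ (m2.toLp _) p.2 := by
    intro p
    rw [L2.inner_def]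
    refine integral_congr_ae ?_
    filter_upwards [m2.coeFn_toLp] with x hx
    rw [hx, real_inner_smul_left, real_inner_comm]
  simp_rw [e1, e2]
  exact isClosed_eq (by fun_prop) (by fun_prop)

instance {n : ℕ} (Ω : Set (E n)) : CompleteSpace (H1 Ω) :=
  (isClosed_H1 Ω).completeSpace_coe

/-- The function underlying an element of `H¹(Ω)`, as a continuous linear map. -/
noncomputable def fnL {n : ℕ} (Ω : Set (E n)) : H1 Ω →L[ℝ] Lp ℝ 2 (vol Ω) :=
  (ContinuousLinearMap.fst ℝ _ _).comp (H1 Ω).subtypeL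

/-- The weak gradient as a continuous linear map. -/
noncomputable def gradL {n : ℕ} (Ω : Set (E n)) : H1 Ω →L[ℝ] Lp (E n) 2 (vol Ω) :=
  (ContinuousLinearMap.snd ℝ _ _).comp (H1 Ω).subtypeL

/-- The norm is the maximum inherited from the product, not a Hilbert norm; this is why the abstract
part assumes only a normed space `V`. -/
lemma norm_H1 {n : ℕ} {Ω : Set (E n)} (u : H1 Ω) : ‖u‖ = max ‖fnL Ω u‖ ‖gradL Ω u‖ := rfl

/-- By the fundamental lemma of the calculus of variations, a zero function has only the zero weak
gradient, so the stored pair vanishes. -/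
lemma eq_zero_of_fnL_eq_zero {n : ℕ} {Ω : Set (E n)} (hΩ : IsOpen Ω) {u : H1 Ω}
    (hu : fnL Ω u = 0) : u = 0 := by
  have hg : grad u = 0 := by
    rw [Lp.eq_zero_iff_ae_eq_zero]
    have hall : ∀ v : E n, ∀ᵐ x, x ∈ Ω → inner ℝ (grad u x) v = 0 := by
      intro v
      refine hΩ.ae_eq_zero_of_integral_contDiff_smul_eq_zero ?_ fun φ hφ hc hs => ?_
      · have h1 : MemLp (fun x => inner ℝ (grad u x) v) 2 (vol Ω) :=
          (Lp.memLp (grad u)).inner_const v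
        exact (locallyIntegrableOn_of_locallyIntegrable_restrict
          (h1.locallyIntegrable (by norm_num)))
      · have h1 := u.2 φ hφ hc hs v
        have h2 : ∫ x in Ω, fn u x * fderiv ℝ φ x v = 0 := by
          rw [← integral_zero (E n) ℝ (μ := vol Ω)]
          refine integral_congr_ae ?_
          have h3 : fn u = 0 := hu
          filter_upwards [(Lp.eq_zero_iff_ae_eq_zero.1 h3)] with x hx
          rw [hx]; simp
        have h4 : ∫ x in Ω, φ x * inner ℝ (grad u x) v = 0 := by
          have h5 : ∫ x in Ω, fn u x * fderiv ℝ φ x v = - ∫ x in Ω, φ x * inner ℝ (grad u x) v := h1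
          linarith
        rw [← h4]
        refine (setIntegral_eq_integral_of_forall_compl_eq_zero fun x hx => ?_).symm
        rw [image_eq_zero_of_notMem_tsupport fun h => hx (hs h), zero_smul]
    have hbasis := ae_all_iff.2 fun i : Fin n => hall (EuclideanSpace.single i 1)
    refine (ae_restrict_iff' hΩ.measurableSet).2 ?_
    filter_upwards [hbasis] with x hx hxΩ
    ext i
    have := hx i hxΩ
    simpa [EuclideanSpace.inner_single_right] using this
  exact Subtype.ext (Prod.ext hu hg)

/-- The compactly supported smooth functions on `ℝⁿ`. -/
def Smooth (n : ℕ) : Submodule ℝ (E n → ℝ) where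
  carrier := {φ | ContDiff ℝ ∞ φ ∧ HasCompactSupport φ}
  zero_mem' := ⟨contDiff_const, HasCompactSupport.zero⟩
  add_mem' := fun h k => ⟨h.1.add k.1, h.2.add k.2⟩
  smul_mem' := fun c _ h => ⟨contDiff_const.smul h.1, h.2.smul_left (f := fun _ => c)⟩

lemma memLp_smooth {n : ℕ} (φ : Smooth n) (μ : Measure (E n)) [IsFiniteMeasureOnCompacts μ] :
    MemLp (φ : E n → ℝ) 2 μ :=
  φ.2.1.continuous.memLp_of_hasCompactSupport φ.2.2

lemma memLp_gradient {n : ℕ} (φ : Smooth n) (μ : Measure (E n)) [IsFiniteMeasureOnCompacts μ] :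
    MemLp (gradient (φ : E n → ℝ)) 2 μ :=
  (continuous_gradient φ.2.1).memLp_of_hasCompactSupport (hasCompactSupport_gradient φ.2.2)

/-- The test function vanishes off `Ω`, so this is integration by parts on the whole space and no
boundary term arises. -/
lemma hasWeakGradient_smooth {n : ℕ} (Ω : Set (E n)) (φ : Smooth n) :
    HasWeakGradient Ω φ (gradient (φ : E n → ℝ)) := by
  intro ψ hψ hc hs v
  have hφ := φ.2.1
  have c1 : Continuous fun x => fderiv ℝ (φ : E n → ℝ) x v :=
    (hφ.continuous_fderiv (by simp)).clm_apply continuous_const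
  have c2 : Continuous fun x => fderiv ℝ ψ x v :=
    (hψ.continuous_fderiv (by simp)).clm_apply continuous_const
  have h1 : ∫ x in Ω, φ.1 x * fderiv ℝ ψ x v = ∫ x, φ.1 x * fderiv ℝ ψ x v := by
    refine setIntegral_eq_integral_of_forall_compl_eq_zero fun x hx => ?_
    have : x ∉ tsupport (fderiv ℝ ψ) := fun h => hx (hs (tsupport_fderiv_subset ℝ h))
    rw [image_eq_zero_of_notMem_tsupport this]; simp
  have h2 : ∫ x in Ω, ψ x * inner ℝ (gradient φ.1 x) v = ∫ x, fderiv ℝ φ.1 x v * ψ x := by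
    rw [setIntegral_eq_integral_of_forall_compl_eq_zero fun x hx => ?_]
    · refine integral_congr_ae (ae_of_all _ fun x => ?_)
      simp only
      rw [← gradient_eq_iff.1 rfl v, mul_comm]
    · rw [image_eq_zero_of_notMem_tsupport fun h => hx (hs h), zero_mul]
  rw [h1, h2]
  refine integral_mul_fderiv_eq_neg_fderiv_mul_of_integrable ?_ ?_ ?_ ?_ ?_
  · exact (c1.mul hψ.continuous).integrable_of_hasCompactSupport hc.mul_left
  · exact (hφ.continuous.mul c2).integrable_of_hasCompactSupport φ.2.2.mul_right
  · exact (hφ.continuous.mul hψ.continuous).integrable_of_hasCompactSupport hc.mul_left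
  · exact fun x _ => hφ.differentiable (by simp) x
  · exact fun x _ => hψ.differentiable (by simp) x

lemma HasWeakGradient.congr {n : ℕ} {Ω : Set (E n)} {u u' : E n → ℝ} {G G' : E n → E n}
    (h : HasWeakGradient Ω u G) (hu : u' =ᵐ[vol Ω] u) (hG : G' =ᵐ[vol Ω] G) :
    HasWeakGradient Ω u' G' := by
  intro φ hφ hc hs v
  rw [integral_congr_ae (hu.mono fun x hx => by simp only [hx] :
      (fun x => u' x * fderiv ℝ φ x v) =ᵐ[vol Ω] fun x => u x * fderiv ℝ φ x v),
    integral_congr_ae (hG.mono fun x hx => by simp only [hx] :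
      (fun x => φ x * inner ℝ (G' x) v) =ᵐ[vol Ω] fun x => φ x * inner ℝ (G x) v)]
  exact h φ hφ hc hs v

lemma gradient_add_smooth {n : ℕ} (φ ψ : Smooth n) (x : E n) :
    gradient (φ + ψ : Smooth n).1 x = gradient φ.1 x + gradient ψ.1 x := by
  rw [gradient_eq_iff]
  intro v
  change fderiv ℝ (φ.1 + ψ.1) x v = _
  rw [fderiv_add (φ.2.1.differentiable (by simp) x) (ψ.2.1.differentiable (by simp) x),
    inner_add_left, ← gradient_eq_iff.1 rfl v, ← gradient_eq_iff.1 rfl v]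
  rfl

lemma gradient_smul_smooth {n : ℕ} (c : ℝ) (φ : Smooth n) (x : E n) :
    gradient (c • φ : Smooth n).1 x = c • gradient φ.1 x := by
  rw [gradient_eq_iff]
  intro v
  change fderiv ℝ (c • φ.1) x v = _
  rw [fderiv_const_smul (φ.2.1.differentiable (by simp) x), real_inner_smul_left,
    ← gradient_eq_iff.1 rfl v]
  rfl

/-- Restriction of smooth functions to elements of `H¹(Ω)`. -/
noncomputable def smoothToH1 {n : ℕ} (Ω : Set (E n)) : Smooth n →ₗ[ℝ] H1 Ω where
  toFun φ := ⟨((memLp_smooth φ (vol Ω)).toLp _, (memLp_gradient φ (vol Ω)).toLp _),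
    (hasWeakGradient_smooth Ω φ).congr (memLp_smooth φ (vol Ω)).coeFn_toLp
      (memLp_gradient φ (vol Ω)).coeFn_toLp⟩
  map_add' φ ψ := by
    refine Subtype.ext (Prod.ext rfl ?_)
    change (memLp_gradient (φ + ψ) (vol Ω)).toLp _ =
      (memLp_gradient φ (vol Ω)).toLp _ + (memLp_gradient ψ (vol Ω)).toLp _
    rw [← MemLp.toLp_add]
    congr 1
    ext1 x
    exact gradient_add_smooth φ ψ x
  map_smul' c φ := by
    refine Subtype.ext (Prod.ext rfl ?_)
    change (memLp_gradient (c • φ) (vol Ω)).toLp _ = c • (memLp_gradient φ (vol Ω)).toLp _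
    rw [← MemLp.toLp_const_smul]
    congr 1
    ext1 x
    exact gradient_smul_smooth c φ x

/-- Restriction of smooth functions to the boundary. -/
noncomputable def smoothToSurf {n : ℕ} (Ω : Set (E n)) [IsFiniteMeasure (surf Ω)] :
    Smooth n →ₗ[ℝ] Lp ℝ 2 (surf Ω) where
  toFun φ := (memLp_smooth φ (surf Ω)).toLp _
  map_add' _ _ := rfl
  map_smul' _ _ := rfl

section SmoothNorms

variable {n : ℕ} {Ω : Set (E n)}

lemma fnL_smoothToH1 (φ : Smooth n) : fnL Ω (smoothToH1 Ω φ) =ᵐ[vol Ω] φ.1 :=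
  MemLp.coeFn_toLp (memLp_smooth φ (vol Ω))

lemma gradL_smoothToH1 (φ : Smooth n) : gradL Ω (smoothToH1 Ω φ) =ᵐ[vol Ω] gradient φ.1 :=
  MemLp.coeFn_toLp (memLp_gradient φ (vol Ω))

lemma smoothToSurf_coeFn [IsFiniteMeasure (surf Ω)] (φ : Smooth n) :
    smoothToSurf Ω φ =ᵐ[surf Ω] φ.1 :=
  MemLp.coeFn_toLp (memLp_smooth φ (surf Ω))

lemma ofReal_norm_fnL_sq (φ : Smooth n) :
    ENNReal.ofReal (‖fnL Ω (smoothToH1 Ω φ)‖ ^ 2) = ∫⁻ x in Ω, ‖φ.1 x‖ₑ ^ 2 := by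
  rw [toLp_norm_sq]
  exact lintegral_congr_ae ((fnL_smoothToH1 φ).mono fun x hx => by simp only [hx])

lemma ofReal_norm_gradL_sq (φ : Smooth n) :
    ENNReal.ofReal (‖gradL Ω (smoothToH1 Ω φ)‖ ^ 2) = ∫⁻ x in Ω, ‖fderiv ℝ φ.1 x‖ₑ ^ 2 := by
  rw [toLp_norm_sq]
  exact lintegral_congr_ae ((gradL_smoothToH1 φ).mono fun x hx => by
    simp only [hx, enorm_gradient])

lemma ofReal_norm_smoothToSurf_sq [IsFiniteMeasure (surf Ω)] (φ : Smooth n) :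
    ENNReal.ofReal (‖smoothToSurf Ω φ‖ ^ 2) = ∫⁻ x, ‖φ.1 x‖ₑ ^ 2 ∂(surf Ω) := by
  rw [toLp_norm_sq]
  exact lintegral_congr_ae ((smoothToSurf_coeFn φ).mono fun x hx => by simp only [hx])

lemma exists_norm_smoothToSurf_sq_le (hΩ : IsBoundedLipschitzDomain Ω) [IsFiniteMeasure (surf Ω)]
    {ε : ℝ} (hε : 0 < ε) : ∃ (ι : Type) (_ : Fintype ι) (g : ι → Lp ℝ 2 (vol Ω)),
      ∀ φ : Smooth n, ‖smoothToSurf Ω φ‖ ^ 2 ≤ ε * ‖gradL Ω (smoothToH1 Ω φ)‖ ^ 2 +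
        ∑ i, inner ℝ (g i) (fnL Ω (smoothToH1 Ω φ)) ^ 2 := by
  obtain ⟨ι, _, g, hg⟩ := exists_lintegral_surf_sq_le hΩ (ε := ε.toNNReal) (Real.toNNReal_pos.2 hε)
  refine ⟨ι, inferInstance, g, fun φ => ?_⟩
  have h := hg φ.1 (φ.2.1.of_le (by exact_mod_cast le_top))
  rw [← ofReal_norm_smoothToSurf_sq, ← ofReal_norm_gradL_sq] at h
  have h1 : ∀ i, ‖∫ x in Ω, g i x * φ.1 x‖ₑ ^ 2 =
      ENNReal.ofReal (inner ℝ (g i) (fnL Ω (smoothToH1 Ω φ)) ^ 2) := by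
    intro i
    have h2 : ∫ x in Ω, g i x * φ.1 x = inner ℝ (g i) (fnL Ω (smoothToH1 Ω φ)) := by
      rw [L2.inner_def]
      refine integral_congr_ae ((fnL_smoothToH1 φ).mono fun x hx => ?_)
      simp only [hx]
      simp [mul_comm]
    rw [h2, ← sq_abs, ENNReal.ofReal_pow (abs_nonneg _), ← Real.norm_eq_abs, ofReal_norm]
  simp_rw [h1] at h
  rw [← ENNReal.ofReal_sum_of_nonneg (fun i _ => sq_nonneg _)] at h
  have h3 : (ε.toNNReal : ℝ≥0∞) = ENNReal.ofReal ε := rfl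
  rw [h3, ← ENNReal.ofReal_mul hε.le,
    ← ENNReal.ofReal_add (by positivity) (Finset.sum_nonneg fun i _ => sq_nonneg _)] at h
  exact (ENNReal.ofReal_le_ofReal_iff
    (add_nonneg (by positivity) (Finset.sum_nonneg fun i _ => sq_nonneg _))).1 h

lemma exists_friedrichs_smoothToH1 (hn : 1 ≤ n) (hΩ : IsBoundedLipschitzDomain Ω)
    [IsFiniteMeasure (surf Ω)] : ∃ C : ℝ, 0 ≤ C ∧ ∀ φ : Smooth n,
      ‖fnL Ω (smoothToH1 Ω φ)‖ ^ 2 ≤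
        C * (‖gradL Ω (smoothToH1 Ω φ)‖ ^ 2 + ‖smoothToSurf Ω φ‖ ^ 2) := by
  obtain ⟨C, hC⟩ := exists_friedrichs_smooth hn hΩ.isOpen hΩ.isBounded
  refine ⟨C, C.2, fun φ => ?_⟩
  have h := hC φ.1 (φ.2.1.of_le (by exact_mod_cast le_top))
  rw [← ofReal_norm_smoothToSurf_sq, ← ofReal_norm_gradL_sq, ← ofReal_norm_fnL_sq,
    ← ENNReal.ofReal_add (by positivity) (by positivity), ← ENNReal.ofReal_coe_nnreal,
    ← ENNReal.ofReal_mul (by positivity)] at h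
  exact (ENNReal.ofReal_le_ofReal_iff (by positivity)).1 h

end SmoothNorms

/-! ### The trace operator -/

section Trace

variable {n : ℕ} {Ω : Set (E n)}

lemma tendsto_Lp_of_tendsto_eLpNorm {α F : Type*} [MeasurableSpace α] [NormedAddCommGroup F]
    {μ : Measure α} {f : ℕ → Lp F 2 μ} {g : ℕ → α → F} {u : Lp F 2 μ}
    (hfg : ∀ k, f k =ᵐ[μ] g k) :
    Tendsto f atTop (𝓝 u) ↔ Tendsto (fun k => eLpNorm (fun x => g k x - u x) 2 μ) atTop (𝓝 0) := by
  rw [Lp.tendsto_Lp_iff_tendsto_eLpNorm']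
  refine tendsto_congr fun k => eLpNorm_congr_ae ?_
  filter_upwards [hfg k] with x hx
  simp [hx]

lemma tendsto_smoothToH1 {φ : ℕ → Smooth n} {u : H1 Ω}
    (h1 : Tendsto (fun k => eLpNorm (fun x => (φ k).1 x - fn u x) 2 (vol Ω)) atTop (𝓝 0))
    (h2 : Tendsto (fun k => eLpNorm (fun x => gradient (φ k).1 x - grad u x) 2 (vol Ω)) atTop
      (𝓝 0)) : Tendsto (fun k => smoothToH1 Ω (φ k)) atTop (𝓝 u) := by
  have e1 := (tendsto_Lp_of_tendsto_eLpNorm (fun k => fnL_smoothToH1 (Ω := Ω) (φ k))).2 h1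
  have e2 := (tendsto_Lp_of_tendsto_eLpNorm (fun k => gradL_smoothToH1 (Ω := Ω) (φ k))).2 h2
  rw [tendsto_subtype_rng]
  exact e1.prodMk_nhds e2

lemma exists_seq_smoothToH1 (hΩ : IsBoundedLipschitzDomain Ω) (u : H1 Ω) :
    ∃ φ : ℕ → Smooth n,
      Tendsto (fun k => eLpNorm (fun x => (φ k).1 x - fn u x) 2 (vol Ω)) atTop (𝓝 0) ∧
      Tendsto (fun k => eLpNorm (fun x => gradient (φ k).1 x - grad u x) 2 (vol Ω)) atTop (𝓝 0) := by
  obtain ⟨φ, hφ, h1, h2⟩ := exists_smooth_approx hΩ u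
  exact ⟨fun k => ⟨φ k, hφ k⟩, h1, h2⟩

lemma denseRange_smoothToH1 (hΩ : IsBoundedLipschitzDomain Ω) : DenseRange (smoothToH1 Ω) := by
  intro u
  obtain ⟨φ, h1, h2⟩ := exists_seq_smoothToH1 hΩ u
  exact mem_closure_of_tendsto (tendsto_smoothToH1 h1 h2) (Eventually.of_forall fun k => ⟨_, rfl⟩)

/-- The compact trace bound with ε = 1, each functional being estimated by Cauchy–Schwarz. -/
lemma exists_norm_smoothToSurf_le (hΩ : IsBoundedLipschitzDomain Ω) [IsFiniteMeasure (surf Ω)] :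
    ∃ C : ℝ, ∀ φ : Smooth n, ‖smoothToSurf Ω φ‖ ≤ C * ‖smoothToH1 Ω φ‖ := by
  obtain ⟨ι, _, g, hg⟩ := exists_norm_smoothToSurf_sq_le hΩ one_pos
  refine ⟨√(1 + ∑ i, ‖g i‖ ^ 2), fun φ => ?_⟩
  set u := smoothToH1 Ω φ
  have hf : ‖fnL Ω u‖ ≤ ‖u‖ := le_max_left _ _
  have hgr : ‖gradL Ω u‖ ≤ ‖u‖ := le_max_right _ _
  refine (sq_le_sq₀ (norm_nonneg _) (by positivity)).1 ?_
  rw [mul_pow, Real.sq_sqrt (by positivity), add_mul, Finset.sum_mul]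
  refine (hg φ).trans (add_le_add ?_ (Finset.sum_le_sum fun i _ => ?_))
  · gcongr
  · rw [← mul_pow, ← sq_abs]
    gcongr
    exact (abs_real_inner_le_norm _ _).trans (by gcongr)

/-- On a bounded Lipschitz domain the trace is a continuous linear map extending restriction. -/
lemma exists_traceL (hΩ : IsBoundedLipschitzDomain Ω) [IsFiniteMeasure (surf Ω)] :
    ∃ T : H1 Ω →L[ℝ] Lp ℝ 2 (surf Ω), (∀ u, trace u = T u) ∧
      ∀ φ, T (smoothToH1 Ω φ) = smoothToSurf Ω φ := by
  set T := (smoothToSurf Ω).extendOfNorm (smoothToH1 Ω)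
  have hT : ∀ φ, T (smoothToH1 Ω φ) = smoothToSurf Ω φ :=
    LinearMap.extendOfNorm_eq (denseRange_smoothToH1 hΩ) (exists_norm_smoothToSurf_le hΩ)
  refine ⟨T, fun u => ?_, hT⟩
  have hex : IsTrace u (T u) := by
    obtain ⟨φ, h1, h2⟩ := exists_seq_smoothToH1 hΩ u
    refine ⟨fun k => (φ k).1, fun k => (φ k).2, h1, h2, ?_⟩
    refine (tendsto_Lp_of_tendsto_eLpNorm (fun k => smoothToSurf_coeFn (Ω := Ω) (φ k))).1 ?_
    simp_rw [← hT]
    exact (T.continuous.tendsto u).comp (tendsto_smoothToH1 h1 h2)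
  -- Any sequence admitted by `IsTrace` converges in H¹, so continuity of `T` determines its
  -- boundary limit; the choice in `trace` therefore returns `T u`.
  have huniq : ∀ g, IsTrace u g → g = T u := by
    rintro g ⟨φ, hφ, h1, h2, h3⟩
    let ψ : ℕ → Smooth n := fun k => ⟨φ k, hφ k⟩
    have e1 := (T.continuous.tendsto u).comp (tendsto_smoothToH1 (φ := ψ) h1 h2)
    have e2 := (tendsto_Lp_of_tendsto_eLpNorm (fun k => smoothToSurf_coeFn (Ω := Ω) (ψ k))).2 h3
    refine tendsto_nhds_unique e2 (e1.congr fun k => ?_)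
    exact hT (ψ k)
  have hex' : ∃ g, IsTrace u g := ⟨_, hex⟩
  rw [trace, dif_pos hex']
  exact huniq _ hex'.choose_spec

lemma exists_norm_traceL_sq_le (hΩ : IsBoundedLipschitzDomain Ω) [IsFiniteMeasure (surf Ω)]
    {T : H1 Ω →L[ℝ] Lp ℝ 2 (surf Ω)} (hT : ∀ φ, T (smoothToH1 Ω φ) = smoothToSurf Ω φ)
    {ε : ℝ} (hε : 0 < ε) : ∃ (ι : Type) (_ : Fintype ι) (g : ι → Lp ℝ 2 (vol Ω)),
      ∀ u : H1 Ω, ‖T u‖ ^ 2 ≤ ε * ‖gradL Ω u‖ ^ 2 + ∑ i, inner ℝ (g i) (fnL Ω u) ^ 2 := by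
  obtain ⟨ι, _, g, hg⟩ := exists_norm_smoothToSurf_sq_le hΩ hε
  refine ⟨ι, inferInstance, g, fun u => ?_⟩
  refine (denseRange_smoothToH1 hΩ).induction_on
    (p := fun u => ‖T u‖ ^ 2 ≤ ε * ‖gradL Ω u‖ ^ 2 + ∑ i, inner ℝ (g i) (fnL Ω u) ^ 2) u ?_
    fun φ => by rw [hT]; exact hg φ
  exact isClosed_le (by fun_prop) (by fun_prop)

lemma exists_friedrichs (hn : 1 ≤ n) (hΩ : IsBoundedLipschitzDomain Ω) [IsFiniteMeasure (surf Ω)]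
    {T : H1 Ω →L[ℝ] Lp ℝ 2 (surf Ω)} (hT : ∀ φ, T (smoothToH1 Ω φ) = smoothToSurf Ω φ) :
    ∃ C : ℝ, 0 ≤ C ∧ ∀ u : H1 Ω, ‖fnL Ω u‖ ^ 2 ≤ C * (‖gradL Ω u‖ ^ 2 + ‖T u‖ ^ 2) := by
  obtain ⟨C, hC, h⟩ := exists_friedrichs_smoothToH1 hn hΩ
  refine ⟨C, hC, fun u => ?_⟩
  refine (denseRange_smoothToH1 hΩ).induction_on
    (p := fun u => ‖fnL Ω u‖ ^ 2 ≤ C * (‖gradL Ω u‖ ^ 2 + ‖T u‖ ^ 2)) u ?_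
    fun φ => by rw [hT]; exact h φ
  exact isClosed_le (by fun_prop) (by fun_prop)

end Trace

/-! ### Constants as the kernel of the gradient -/

section Constants

variable {n : ℕ} {Ω : Set (E n)}

/-- This supplies the constant function 1 within the compactly supported smooth functions. Being 1
on a neighbourhood of the closure, it has zero gradient on `Ω` and boundary values 1. -/
lemma exists_cutoff (hb : Bornology.IsBounded Ω) :
    ∃ (χ : Smooth n) (V : Set (E n)), IsOpen V ∧ closure Ω ⊆ V ∧ ∀ x ∈ V, χ.1 x = 1 := by
  obtain ⟨R, hR0, hR⟩ := hb.subset_closedBall_lt 0 0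
  let b : ContDiffBump (0 : E n) := ⟨R + 1, R + 2, by linarith, by linarith⟩
  refine ⟨⟨b, b.contDiff, b.hasCompactSupport⟩, Metric.ball 0 (R + 1), Metric.isOpen_ball, ?_,
    fun x hx => b.one_of_mem_closedBall (Metric.ball_subset_closedBall hx)⟩
  exact (closure_minimal hR Metric.isClosed_closedBall).trans
    (Metric.closedBall_subset_ball (by linarith))

lemma gradient_cutoff {χ : Smooth n} {V : Set (E n)} (hV : IsOpen V) (h1 : ∀ x ∈ V, χ.1 x = 1)
    {x : E n} (hx : x ∈ V) : gradient χ.1 x = 0 := by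
  refine gradient_eq_zero_of_fderiv ?_
  have h2 : χ.1 =ᶠ[𝓝 x] fun _ => (1 : ℝ) := eventually_of_mem (hV.mem_nhds hx) h1
  rw [h2.fderiv_eq]; simp

lemma gradL_cutoff (hΩ : IsOpen Ω) {χ : Smooth n} {V : Set (E n)} (hV : IsOpen V)
    (hΩV : closure Ω ⊆ V) (h1 : ∀ x ∈ V, χ.1 x = 1) : gradL Ω (smoothToH1 Ω χ) = 0 := by
  rw [Lp.eq_zero_iff_ae_eq_zero]
  filter_upwards [gradL_smoothToH1 (Ω := Ω) χ, ae_restrict_mem hΩ.measurableSet] with x hx hxΩ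
  rw [hx, gradient_cutoff hV h1 (hΩV (subset_closure hxΩ))]
  rfl

/-- The mollifications have zero gradient on a small ball, so they are constant there, and a
subsequence converges almost everywhere to the function. -/
lemma exists_const_on_ball_of_gradL_eq_zero (hΩ : IsOpen Ω) {u : H1 Ω} (hu : gradL Ω u = 0)
    {p : E n} (hp : p ∈ Ω) : ∃ (r c : ℝ), 0 < r ∧ Metric.ball p r ⊆ Ω ∧
      ∀ᵐ x ∂(volume.restrict (Metric.ball p r)), fnL Ω u x = c := by
  have hΩm := hΩ.measurableSet
  obtain ⟨R, hR, hb⟩ := Metric.isOpen_iff.1 hΩ p hp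
  obtain ⟨e, c, r, h, hc, hr, hh, hcone⟩ := exists_hasCone_of_mem hΩ hp
  obtain ⟨f, ρ, hf, hρ, hfx⟩ := exists_mollifier_of_hasCone hc hh hcone
  set U := Ω.indicator (fnL Ω u) with hU
  have hU2 : MemLp U 2 volume := memLp_indicator hΩm _
  have hUl : LocallyIntegrable U := hU2.locallyIntegrable (by norm_num)
  have hlim := tendsto_eLpNorm_mollify_sub hf hρ (stronglyMeasurable_indicator hΩm (fnL Ω u)) hU2
  set B := Metric.ball p (min r R) with hB
  have hBΩ : B ⊆ Ω := (Metric.ball_subset_ball (min_le_right _ _)).trans hb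
  have hpB : p ∈ B := Metric.mem_ball_self (lt_min hr hR)
  have hw : HasWeakGradient Ω (fnL Ω u) 0 := by
    have h1 : HasWeakGradient Ω (fnL Ω u) (gradL Ω u) := u.2
    exact h1.congr (ae_eq_refl _) (Lp.eq_zero_iff_ae_eq_zero.1 hu).symm
  have hconst : ∀ k, ∀ x ∈ B, mollify (f k) U x = mollify (f k) U p := by
    intro k x hx
    have hd := contDiff_mollify (hf k).contDiff (hf k).hasCompactSupport hUl
    refine Metric.isOpen_ball.is_const_of_fderiv_eq_zero (𝕜 := ℝ)
      (convex_ball p (min r R)).isPreconnected (hd.differentiable (by simp)).differentiableOn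
      (fun y hy => ?_) hx hpB
    have hy2 : dist y p < r := lt_of_lt_of_le hy (min_le_left _ _)
    have h2 := gradient_mollify (G := 0) hΩm hUl (by
      rw [show Ω.indicator (0 : E n → E n) = fun _ => 0 from Set.indicator_zero' _]
      exact locallyIntegrable_const 0) hw
      (hf k).contDiff (hf k).hasCompactSupport (hfx k y (subset_closure (hBΩ hy)) hy2)
    have h3 : mollify (f k) (Ω.indicator (0 : E n → E n)) y = 0 := by
      simp [mollify_apply]
    rw [h3, gradient_eq_iff] at h2
    ext v
    rw [h2 v]; simp
  have hlimB : Tendsto (fun k => eLpNorm (mollify (f k) U - U) 2 (volume.restrict B)) atTop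
      (𝓝 0) :=
    tendsto_of_tendsto_of_tendsto_of_le_of_le tendsto_const_nhds hlim (fun _ => zero_le)
      fun k => eLpNorm_mono_measure _ Measure.restrict_le_self
  have hmeas := tendstoInMeasure_of_tendsto_eLpNorm two_ne_zero
    (fun k => (contDiff_mollify (hf k).contDiff (hf k).hasCompactSupport
      hUl).continuous.aestronglyMeasurable)
    (stronglyMeasurable_indicator hΩm (fnL Ω u)).aestronglyMeasurable hlimB
  obtain ⟨ns, -, hns⟩ := hmeas.exists_seq_tendsto_ae
  have hae : ∀ᵐ x ∂(volume.restrict B), Tendsto (fun k => mollify (f (ns k)) U p) atTop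
      (𝓝 (fnL Ω u x)) := by
    filter_upwards [hns, ae_restrict_mem measurableSet_ball] with x hx hxB
    rw [hU, Set.indicator_of_mem (hBΩ hxB)] at hx
    exact hx.congr fun k => hconst _ x hxB
  have hne : (volume.restrict B) ≠ 0 := by
    rw [Ne, Measure.restrict_eq_zero]
    exact (Metric.measure_ball_pos volume p (lt_min hr hR)).ne'
  have : (ae (volume.restrict B)).NeBot := ae_neBot.2 hne
  obtain ⟨x₀, hx₀⟩ := hae.exists
  exact ⟨min r R, fnL Ω u x₀, lt_min hr hR, hBΩ, hae.mono fun x hx => tendsto_nhds_unique hx hx₀⟩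

/-- The local constants agree for nearby centres because the overlap of two such balls has positive
measure; connectedness makes them all equal, and a locally null exceptional set is null. -/
lemma exists_const_of_gradL_eq_zero (hΩ : IsOpen Ω) (hconn : IsConnected Ω) {u : H1 Ω}
    (hu : gradL Ω u = 0) : ∃ c : ℝ, ∀ᵐ x ∂(vol Ω), fnL Ω u x = c := by
  have hloc : ∀ p : E n, ∃ (r c : ℝ), p ∈ Ω → 0 < r ∧ Metric.ball p r ⊆ Ω ∧
      ∀ᵐ x ∂(volume.restrict (Metric.ball p r)), fnL Ω u x = c := by
    intro p
    by_cases hp : p ∈ Ω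
    · obtain ⟨r, c, h⟩ := exists_const_on_ball_of_gradL_eq_zero hΩ hu hp
      exact ⟨r, c, fun _ => h⟩
    · exact ⟨0, 0, fun h => absurd h hp⟩
  choose r c hrc using hloc
  have hP : ∀ x ∈ Ω, ∀ y ∈ Ω, c x = c y := by
    intro x hx y hy
    refine hconn.isPreconnected.induction₂ (fun x y => c x = c y) (fun x hx => ?_)
      (fun x y z _ _ _ h1 h2 => h1.trans h2) (fun x y _ _ h => h.symm) hx hy
    obtain ⟨hr, -, hxc⟩ := hrc x hx
    filter_upwards [mem_nhdsWithin_of_mem_nhds (Metric.ball_mem_nhds x hr),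
      self_mem_nhdsWithin] with y hyx hy
    obtain ⟨hry, -, hyc⟩ := hrc y hy
    have hpos : volume (Metric.ball x (r x) ∩ Metric.ball y (r y)) ≠ 0 :=
      ((Metric.isOpen_ball.inter Metric.isOpen_ball).measure_pos volume
        ⟨y, hyx, Metric.mem_ball_self hry⟩).ne'
    have : (ae (volume.restrict (Metric.ball x (r x) ∩ Metric.ball y (r y)))).NeBot := by
      rw [ae_neBot, Ne, Measure.restrict_eq_zero]; exact hpos
    obtain ⟨z, hz1, hz2⟩ :=
      ((ae_restrict_of_ae_restrict_of_subset Set.inter_subset_left hxc).and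
        (ae_restrict_of_ae_restrict_of_subset Set.inter_subset_right hyc)).exists
    rw [← hz1, hz2]
  obtain ⟨x₀, hx₀⟩ := hconn.nonempty
  refine ⟨c x₀, ?_⟩
  rw [ae_restrict_iff' hΩ.measurableSet, ae_iff]
  refine measure_null_of_locally_null _ fun x hx => ?_
  have hxΩ : x ∈ Ω := by
    by_contra h
    exact hx fun h' => absurd h' h
  obtain ⟨hr, -, hxc⟩ := hrc x hxΩ
  refine ⟨Metric.ball x (r x) ∩ {a | ¬ (a ∈ Ω → fnL Ω u a = c x₀)}, ?_, ?_⟩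
  · exact inter_mem (mem_nhdsWithin_of_mem_nhds (Metric.ball_mem_nhds x hr)) self_mem_nhdsWithin
  · rw [ae_restrict_iff' measurableSet_ball, ae_iff] at hxc
    refine measure_mono_null (fun a ha => ?_) hxc
    intro h
    exact ha.2 fun _ => by rw [h ha.1, hP x hxΩ x₀ hx₀]

end Constants

/-- The analytic facts about `H¹(Ω)` from which the spectral statements follow. -/
lemma exists_trace_structure {n : ℕ} (hn : 1 ≤ n) {Ω : Set (E n)}
    (hΩ : IsBoundedLipschitzDomain Ω) :
    ∃ T : H1 Ω →L[ℝ] Lp ℝ 2 (surf Ω), (∀ u, trace u = T u) ∧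
      (∃ C : ℝ, 0 ≤ C ∧ ∀ u : H1 Ω, ‖fnL Ω u‖ ^ 2 ≤ C * (‖gradL Ω u‖ ^ 2 + ‖T u‖ ^ 2)) ∧
      (∀ ε : ℝ, 0 < ε → ∃ (ι : Type) (_ : Fintype ι) (g : ι → Lp ℝ 2 (vol Ω)), ∀ u : H1 Ω,
        ‖T u‖ ^ 2 ≤ ε * ‖gradL Ω u‖ ^ 2 + ∑ i, inner ℝ (g i) (fnL Ω u) ^ 2) ∧
      ∃ one : H1 Ω, one ≠ 0 ∧ gradL Ω one = 0 ∧
        (∀ u, gradL Ω u = 0 → ∃ c : ℝ, u = c • one) ∧ ∃ w, ∀ c : ℝ, T w ≠ c • T one := by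
  have : IsFiniteMeasure (surf Ω) := ⟨(compactTraceBound_frontier hΩ).1⟩
  obtain ⟨T, hT, hTs⟩ := exists_traceL hΩ
  obtain ⟨χ, V, hV, hΩV, hχ⟩ := exists_cutoff hΩ.isBounded
  have hone : fnL Ω (smoothToH1 Ω χ) =ᵐ[vol Ω] fun _ => 1 := by
    filter_upwards [fnL_smoothToH1 (Ω := Ω) χ, ae_restrict_mem hΩ.isOpen.measurableSet]
      with x hx hxΩ
    rw [hx, hχ x (hΩV (subset_closure hxΩ))]
  refine ⟨T, hT, exists_friedrichs hn hΩ hTs, fun ε hε => exists_norm_traceL_sq_le hΩ hTs hε,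
    smoothToH1 Ω χ, ?_, gradL_cutoff hΩ.isOpen hV hΩV hχ, ?_, ?_⟩
  · intro h0
    have h1 : fnL Ω (smoothToH1 Ω χ) =ᵐ[vol Ω] 0 := by
      rw [h0, map_zero]; exact Lp.coeFn_zero _ _ _
    have h2 : ∀ᵐ x ∂(vol Ω), False := by
      filter_upwards [hone, h1] with x hx1 hx2
      rw [hx1] at hx2
      exact one_ne_zero hx2
    rw [eventually_false_iff_eq_bot, ae_eq_bot, Measure.restrict_eq_zero] at h2
    exact (hΩ.isOpen.measure_pos volume hΩ.isConnected.nonempty).ne' h2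
  · intro u hu
    obtain ⟨c, hc⟩ := exists_const_of_gradL_eq_zero hΩ.isOpen hΩ.isConnected hu
    refine ⟨c, ?_⟩
    rw [← sub_eq_zero]
    refine eq_zero_of_fnL_eq_zero hΩ.isOpen ?_
    rw [map_sub, map_smul, sub_eq_zero]
    refine Lp.ext ?_
    filter_upwards [hc, hone, Lp.coeFn_smul c (fnL Ω (smoothToH1 Ω χ))] with x h1 h2 h3
    rw [h1, h3, Pi.smul_apply, h2, smul_eq_mul, mul_one]
  · set e : E n := EuclideanSpace.single ⟨0, hn⟩ 1
    have he : ‖e‖ = 1 := by simp [e]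
    -- On the boundary this is a coordinate function, which is not almost everywhere constant there.
    let w : Smooth n := ⟨fun x => χ.1 x * inner ℝ e x,
      χ.2.1.mul (contDiff_const.inner ℝ contDiff_id), χ.2.2.mul_right⟩
    refine ⟨smoothToH1 Ω w, fun c hc => ?_⟩
    rw [hTs, hTs] at hc
    refine not_ae_surf_inner_eq_const hΩ.isOpen hΩ.isConnected.nonempty hΩ.isBounded he c ?_
    have h4 := Lp.coeFn_smul c (smoothToSurf Ω χ)
    rw [← hc] at h4
    filter_upwards [h4, smoothToSurf_coeFn (Ω := Ω) w, smoothToSurf_coeFn (Ω := Ω) χ,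
      ae_restrict_mem isClosed_frontier.measurableSet] with x h1 h2 h3 hx
    have hx1 := hχ x (hΩV (frontier_subset_closure hx))
    rw [h2, Pi.smul_apply, h3, hx1] at h1
    simpa [w, hx1] using h1

/-! ### Spectral theory of an abstract triple -/

section Abstract

variable {V X Y Z : Type*} [NormedAddCommGroup V] [NormedSpace ℝ V]
  [NormedAddCommGroup X] [InnerProductSpace ℝ X] [NormedAddCommGroup Y] [InnerProductSpace ℝ Y]
  [NormedAddCommGroup Z] [InnerProductSpace ℝ Z]
  {f : V →L[ℝ] X} {G : V →L[ℝ] Y} {T : V →L[ℝ] Z} {one : V}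

/-- The properties shared by the inclusion `f` of `H¹` into `L²`, the gradient `G`, the trace `T`
and the constant function `one`, on which the Robin and Steklov spectral theory rests. -/
structure IsRobinTriple (f : V →L[ℝ] X) (G : V →L[ℝ] Y) (T : V →L[ℝ] Z) (one : V) : Prop where
  norm_eq : ∀ v, ‖v‖ = max ‖f v‖ ‖G v‖
  injective : ∀ v, f v = 0 → v = 0
  friedrichs : ∃ C : ℝ, 0 ≤ C ∧ ∀ u, ‖f u‖ ^ 2 ≤ C * (‖G u‖ ^ 2 + ‖T u‖ ^ 2)
  compact_trace : ∀ ε : ℝ, 0 < ε → ∃ (ι : Type) (_ : Fintype ι) (g : ι → X), ∀ u,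
    ‖T u‖ ^ 2 ≤ ε * ‖G u‖ ^ 2 + ∑ i, inner ℝ (g i) (f u) ^ 2
  one_ne_zero : one ≠ 0
  map_one : G one = 0
  ker : ∀ u, G u = 0 → ∃ c : ℝ, u = c • one
  exists_not_const : ∃ w, ∀ c : ℝ, T w ≠ c • T one

/-- The Rayleigh quotient of a triple. -/
noncomputable def rq (f : V →L[ℝ] X) (G : V →L[ℝ] Y) (T : V →L[ℝ] Z) (α : ℝ) (u : V) : ℝ :=
  (‖G u‖ ^ 2 + α * ‖T u‖ ^ 2) / ‖f u‖ ^ 2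

/-- The min-max values of the Rayleigh quotient of a triple. -/
noncomputable def ev (f : V →L[ℝ] X) (G : V →L[ℝ] Y) (T : V →L[ℝ] Z) (k : ℕ) (α : ℝ) : ℝ :=
  ⨅ U : {U : Submodule ℝ V // Module.finrank ℝ U = k},
    ⨆ u : {u : V // u ∈ U.1 ∧ u ≠ 0}, rq f G T α u.1

namespace IsRobinTriple

lemma normSq_pos (h : IsRobinTriple f G T one) {u : V} (hu : u ≠ 0) : 0 < ‖f u‖ ^ 2 := by
  have : f u ≠ 0 := fun h0 => hu (h.injective u h0)
  positivity

lemma map_one_ne_zero (h : IsRobinTriple f G T one) : T one ≠ 0 := by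
  intro h0
  obtain ⟨C, -, hC⟩ := h.friedrichs
  have := hC one
  rw [h.map_one, h0] at this
  have h1 := h.normSq_pos h.one_ne_zero
  simp at this
  rw [this] at h1
  simp at h1

/-- The parameter `1 / (|α| + 1)` lets the gradient absorb the boundary term. The bound is needed
because a real infimum over a family unbounded below would be a default value. -/
lemma exists_le_rq (h : IsRobinTriple f G T one) (α : ℝ) : ∃ c : ℝ, ∀ u, c ≤ rq f G T α u := by
  obtain ⟨ι, _, g, hg⟩ := h.compact_trace (1 / (|α| + 1)) (by positivity)
  refine ⟨-(|α| * ∑ i, ‖g i‖ ^ 2), fun u => ?_⟩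
  rcases eq_or_ne u 0 with rfl | hu
  · simp only [rq, map_zero, norm_zero]
    simp only [ne_eq, OfNat.ofNat_ne_zero, not_false_eq_true, zero_pow, div_zero]
    rw [neg_nonpos]; positivity
  rw [rq, le_div_iff₀ (h.normSq_pos hu)]
  have h1 : ∑ i, inner ℝ (g i) (f u) ^ 2 ≤ (∑ i, ‖g i‖ ^ 2) * ‖f u‖ ^ 2 := by
    rw [Finset.sum_mul]
    refine Finset.sum_le_sum fun i _ => ?_
    rw [← mul_pow, ← sq_abs]
    gcongr
    exact abs_real_inner_le_norm _ _
  have h2 : |α| * ‖T u‖ ^ 2 ≤ ‖G u‖ ^ 2 + |α| * ((∑ i, ‖g i‖ ^ 2) * ‖f u‖ ^ 2) := by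
    calc |α| * ‖T u‖ ^ 2
        ≤ |α| * (1 / (|α| + 1) * ‖G u‖ ^ 2 + (∑ i, ‖g i‖ ^ 2) * ‖f u‖ ^ 2) := by
          gcongr; exact (hg u).trans (by gcongr)
      _ = |α| / (|α| + 1) * ‖G u‖ ^ 2 + |α| * ((∑ i, ‖g i‖ ^ 2) * ‖f u‖ ^ 2) := by ring
      _ ≤ 1 * ‖G u‖ ^ 2 + |α| * ((∑ i, ‖g i‖ ^ 2) * ‖f u‖ ^ 2) := by
          gcongr
          rw [div_le_one (by positivity)]; linarith
      _ = _ := by rw [one_mul]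
  have h3 : -(|α| * ‖T u‖ ^ 2) ≤ α * ‖T u‖ ^ 2 := by
    rw [← neg_mul]; gcongr; exact neg_abs_le α
  linarith

/-- On a finite-dimensional space the injective map `f` is bounded below, so numerator and
denominator are comparable. This makes the suprema in `ev` genuine. -/
lemma exists_rq_le (h : IsRobinTriple f G T one) (α : ℝ) (U : Submodule ℝ V)
    [FiniteDimensional ℝ U] : ∃ c : ℝ, ∀ u ∈ U, rq f G T α u ≤ c := by
  obtain ⟨K, -, hK⟩ := ((f : V →ₗ[ℝ] X).comp U.subtype).exists_antilipschitzWith (by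
    rw [LinearMap.ker_eq_bot']
    intro u hu
    exact Subtype.ext (h.injective u hu))
  have hK' : ∀ u ∈ U, ‖u‖ ≤ K * ‖f u‖ := fun u hu => by
    simpa [dist_eq_norm] using hK.le_mul_dist (⟨u, hu⟩ : U) 0
  refine ⟨(1 + |α| * ‖T‖ ^ 2) * K ^ 2, fun u hu => ?_⟩
  rcases eq_or_ne u 0 with rfl | hu0
  · simp only [rq, map_zero, norm_zero]
    simp only [ne_eq, OfNat.ofNat_ne_zero, not_false_eq_true, zero_pow, div_zero]
    positivity
  rw [rq, div_le_iff₀ (h.normSq_pos hu0)]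
  have h1 : ‖G u‖ ≤ ‖u‖ := (le_max_right _ _).trans_eq (h.norm_eq u).symm
  calc ‖G u‖ ^ 2 + α * ‖T u‖ ^ 2 ≤ ‖u‖ ^ 2 + |α| * (‖T‖ * ‖u‖) ^ 2 := by
        gcongr
        · exact le_abs_self α
        · exact T.le_opNorm u
    _ = (1 + |α| * ‖T‖ ^ 2) * ‖u‖ ^ 2 := by ring
    _ ≤ (1 + |α| * ‖T‖ ^ 2) * (K * ‖f u‖) ^ 2 := by gcongr; exact hK' u hu
    _ = _ := by ring

/-- Positivity of `k` guarantees nonzero test vectors and excludes infinite-dimensional subspaces,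
whose `finrank` is 0. -/
lemma ev_le (h : IsRobinTriple f G T one) {k : ℕ} (hk : 0 < k) {α c : ℝ} {U : Submodule ℝ V}
    (hU : Module.finrank ℝ U = k) (hc : ∀ u ∈ U, u ≠ 0 → rq f G T α u ≤ c) :
    ev f G T k α ≤ c := by
  obtain ⟨d, hd⟩ := h.exists_le_rq α
  have hne : ∀ W : {U : Submodule ℝ V // Module.finrank ℝ U = k},
      Nonempty {u : V // u ∈ W.1 ∧ u ≠ 0} := by
    rintro ⟨W, hW⟩
    have : W ≠ ⊥ := by rintro rfl; simp at hW; omega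
    obtain ⟨u, hu, hu0⟩ := Submodule.exists_mem_ne_zero_of_ne_bot this
    exact ⟨⟨u, hu, hu0⟩⟩
  have hbdd : BddBelow (Set.range fun W : {U : Submodule ℝ V // Module.finrank ℝ U = k} =>
      ⨆ u : {u : V // u ∈ W.1 ∧ u ≠ 0}, rq f G T α u.1) := by
    refine ⟨d, ?_⟩
    rintro _ ⟨W, rfl⟩
    have : FiniteDimensional ℝ W.1 := Module.finite_of_finrank_pos (by rw [W.2]; exact hk)
    obtain ⟨b, hb⟩ := h.exists_rq_le α W.1
    obtain ⟨u⟩ := hne W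
    exact (hd u).trans (le_ciSup (f := fun u : {u : V // u ∈ W.1 ∧ u ≠ 0} => rq f G T α u.1)
      ⟨b, by rintro _ ⟨v, rfl⟩; exact hb v v.2.1⟩ u)
  refine (ciInf_le hbdd ⟨U, hU⟩).trans ?_
  have := hne ⟨U, hU⟩
  exact ciSup_le fun u => hc u u.2.1 u.2.2

/-- The subspace `U` serves only to make the family nonempty, so that the infimum is meaningful. -/
lemma le_ev (h : IsRobinTriple f G T one) {k : ℕ} (hk : 0 < k) {α c : ℝ} {U : Submodule ℝ V}
    (hU : Module.finrank ℝ U = k)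
    (hc : ∀ W : Submodule ℝ V, Module.finrank ℝ W = k →
      ∀ s, (∀ u ∈ W, u ≠ 0 → rq f G T α u ≤ s) → c ≤ s) : c ≤ ev f G T k α := by
  have : Nonempty {U : Submodule ℝ V // Module.finrank ℝ U = k} := ⟨⟨U, hU⟩⟩
  refine le_ciInf fun W => hc W.1 W.2 _ fun u hu hu0 => ?_
  have : FiniteDimensional ℝ W.1 := Module.finite_of_finrank_pos (by rw [W.2]; exact hk)
  obtain ⟨b, hb⟩ := h.exists_rq_le α W.1
  exact le_ciSup (f := fun u : {u : V // u ∈ W.1 ∧ u ≠ 0} => rq f G T α u.1)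
      ⟨b, by rintro _ ⟨v, rfl⟩; exact hb v v.2.1⟩ ⟨u, hu, hu0⟩

lemma rq_mono (α β : ℝ) (hαβ : α ≤ β) (u : V) : rq f G T α u ≤ rq f G T β u := by
  unfold rq; gcongr

lemma ev_mono (h : IsRobinTriple f G T one) {k : ℕ} (hk : 0 < k) {U : Submodule ℝ V}
    (hU : Module.finrank ℝ U = k) : Monotone (ev f G T k) := fun α β hαβ =>
  h.le_ev hk hU fun _ hW _ hs => h.ev_le hk hW fun u hu hu0 =>
    (rq_mono α β hαβ u).trans (hs u hu hu0)

lemma rq_smul (α : ℝ) {c : ℝ} (hc : c ≠ 0) (u : V) :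
    rq f G T α (c • u) = rq f G T α u := by
  simp only [rq, map_smul, norm_smul, mul_pow]
  rw [show ‖c‖ ^ 2 * ‖G u‖ ^ 2 + α * (‖c‖ ^ 2 * ‖T u‖ ^ 2)
    = ‖c‖ ^ 2 * (‖G u‖ ^ 2 + α * ‖T u‖ ^ 2) by ring]
  exact mul_div_mul_left _ _ (by positivity)

lemma ev_one_le (h : IsRobinTriple f G T one) (α : ℝ) {u : V} (hu : u ≠ 0) :
    ev f G T 1 α ≤ rq f G T α u := by
  refine h.ev_le one_pos (finrank_span_singleton (K := ℝ) hu) fun v hv hv0 => ?_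
  obtain ⟨c, rfl⟩ := Submodule.mem_span_singleton.1 hv
  rw [rq_smul α (by rintro rfl; simp at hv0)]

lemma le_ev_one (h : IsRobinTriple f G T one) {α c : ℝ} (hc : ∀ u ≠ 0, c ≤ rq f G T α u) :
    c ≤ ev f G T 1 α := by
  refine h.le_ev one_pos (finrank_span_singleton (K := ℝ) h.one_ne_zero) fun W hW s hs => ?_
  have : W ≠ ⊥ := by rintro rfl; simp at hW
  obtain ⟨u, hu, hu0⟩ := Submodule.exists_mem_ne_zero_of_ne_bot this
  exact (hc u hu0).trans (hs u hu hu0)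

lemma rq_one (h : IsRobinTriple f G T one) (α : ℝ) :
    rq f G T α one = α * (‖T one‖ ^ 2 / ‖f one‖ ^ 2) := by
  simp [rq, h.map_one, mul_div_assoc]

lemma rq_one_coeff_pos (h : IsRobinTriple f G T one) : 0 < ‖T one‖ ^ 2 / ‖f one‖ ^ 2 := by
  have := h.map_one_ne_zero
  exact div_pos (by positivity) (h.normSq_pos h.one_ne_zero)

lemma ev_one_neg (h : IsRobinTriple f G T one) {α : ℝ} (hα : α < 0) : ev f G T 1 α < 0 := by
  refine (h.ev_one_le α h.one_ne_zero).trans_lt ?_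
  rw [h.rq_one]
  exact mul_neg_of_neg_of_pos hα h.rq_one_coeff_pos

/-- A coercivity estimate turns into a positive lower bound for the Rayleigh quotient. -/
lemma exists_pos_le_rq (h : IsRobinTriple f G T one) {α δ : ℝ} (hδ : 0 < δ) : ∃ c : ℝ, 0 < c ∧
    ∀ u ≠ 0, δ * (‖G u‖ ^ 2 + ‖T u‖ ^ 2) ≤ ‖G u‖ ^ 2 + α * ‖T u‖ ^ 2 → c ≤ rq f G T α u := by
  obtain ⟨C, hC0, hC⟩ := h.friedrichs
  refine ⟨δ / (C + 1), by positivity, fun u hu hle => ?_⟩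
  rw [rq, le_div_iff₀ (h.normSq_pos hu), div_mul_eq_mul_div, div_le_iff₀ (by positivity)]
  have h1 : 0 ≤ ‖G u‖ ^ 2 + ‖T u‖ ^ 2 := by positivity
  calc δ * ‖f u‖ ^ 2 ≤ δ * (C * (‖G u‖ ^ 2 + ‖T u‖ ^ 2)) := by gcongr; exact hC u
    _ ≤ δ * ((C + 1) * (‖G u‖ ^ 2 + ‖T u‖ ^ 2)) := by gcongr; linarith
    _ = δ * (‖G u‖ ^ 2 + ‖T u‖ ^ 2) * (C + 1) := by ring
    _ ≤ _ := by gcongr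

lemma ev_one_pos (h : IsRobinTriple f G T one) {α : ℝ} (hα : 0 < α) : 0 < ev f G T 1 α := by
  obtain ⟨c, hc0, hc⟩ := h.exists_pos_le_rq (α := α) (δ := min 1 α) (by positivity)
  refine hc0.trans_le (h.le_ev_one fun u hu => hc u hu ?_)
  rw [mul_add]
  have h1 : min 1 α * ‖G u‖ ^ 2 ≤ 1 * ‖G u‖ ^ 2 := by gcongr; exact min_le_left _ _
  have h2 : min 1 α * ‖T u‖ ^ 2 ≤ α * ‖T u‖ ^ 2 := by gcongr; exact min_le_right _ _
  linarith

lemma ev_one_eq_zero_iff (h : IsRobinTriple f G T one) {α : ℝ} : ev f G T 1 α = 0 ↔ α = 0 := by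
  constructor
  · intro h0
    rcases lt_trichotomy α 0 with hα | hα | hα
    · exact absurd h0 (h.ev_one_neg hα).ne
    · exact hα
    · exact absurd h0 (h.ev_one_pos hα).ne'
  · rintro rfl
    refine le_antisymm ((h.ev_one_le 0 h.one_ne_zero).trans_eq (by rw [h.rq_one, zero_mul])) ?_
    exact h.le_ev_one fun u _ => by unfold rq; positivity

/-- Concavity of the first eigenvalue along a ray from the origin. -/
lemma mul_ev_one_le (h : IsRobinTriple f G T one) {s : ℝ} (hs0 : 0 ≤ s) (hs1 : s ≤ 1) (α : ℝ) :
    s * ev f G T 1 α ≤ ev f G T 1 (s * α) := by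
  refine h.le_ev_one fun u hu => ?_
  -- The quotient is affine in the parameter, so at `s * α` it is a convex combination of its values
  -- at `α` and at `0`, the latter being nonnegative.
  have h1 : rq f G T (s * α) u = s * rq f G T α u + (1 - s) * (‖G u‖ ^ 2 / ‖f u‖ ^ 2) := by
    unfold rq; ring
  have h2 : 0 ≤ (1 - s) * (‖G u‖ ^ 2 / ‖f u‖ ^ 2) :=
    mul_nonneg (sub_nonneg.2 hs1) (by positivity)
  rw [h1]
  have := mul_le_mul_of_nonneg_left (h.ev_one_le α hu) hs0
  linarith

lemma div_ev_one_pos (h : IsRobinTriple f G T one) {α : ℝ} (hα : α ≠ 0) :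
    0 < α / ev f G T 1 α := by
  rcases hα.lt_or_gt with hα | hα
  · exact div_pos_of_neg_of_neg hα (h.ev_one_neg hα)
  · exact div_pos hα (h.ev_one_pos hα)

/-- For equal signs, concavity is applied on the ray through the parameter farther from 0, with
scale the ratio of the two. For opposite signs, both quotients are compared with `1 / t`, where `t`
is the slope obtained by testing with `one`. -/
lemma div_ev_one_mono (h : IsRobinTriple f G T one) {α β : ℝ} (hα : α ≠ 0) (hβ : β ≠ 0)
    (hαβ : α ≤ β) : α / ev f G T 1 α ≤ β / ev f G T 1 β := by
  rcases hα.lt_or_gt with hα | hα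
  · have hLα := h.ev_one_neg hα
    rcases hβ.lt_or_gt with hβ | hβ
    · have hLβ := h.ev_one_neg hβ
      have h1 := h.mul_ev_one_le (s := β / α) (div_nonneg_of_nonpos hβ.le hα.le)
        ((div_le_one_of_neg hα).2 hαβ) α
      rw [div_mul_cancel₀ _ hα.ne, div_mul_eq_mul_div, div_le_iff_of_neg hα] at h1
      rw [← neg_div_neg_eq, ← neg_div_neg_eq β, div_le_div_iff₀ (neg_pos.2 hLα) (neg_pos.2 hLβ)]
      linarith
    · have hLβ := h.ev_one_pos hβ
      have ht := h.rq_one_coeff_pos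
      have e1 := h.ev_one_le α h.one_ne_zero
      have e2 := h.ev_one_le β h.one_ne_zero
      rw [h.rq_one] at e1 e2
      set t := ‖T one‖ ^ 2 / ‖f one‖ ^ 2
      calc α / ev f G T 1 α ≤ 1 / t := by
            rw [← neg_div_neg_eq, div_le_div_iff₀ (neg_pos.2 hLα) ht]; linarith
        _ ≤ β / ev f G T 1 β := by rw [div_le_div_iff₀ ht hLβ]; linarith
  · have hβ := hα.trans_le hαβ
    have h1 := h.mul_ev_one_le (s := α / β) (by positivity) ((div_le_one hβ).2 hαβ) β
    rw [div_mul_cancel₀ _ hβ.ne', div_mul_eq_mul_div, div_le_iff₀ hβ] at h1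
    rw [div_le_div_iff₀ (h.ev_one_pos hα) (h.ev_one_pos hβ)]
    linarith

/-- Subtracting a multiple of `one` makes the trace orthogonal to constants. -/
lemma exists_sub_smul_orthogonal (h : IsRobinTriple f G T one) (w : V) :
    ∃ c : ℝ, inner ℝ (T (w - c • one)) (T one) = 0 := by
  have h1 : ‖T one‖ ^ 2 ≠ 0 := pow_ne_zero _ (norm_ne_zero_iff.2 h.map_one_ne_zero)
  refine ⟨inner ℝ (T w) (T one) / ‖T one‖ ^ 2, ?_⟩
  rw [map_sub, map_smul, inner_sub_left, real_inner_smul_left, real_inner_self_eq_norm_sq,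
    div_mul_cancel₀ _ h1, sub_self]

lemma exists_unit_orthogonal (h : IsRobinTriple f G T one) :
    ∃ u, inner ℝ (T u) (T one) = 0 ∧ ‖T u‖ = 1 := by
  obtain ⟨w, hw⟩ := h.exists_not_const
  obtain ⟨c, hc⟩ := h.exists_sub_smul_orthogonal w
  have h0 : T (w - c • one) ≠ 0 := by
    rw [map_sub, map_smul, sub_ne_zero]; exact hw c
  refine ⟨‖T (w - c • one)‖⁻¹ • (w - c • one), ?_, ?_⟩
  · rw [map_smul, real_inner_smul_left, hc, mul_zero]
  · rw [map_smul]
    exact norm_smul_inv_norm (𝕜 := ℝ) h0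

/-- A sequence bounded in energy norm, for which the energies of differences are controlled by
boundary norms, converges along the hyperfilter. -/
lemma exists_tendsto_of_minimizing [CompleteSpace V] (h : IsRobinTriple f G T one) {m : ℝ}
    (hm : ∀ w, inner ℝ (T w) (T one) = 0 → m * ‖T w‖ ^ 2 ≤ ‖G w‖ ^ 2) {u : ℕ → V}
    (hu0 : ∀ k, inner ℝ (T (u k)) (T one) = 0) (hu1 : ∀ k, ‖T (u k)‖ = 1)
    (hu : Tendsto (fun k => ‖G (u k)‖ ^ 2) atTop (𝓝 m)) :
    ∃ u₁, Tendsto u (hyperfilter ℕ : Filter ℕ) (𝓝 u₁) := by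
  set F : Filter ℕ := (hyperfilter ℕ : Filter ℕ) with hF
  have huF : Tendsto (fun k => ‖G (u k)‖ ^ 2) F (𝓝 m) := hu.mono_left Nat.hyperfilter_le_atTop
  obtain ⟨B, hB⟩ := hu.bddAbove_range
  have hB' : ∀ k, ‖G (u k)‖ ^ 2 ≤ B := fun k => hB ⟨k, rfl⟩
  obtain ⟨C, hC0, hC⟩ := h.friedrichs
  have hfb : ∀ k, ‖f (u k)‖ ≤ √(C * (B + 1)) := fun k => by
    refine Real.le_sqrt_of_sq_le ((hC (u k)).trans ?_)
    rw [hu1 k, one_pow]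
    gcongr; exact hB' k
  -- Bounded real sequences converge along an ultrafilter, so all functionals converge
  -- simultaneously without a diagonal subsequence or weak compactness.
  have hinner : ∀ g : X, ∃ a : ℝ, Tendsto (fun k => inner ℝ g (f (u k))) F (𝓝 a) := fun g => by
    obtain ⟨a, -, ha⟩ := (isCompact_closedBall (0 : ℝ) (‖g‖ * √(C * (B + 1)))).ultrafilter_le_nhds
      ((hyperfilter ℕ).map fun k => inner ℝ g (f (u k))) (by
        rw [le_principal_iff]
        refine Filter.mem_map.2 (univ_mem' fun k => ?_)
        rw [Set.mem_preimage, mem_closedBall_zero_iff]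
        exact (norm_inner_le_norm _ _).trans (by gcongr; exact hfb k))
    exact ⟨a, ha⟩
  have hGdiff : ∀ k l, ‖G (u k - u l)‖ ^ 2 ≤ 4 * B := fun k l => by
    have := parallelogram_law_with_norm ℝ (G (u k)) (G (u l))
    rw [map_sub]
    nlinarith [hB' k, hB' l, sq_nonneg ‖G (u k) + G (u l)‖]
  -- Traces are Cauchy: the energies of differences are at most `4 * B`, so a small ε makes the
  -- gradient term negligible, and the finitely many functionals converge.
  have hT0 : Tendsto (fun p : ℕ × ℕ => ‖T (u p.1 - u p.2)‖ ^ 2) (F ×ˢ F) (𝓝 0) := by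
    rw [Metric.tendsto_nhds]
    intro η hη
    have hB0 : 0 ≤ B := (sq_nonneg _).trans (hB' 0)
    obtain ⟨ι, _, g, hg⟩ := h.compact_trace (η / (2 * (4 * B + 1))) (by positivity)
    have hS : Tendsto (fun p : ℕ × ℕ => ∑ i, inner ℝ (g i) (f (u p.1 - u p.2)) ^ 2) (F ×ˢ F)
        (𝓝 0) := by
      have : ∀ i ∈ Finset.univ, Tendsto (fun p : ℕ × ℕ => inner ℝ (g i) (f (u p.1 - u p.2)) ^ 2)
          (F ×ˢ F) (𝓝 0) := fun i _ => by
        obtain ⟨a, ha⟩ := hinner (g i)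
        have := ((ha.comp tendsto_fst).sub (ha.comp (tendsto_snd (f := F)))).pow 2
        simpa [inner_sub_right, Function.comp_def] using this
      simpa using tendsto_finsetSum _ this
    filter_upwards [hS.eventually_lt_const (half_pos hη)] with p hp
    rw [Real.dist_eq, sub_zero, abs_of_nonneg (by positivity)]
    have h1 : η / (2 * (4 * B + 1)) * ‖G (u p.1 - u p.2)‖ ^ 2 ≤ η / 2 := by
      calc _ ≤ η / (2 * (4 * B + 1)) * (4 * B + 1) := by
            gcongr; linarith [hGdiff p.1 p.2]
        _ = η / 2 := by field_simp
    linarith [hg (u p.1 - u p.2)]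
  -- The parallelogram law bounds the energy of a difference once that of the sum is bounded below.
  -- By `hm` the latter is at least `m` times the squared trace norm of the sum, which tends to 4
  -- since the traces are Cauchy unit vectors.
  have hG0 : Tendsto (fun p : ℕ × ℕ => ‖G (u p.1 - u p.2)‖ ^ 2) (F ×ˢ F) (𝓝 0) := by
    have hlim : Tendsto (fun p : ℕ × ℕ => 2 * ‖G (u p.1)‖ ^ 2 + 2 * ‖G (u p.2)‖ ^ 2
        - m * (4 - ‖T (u p.1 - u p.2)‖ ^ 2)) (F ×ˢ F) (𝓝 (2 * m + 2 * m - m * (4 - 0))) :=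
      (((huF.comp tendsto_fst).const_mul 2).add ((huF.comp tendsto_snd).const_mul 2)).sub
        ((tendsto_const_nhds.sub hT0).const_mul m)
    rw [show 2 * m + 2 * m - m * (4 - 0) = 0 by ring] at hlim
    refine squeeze_zero (fun _ => by positivity) (fun p => ?_) hlim
    have e1 := parallelogram_law_with_norm ℝ (G (u p.1)) (G (u p.2))
    have e2 := parallelogram_law_with_norm ℝ (T (u p.1)) (T (u p.2))
    have e3 := hm (u p.1 + u p.2) (by rw [map_add, inner_add_left, hu0, hu0, add_zero])
    rw [hu1, hu1] at e2
    rw [map_sub, map_sub]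
    rw [map_add, map_add] at e3
    have e4 : ‖T (u p.1) + T (u p.2)‖ ^ 2 = 4 - ‖T (u p.1) - T (u p.2)‖ ^ 2 := by linarith
    rw [e4] at e3
    linarith
  have hV0 : Tendsto (fun p : ℕ × ℕ => ‖u p.1 - u p.2‖ ^ 2) (F ×ˢ F) (𝓝 0) := by
    have hlim := ((hG0.add hT0).const_mul C).add hG0
    simp only [add_zero, mul_zero] at hlim
    refine squeeze_zero (fun _ => by positivity) (fun p => ?_) hlim
    have e1 := hC (u p.1 - u p.2)
    rw [h.norm_eq]
    rcases max_choice ‖f (u p.1 - u p.2)‖ ‖G (u p.1 - u p.2)‖ with e | e <;> rw [e]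
    · have := sq_nonneg ‖G (u p.1 - u p.2)‖
      linarith
    · have := sq_nonneg ‖f (u p.1 - u p.2)‖
      linarith
  have hcauchy : Cauchy (map u F) := by
    rw [cauchy_map_iff, Metric.uniformity_eq_comap_nhds_zero, tendsto_comap_iff]
    refine ⟨inferInstance, ?_⟩
    have := hV0.sqrt
    simpa [Function.comp_def, dist_eq_norm] using this
  exact CompleteSpace.complete hcauchy

/-- The Steklov quotient attains its minimum over functions with mean-free trace. -/
lemma exists_minimizer [CompleteSpace V] (h : IsRobinTriple f G T one) :
    ∃ u, inner ℝ (T u) (T one) = 0 ∧ ‖T u‖ = 1 ∧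
      ∀ w, inner ℝ (T w) (T one) = 0 → ‖G u‖ ^ 2 * ‖T w‖ ^ 2 ≤ ‖G w‖ ^ 2 := by
  set S : Set ℝ := {s | ∃ u, inner ℝ (T u) (T one) = 0 ∧ ‖T u‖ = 1 ∧ ‖G u‖ ^ 2 = s} with hS
  have hSne : S.Nonempty := by
    obtain ⟨u, h0, h1⟩ := h.exists_unit_orthogonal
    exact ⟨_, u, h0, h1, rfl⟩
  have hSb : BddBelow S := ⟨0, by rintro _ ⟨u, -, -, rfl⟩; positivity⟩
  have hm : ∀ w, inner ℝ (T w) (T one) = 0 → sInf S * ‖T w‖ ^ 2 ≤ ‖G w‖ ^ 2 := by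
    intro w hw
    rcases eq_or_ne (T w) 0 with h0 | h0
    · rw [h0]; simp
    have h1 : sInf S ≤ ‖G (‖T w‖⁻¹ • w)‖ ^ 2 := csInf_le hSb ⟨‖T w‖⁻¹ • w, by
      rw [map_smul, real_inner_smul_left, hw, mul_zero], by
      rw [map_smul]; exact norm_smul_inv_norm (𝕜 := ℝ) h0, rfl⟩
    rw [map_smul, norm_smul, norm_inv, norm_norm, mul_pow, inv_pow, ← div_eq_inv_mul,
      le_div_iff₀ (by positivity)] at h1
    exact h1
  obtain ⟨s, -, hs, hsS⟩ := exists_seq_tendsto_sInf hSne hSb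
  choose u hu0 hu1 hus using hsS
  obtain ⟨u₁, hu₁⟩ := h.exists_tendsto_of_minimizing hm hu0 hu1 (by simpa only [hus] using hs)
  have hTu : Tendsto (fun k => T (u k)) (hyperfilter ℕ : Filter ℕ) (𝓝 (T u₁)) :=
    (T.continuous.tendsto u₁).comp hu₁
  have hGu : Tendsto (fun k => ‖G (u k)‖ ^ 2) (hyperfilter ℕ : Filter ℕ) (𝓝 (‖G u₁‖ ^ 2)) :=
    ((G.continuous.tendsto u₁).comp hu₁).norm.pow 2
  have hmin : ‖G u₁‖ ^ 2 = sInf S :=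
    tendsto_nhds_unique hGu (by simpa only [hus] using hs.mono_left Nat.hyperfilter_le_atTop)
  refine ⟨u₁, ?_, ?_, by rwa [hmin]⟩
  · have := hTu.inner (𝕜 := ℝ) (tendsto_const_nhds (x := T one))
    simp only [hu0] at this
    exact tendsto_nhds_unique this tendsto_const_nhds
  · have := hTu.norm
    simp only [hu1] at this
    exact tendsto_nhds_unique this tendsto_const_nhds

/-- The least nonzero Steklov eigenvalue, with its variational characterisation. -/
lemma exists_steklov [CompleteSpace V] (h : IsRobinTriple f G T one) :
    ∃ m : ℝ, 0 < m ∧ (∀ w, inner ℝ (T w) (T one) = 0 → m * ‖T w‖ ^ 2 ≤ ‖G w‖ ^ 2) ∧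
      ∃ u, inner ℝ (T u) (T one) = 0 ∧ ‖T u‖ = 1 ∧
        ∀ w, inner ℝ (G u) (G w) = m * inner ℝ (T u) (T w) := by
  obtain ⟨u, hu0, hu1, hm⟩ := h.exists_minimizer
  have hGu : G u ≠ 0 := by
    intro h0
    obtain ⟨c, rfl⟩ := h.ker u h0
    rw [map_smul, real_inner_smul_left, real_inner_self_eq_norm_sq] at hu0
    rcases mul_eq_zero.1 hu0 with hc | hc
    · rw [hc] at hu1; simp at hu1
    · exact h.map_one_ne_zero (by simpa using hc)
  refine ⟨‖G u‖ ^ 2, by positivity, hm, u, hu0, hu1, ?_⟩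
  set m := ‖G u‖ ^ 2 with hmdef
  have key : ∀ w, inner ℝ (T w) (T one) = 0 → inner ℝ (G u) (G w) = m * inner ℝ (T u) (T w) := by
    intro w hw
    -- Minimality along `u + t • w` makes this quadratic nonnegative for all `t`. Its constant term
    -- is zero, so the discriminant forces the linear coefficient to vanish.
    have hq : ∀ t : ℝ, 0 ≤ (‖G w‖ ^ 2 - m * ‖T w‖ ^ 2) * (t * t)
        + 2 * (inner ℝ (G u) (G w) - m * inner ℝ (T u) (T w)) * t + 0 := by
      intro t
      have h1 := hm (u + t • w) (by
        rw [map_add, map_smul, inner_add_left, real_inner_smul_left, hu0, hw, mul_zero, add_zero])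
      rw [map_add, map_smul, map_add, map_smul, norm_add_sq_real, norm_add_sq_real, norm_smul,
        norm_smul, mul_pow, mul_pow, real_inner_smul_right, real_inner_smul_right, hu1,
        Real.norm_eq_abs, sq_abs, ← hmdef] at h1
      linarith
    have h2 := discrim_le_zero hq
    rw [discrim] at h2
    have h3 : (2 * (inner ℝ (G u) (G w) - m * inner ℝ (T u) (T w))) ^ 2 ≤ 0 := by linarith
    have h4 := pow_eq_zero_iff two_ne_zero |>.1 (le_antisymm h3 (sq_nonneg _))
    linarith
  intro w
  -- A general `w` differs from a mean-free one by a multiple of `one`, to which both sides are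
  -- blind: `G one = 0`, and `T u` is orthogonal to `T one`.
  obtain ⟨c, hc⟩ := h.exists_sub_smul_orthogonal w
  have h1 := key _ hc
  simpa [inner_sub_right, real_inner_smul_right, h.map_one, hu0] using h1

/-- Testing an eigenfunction for a nonzero eigenvalue with `one` shows that its trace is mean-free,
so the variational bound applies to it. Its trace is nonzero, for otherwise its energy would vanish
too and Friedrichs' inequality would make it zero. -/
lemma isLeast_steklov (h : IsRobinTriple f G T one) {m : ℝ} (hm0 : 0 < m)
    (hm : ∀ w, inner ℝ (T w) (T one) = 0 → m * ‖T w‖ ^ 2 ≤ ‖G w‖ ^ 2) {u : V}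
    (hu1 : ‖T u‖ = 1) (hu : ∀ w, inner ℝ (G u) (G w) = m * inner ℝ (T u) (T w)) :
    IsLeast {σ : ℝ | σ ≠ 0 ∧ ∃ u : V, u ≠ 0 ∧
      ∀ w, inner ℝ (G u) (G w) = σ * inner ℝ (T u) (T w)} m := by
  refine ⟨⟨hm0.ne', u, by rintro rfl; simp at hu1, hu⟩, ?_⟩
  rintro σ ⟨hσ, v, hv0, hv⟩
  have h1 : inner ℝ (T v) (T one) = 0 := by
    have := hv one
    rw [h.map_one, inner_zero_right, eq_comm, mul_eq_zero] at this
    exact this.resolve_left hσ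
  have h2 := hv v
  rw [real_inner_self_eq_norm_sq, real_inner_self_eq_norm_sq] at h2
  have h3 := hm v h1
  rw [h2] at h3
  refine le_of_mul_le_mul_right h3 ?_
  by_contra h4
  have h5 : ‖T v‖ ^ 2 = 0 := le_antisymm (not_lt.1 h4) (sq_nonneg _)
  obtain ⟨C, -, hC⟩ := h.friedrichs
  have h6 := hC v
  rw [h2, h5] at h6
  have h7 := h.normSq_pos hv0
  linarith

lemma finrank_span_pair (h : IsRobinTriple f G T one) {u : V}
    (hu0 : inner ℝ (T u) (T one) = 0) (hu1 : ‖T u‖ = 1) :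
    Module.finrank ℝ (Submodule.span ℝ {one, u}) = 2 := by
  have hli : LinearIndependent ℝ ![one, u] := by
    rw [LinearIndependent.pair_iff' h.one_ne_zero]
    rintro c rfl
    rw [map_smul, real_inner_smul_left, real_inner_self_eq_norm_sq] at hu0
    rcases mul_eq_zero.1 hu0 with hc | hc
    · rw [hc] at hu1; simp at hu1
    · exact h.map_one_ne_zero (by simpa using hc)
  have := finrank_span_eq_card hli
  rwa [Matrix.range_cons, Matrix.range_cons, Matrix.range_empty, Set.union_empty,
    Set.singleton_union, Fintype.card_fin] at this

/-- On `a • one + b • u` the cross terms vanish and the numerator is `α * a ^ 2 * ‖T one‖ ^ 2 + b ^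
2 * (m + α)`, with both terms nonpositive. -/
lemma ev_two_nonpos (h : IsRobinTriple f G T one) {m : ℝ} (hm0 : 0 < m) {u : V}
    (hu0 : inner ℝ (T u) (T one) = 0) (hu1 : ‖T u‖ = 1)
    (hu : ∀ w, inner ℝ (G u) (G w) = m * inner ℝ (T u) (T w)) {α : ℝ} (hα : α ≤ -m) :
    ev f G T 2 α ≤ 0 := by
  refine h.ev_le two_pos (h.finrank_span_pair hu0 hu1) fun v hv _ => ?_
  obtain ⟨a, b, rfl⟩ := Submodule.mem_span_pair.1 hv
  refine div_nonpos_of_nonpos_of_nonneg ?_ (by positivity)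
  have hGu : ‖G u‖ ^ 2 = m := by
    have := hu u
    rwa [real_inner_self_eq_norm_sq, real_inner_self_eq_norm_sq, hu1, one_pow, mul_one] at this
  rw [map_add, map_smul, map_smul, h.map_one, smul_zero, zero_add, norm_smul, mul_pow, hGu,
    map_add, map_smul, map_smul, norm_add_sq_real, real_inner_smul_left, real_inner_smul_right,
    real_inner_comm, hu0, norm_smul, norm_smul, hu1, Real.norm_eq_abs, Real.norm_eq_abs, mul_one,
    sq_abs, mul_pow, sq_abs]
  have h1 : α * (a ^ 2 * ‖T one‖ ^ 2) ≤ 0 :=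
    mul_nonpos_of_nonpos_of_nonneg (by linarith) (by positivity)
  have h2 : b ^ 2 * (m + α) ≤ 0 := mul_nonpos_of_nonneg_of_nonpos (sq_nonneg _) (by linarith)
  linarith

/-- A two-dimensional subspace meets the kernel of the functional `v ↦ ⟪T one, T v⟫` nontrivially.
On such `v` the bound by `m` gives coercivity, and Friedrichs' inequality makes the lower bound
uniform over all subspaces. -/
lemma ev_two_pos (h : IsRobinTriple f G T one) {m : ℝ} (hm0 : 0 < m)
    (hm : ∀ w, inner ℝ (T w) (T one) = 0 → m * ‖T w‖ ^ 2 ≤ ‖G w‖ ^ 2) {U : Submodule ℝ V}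
    (hU : Module.finrank ℝ U = 2) {α : ℝ} (hα : -m < α) : 0 < ev f G T 2 α := by
  -- Coercivity with constant `δ` follows from `δ * (m + 1) ≤ m + α` and `δ ≤ 1`; both hold with
  -- room to spare.
  set δ := min (1 / 2) ((m + α) / (2 * (m + 1))) with hδ
  have hδ0 : 0 < δ := lt_min (by norm_num) (div_pos (by linarith) (by linarith))
  obtain ⟨c, hc0, hc⟩ := h.exists_pos_le_rq (α := α) hδ0
  refine hc0.trans_le (h.le_ev two_pos hU fun W hW s hs => ?_)
  have hfd : FiniteDimensional ℝ W := Module.finite_of_finrank_pos (by rw [hW]; exact two_pos)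
  let L : W →ₗ[ℝ] ℝ := ((innerSL ℝ (T one)).comp T : V →ₗ[ℝ] ℝ).comp W.subtype
  obtain ⟨⟨v, hvW⟩, hv, hv0⟩ := Submodule.exists_mem_ne_zero_of_ne_bot
    (LinearMap.ker_ne_bot_of_finrank_lt (f := L) (by rw [hW, Module.finrank_self]; norm_num))
  have hv0 : v ≠ 0 := fun h0 => hv0 (Subtype.ext h0)
  have hv1 : inner ℝ (T v) (T one) = 0 := by
    rw [real_inner_comm]; exact hv
  refine (hc v hv0 ?_).trans (hs v hvW hv0)
  have h1 := hm v hv1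
  have hd1 : δ ≤ 1 / 2 := min_le_left _ _
  have hd2 : δ * (m + 1) ≤ (m + α) := by
    have : δ ≤ (m + α) / (2 * (m + 1)) := min_le_right _ _
    rw [le_div_iff₀ (by linarith)] at this
    nlinarith
  have h2 : (1 - δ) * (m * ‖T v‖ ^ 2) ≤ (1 - δ) * ‖G v‖ ^ 2 :=
    mul_le_mul_of_nonneg_left h1 (by linarith)
  have h3 : δ * (m + 1) * ‖T v‖ ^ 2 ≤ (m + α) * ‖T v‖ ^ 2 := by gcongr
  linarith

/-- After regrouping as `(α / λ₁) * λ₂`, this is a product of nonnegative nondecreasing factors. A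
change of sign in `λ₁` is harmless because `α / λ₁` stays positive. -/
lemma monotoneOn_mul_ratio (h : IsRobinTriple f G T one) {m : ℝ} (hm0 : 0 < m)
    (hm : ∀ w, inner ℝ (T w) (T one) = 0 → m * ‖T w‖ ^ 2 ≤ ‖G w‖ ^ 2) {U : Submodule ℝ V}
    (hU : Module.finrank ℝ U = 2) :
    MonotoneOn (fun α : ℝ => α * (ev f G T 2 α / ev f G T 1 α)) (Set.Ioi (-m) \ {0}) := by
  rintro α ⟨hα, hα0⟩ β ⟨hβ, hβ0⟩ hαβ
  have h1 := h.div_ev_one_mono hα0 hβ0 hαβ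
  have h2 := h.ev_mono two_pos hU hαβ
  have h3 := (h.div_ev_one_pos hβ0).le
  have h4 := (h.ev_two_pos hm0 hm hU hα).le
  calc α * (ev f G T 2 α / ev f G T 1 α) = α / ev f G T 1 α * ev f G T 2 α := by ring
    _ ≤ β / ev f G T 1 β * ev f G T 2 β := mul_le_mul h1 h2 h4 h3
    _ = _ := by ring

end IsRobinTriple

end Abstract

/-! ### Passage from integrals on the domain to the abstract triple -/

lemma integral_inner_Lp {α F : Type*} [MeasurableSpace α] [NormedAddCommGroup F]
    [InnerProductSpace ℝ F] {μ : Measure α} (f g : Lp F 2 μ) :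
    ∫ x, inner ℝ (f x) (g x) ∂μ = inner ℝ f g := rfl

lemma integral_norm_sq_Lp {α F : Type*} [MeasurableSpace α] [NormedAddCommGroup F]
    [InnerProductSpace ℝ F] {μ : Measure α} (f : Lp F 2 μ) :
    ∫ x, ‖f x‖ ^ 2 ∂μ = ‖f‖ ^ 2 := by
  rw [← real_inner_self_eq_norm_sq, ← integral_inner_Lp]
  simp_rw [real_inner_self_eq_norm_sq]

lemma integral_sq_Lp {α : Type*} [MeasurableSpace α] {μ : Measure α} (f : Lp ℝ 2 μ) :
    ∫ x, f x ^ 2 ∂μ = ‖f‖ ^ 2 := by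
  rw [← integral_norm_sq_Lp]
  simp_rw [Real.norm_eq_abs, sq_abs]

lemma integral_mul_Lp {α : Type*} [MeasurableSpace α] {μ : Measure α} (f g : Lp ℝ 2 μ) :
    ∫ x, f x * g x ∂μ = inner ℝ f g := by
  rw [← integral_inner_Lp]
  exact integral_congr_ae (Eventually.of_forall fun x => mul_comm _ _)

section

variable {n : ℕ} {Ω : Set (E n)} {T : H1 Ω →L[ℝ] Lp ℝ 2 (surf Ω)}

lemma robinEigenvalue_eq_ev (hT : ∀ u, trace u = T u) (k : ℕ) :
    robinEigenvalue Ω k = ev (fnL Ω) (gradL Ω) T k := by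
  have h1 : ∀ (α : ℝ) (u : H1 Ω), rayleigh α u = rq (fnL Ω) (gradL Ω) T α u := fun α u => by
    rw [rayleigh, rq, integral_norm_sq_Lp, integral_sq_Lp, integral_sq_Lp, hT]; rfl
  funext α
  simp_rw [robinEigenvalue, ev, h1]

lemma isSteklovEigenvalue_iff (hT : ∀ u, trace u = T u) (σ : ℝ) :
    IsSteklovEigenvalue Ω σ ↔ ∃ u : H1 Ω, u ≠ 0 ∧
      ∀ w, inner ℝ (gradL Ω u) (gradL Ω w) = σ * inner ℝ (T u) (T w) := by
  simp_rw [IsSteklovEigenvalue, integral_inner_Lp, integral_mul_Lp, hT]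
  rfl

lemma exists_isRobinTriple (hn : 1 ≤ n) (hΩ : IsBoundedLipschitzDomain Ω) :
    ∃ (T : H1 Ω →L[ℝ] Lp ℝ 2 (surf Ω)) (one : H1 Ω), (∀ u, trace u = T u) ∧
      IsRobinTriple (fnL Ω) (gradL Ω) T one := by
  obtain ⟨T, hT, h2, h3, one, h4, h5, h6, h7⟩ := exists_trace_structure hn hΩ
  exact ⟨T, one, hT, norm_H1, fun _ => eq_zero_of_fnL_eq_zero hΩ.isOpen, h2, h3, h4, h5, h6, h7⟩

end

end Robin

theorem mainTheorem12 {n : ℕ} (hn : 1 ≤ n) (Ω : Set (Robin.E n))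
    (hΩ : Robin.IsBoundedLipschitzDomain Ω) :
    IsLeast {σ : ℝ | σ ≠ 0 ∧ Robin.IsSteklovEigenvalue Ω σ} (Robin.steklovSigma1 Ω) ∧
    (∀ α : ℝ, Robin.robinEigenvalue Ω 1 α = 0 ↔ α = 0) ∧
    (∀ α : ℝ, -Robin.steklovSigma1 Ω < α ↔ 0 < Robin.robinEigenvalue Ω 2 α) ∧
    MonotoneOn
      (fun α : ℝ => α * (Robin.robinEigenvalue Ω 2 α / Robin.robinEigenvalue Ω 1 α))
      (Set.Ioi (-Robin.steklovSigma1 Ω) \ {0}) := by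
  obtain ⟨T, one, hT, h⟩ := Robin.exists_isRobinTriple hn hΩ
  obtain ⟨m, hm0, hm, u, hu0, hu1, hu⟩ := h.exists_steklov
  have hleast : IsLeast {σ : ℝ | σ ≠ 0 ∧ Robin.IsSteklovEigenvalue Ω σ} m := by
    simp_rw [Robin.isSteklovEigenvalue_iff hT]
    exact h.isLeast_steklov hm0 hm hu1 hu
  have hσ : Robin.steklovSigma1 Ω = m := hleast.csInf_eq
  have hU := h.finrank_span_pair hu0 hu1
  rw [hσ, Robin.robinEigenvalue_eq_ev hT, Robin.robinEigenvalue_eq_ev hT]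
  refine ⟨hleast, fun α => h.ev_one_eq_zero_iff, fun α => ⟨h.ev_two_pos hm0 hm hU, fun hpos => ?_⟩,
    h.monotoneOn_mul_ratio hm0 hm hU⟩
  by_contra hα
  exact (h.ev_two_nonpos hm0 hu0 hu1 hu (not_lt.1 hα)).not_gt hpos
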